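/- Let $(M,g)=(\mathbb{R}\times\Sigma,\;V^2dt^2-h)$ be a standard static spacetime: $(\Sigma,h)$ is a smooth (Hausdorff, second countable, finite-dimensional, not necessarily connected) Riemannian manifold, $V\in C^\infty(\Sigma)$, $V>0$, and $\partial_t$ is the time orientation. Put $\Sigma_t=\{t\}\times\Sigma$. Let $d$ be the distance on $\Sigma$ induced by the Riemannian metric $V^{-2}h$ ($d=\infty$ between different components); "$\Sigma$ is complete" means complete for $d$, and $C(A,t)=\{p\in\Sigma: d(p,A)\le t\}$. For $A\subseteq M$ let $J^{\pm}(A)$ be the causal future/past of $A$ (the points of $A$ and those reached from $A$ by smooth future- /past-pointing causal curves), $J(A)=J^+(A)\cup J^-(A)$. Let $D^+(A)$ (resp. $D^-(A)$) be the set of $p\in M$ such that every past- (resp. future-) inextendible future-pointing smooth causal curve through $p$ meets $A$, and $D(A)=D^+(A)\cup D^-(A)$. For a compact set $K\subseteq\Sigma_0$ define $$t^\infty(K)=\sup\{t\ge 0: J^+(K)\cap\Sigma_t\text{ is compact}\}\in[0,\infty],$$ $t_0(K)=0$ and $t_{n+1}(K)=\sup\{t\ge 0: J^+(K)\cap\Sigma_t\subseteq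 D(\Sigma_{t_n(K)})\}$, where $t_{n+1}(K):=\infty$ if $t_n(K)=\infty$. Then, for every compact $K\subseteq\Sigma_0$: 1. If $J(K)\cap\Sigma_t$ is compact, then $J(K)\cap\Sigma_{t'}$ is compact whenever $|t'|\le|t|$. 2. $t^\infty(K)\in(0,\infty]$. 3. For $t\in\mathbb{R}$, $J(K)\cap\Sigma_t$ is compact if and only if $|t|<t^\infty(K)$. 4. If $\Sigma$ is complete, then $C(\pi(K),t)$ is compact for all $t\ge 0$, where $\pi(t,x)=x$, and $t^\infty(K)=\infty$. 5. If $\Sigma$ is connected, $K\neq\emptyset$ and $t^\infty(K)=\infty$, then $\Sigma$ is complete. 6. For $t\ge 0$, $J(K)\cap\Sigma_t\subseteq D(\Sigma_0)$ if and only if $t<t^\infty(K)/2$; and $t_1(K)=t^\infty(K)/2$. 7. For $n\ge 0$ and real $t\ge t_n(K)$, $J(K)\cap\Sigma_t\subseteq D(\Sigma_{t_n(K)})$ if and only if $t<(1-2^{-(n+1)})\,t^\infty(K)$. 8. $t_n(K)=(1-2^{-n})\,t^\infty(K)$ for all $n\ge 0$ (with $0\cdot\infty=0$); this sequence is nondecreasing,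 strictly increasing if $t^\infty(K)<\infty$, and converges to $t^\infty(K)$. Moreover, without connectedness: if $t^\infty(K)=\infty$ for every non-empty compact $K\subseteq\Sigma_0$, then $\Sigma$ is complete. -/

import Mathlib

open Set Filter Bundle Manifold
open scoped ContDiff ENNReal Topology

/-- A standard static spacetime `(ℝ × S, V² dt² - h)`: here `(S, h)` is a smooth Riemannian manifold
modelled on the finite-dimensional space `E` and `V` is a smooth positive function on `S`. -/
structure StandardStaticSpacetime
    (E : Type*) [NormedAddCommGroup E] [NormedSpace ℝ E]
    (S : Type*) [TopologicalSpace S] [ChartedSpace E S] [IsManifold 𝓘(ℝ, E) ∞ S] where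
  /-- The Riemannian metric on `S`. -/
  h : ContMDiffRiemannianMetric 𝓘(ℝ, E) ∞ E (fun x : S => TangentSpace 𝓘(ℝ, E) x)
  /-- The lapse function. -/
  V : S → ℝ
  V_smooth : ContMDiff 𝓘(ℝ, E) 𝓘(ℝ, ℝ) ∞ V
  V_pos : ∀ x, 0 < V x

namespace StandardStaticSpacetime

noncomputable section

variable {E : Type*} [NormedAddCommGroup E] [NormedSpace ℝ E]
  {S : Type*} [TopologicalSpace S] [ChartedSpace E S] [IsManifold 𝓘(ℝ, E) ∞ S]

/-! ### The distance on `S` -/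

/-- The smooth Riemannian metric `V⁻² h` on `S`. -/
def conformalMetric (M : StandardStaticSpacetime E S) :
    ContMDiffRiemannianMetric 𝓘(ℝ, E) ∞ E (fun x : S => TangentSpace 𝓘(ℝ, E) x) where
  inner x := (M.V x ^ 2)⁻¹ • M.h.inner x
  symm x v w := by
    simp [M.h.symm x v w]
  pos x v hv := by
    have h1 := M.h.pos x v hv
    have h2 := M.V_pos x
    simp only [smul_apply, smul_eq_mul]
    positivity
  isVonNBounded x := by
    have hV := M.V_pos x
    have hb := M.h.isVonNBounded x
    refine (hb.image (M.V x • ContinuousLinearMap.id ℝ (TangentSpace 𝓘(ℝ, E) x))).subset ?_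
    intro v hv
    refine ⟨(M.V x)⁻¹ • v, ?_, ?_⟩
    · have hv' : (M.V x ^ 2)⁻¹ * M.h.inner x v v < 1 := by simpa using hv
      have : M.h.inner x ((M.V x)⁻¹ • v) ((M.V x)⁻¹ • v) = (M.V x ^ 2)⁻¹ * M.h.inner x v v := by
        simp only [map_smul, smul_apply, smul_eq_mul]
        ring
      change M.h.inner x ((M.V x)⁻¹ • v) ((M.V x)⁻¹ • v) < 1
      rw [this]
      exact hv'
    · simp [smul_smul, hV.ne']
  contMDiff := by
    have hV : ContMDiff 𝓘(ℝ, E) 𝓘(ℝ, ℝ) ∞ (fun x => (M.V x ^ 2)⁻¹) :=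
      (M.V_smooth.pow 2).inv₀ (fun x => (pow_pos (M.V_pos x) 2).ne')
    exact hV.smul_section M.h.contMDiff

/-- The (extended) distance on `S` induced by the Riemannian metric `V⁻² h`: the infimum of the
lengths of the curves joining the two points (it is `∞` between different components). -/
def dist (M : StandardStaticSpacetime E S) (p q : S) : ℝ≥0∞ :=
  letI : RiemannianBundle (fun x : S => TangentSpace 𝓘(ℝ, E) x) :=
    ⟨M.conformalMetric.toRiemannianMetric⟩
  riemannianEDist 𝓘(ℝ, E) p q

/-- `C(A, t) = {p | d(p, A) ≤ t}`. -/
def closedThickening (M : StandardStaticSpacetime E S) (A : Set S) (t : ℝ) : Set S :=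
  {p | ⨅ q ∈ A, M.dist p q ≤ ENNReal.ofReal t}

/-- `S` is complete for the distance induced by `V⁻² h`: every Cauchy sequence converges. -/
def IsComplete (M : StandardStaticSpacetime E S) : Prop :=
  ∀ u : ℕ → S,
    (∀ ε : ℝ≥0∞, 0 < ε → ∃ N : ℕ, ∀ m ≥ N, ∀ n ≥ N, M.dist (u m) (u n) < ε) →
      ∃ p : S, Tendsto (fun n => M.dist (u n) p) atTop (𝓝 0)

/-! ### The Lorentzian metric and causal curves -/

/-- The tangent space of `ℝ × S` at `p`. -/
abbrev Tangent (E : Type*) [NormedAddCommGroup E] [NormedSpace ℝ E]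
    {S : Type*} [TopologicalSpace S] [ChartedSpace E S] (p : ℝ × S) : Type _ :=
  TangentSpace (𝓘(ℝ, ℝ).prod 𝓘(ℝ, E)) p

/-- The component `dt(v)` of a tangent vector of `ℝ × S`. -/
def dtime {p : ℝ × S} (v : Tangent E p) : ℝ :=
  mfderiv (𝓘(ℝ, ℝ).prod 𝓘(ℝ, E)) 𝓘(ℝ, ℝ) (Prod.fst : ℝ × S → ℝ) p v

/-- The component of a tangent vector of `ℝ × S` along `S`. -/
def dspace {p : ℝ × S} (v : Tangent E p) : TangentSpace 𝓘(ℝ, E) p.2 :=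
  mfderiv (𝓘(ℝ, ℝ).prod 𝓘(ℝ, E)) 𝓘(ℝ, E) (Prod.snd : ℝ × S → S) p v

/-- The Lorentzian metric `g = V² dt² - h`. -/
def g (M : StandardStaticSpacetime E S) (p : ℝ × S) (v w : Tangent E p) : ℝ :=
  M.V p.2 ^ 2 * (dtime v * dtime w) - M.h.inner p.2 (dspace v) (dspace w)

/-- The vector field `∂/∂t`, the velocity of `t ↦ (t, x)`, which gives the time orientation. -/
def timeField (E : Type*) [NormedAddCommGroup E] [NormedSpace ℝ E]
    {S : Type*} [TopologicalSpace S] [ChartedSpace E S] (p : ℝ × S) : Tangent E p :=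
  mfderiv 𝓘(ℝ, ℝ) (𝓘(ℝ, ℝ).prod 𝓘(ℝ, E)) (fun t : ℝ => (t, p.2)) p.1 (1 : ℝ)

/-- The velocity at parameter `s` of a curve with parameter domain `I`
(one-sided if `s` is an endpoint of `I`). -/
def velocity (E : Type*) [NormedAddCommGroup E] [NormedSpace ℝ E]
    {S : Type*} [TopologicalSpace S] [ChartedSpace E S]
    (γ : ℝ → ℝ × S) (I : Set ℝ) (s : ℝ) : Tangent E (γ s) :=
  mfderivWithin 𝓘(ℝ, ℝ) (𝓘(ℝ, ℝ).prod 𝓘(ℝ, E)) γ I s (1 : ℝ)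

/-- Future-pointing causal vectors: nonzero, `g(v, v) ≥ 0` and `g(v, ∂/∂t) > 0`. -/
def IsFutureCausal (M : StandardStaticSpacetime E S) {p : ℝ × S} (v : Tangent E p) : Prop :=
  v ≠ 0 ∧ 0 ≤ M.g p v v ∧ 0 < M.g p v (timeField E p)

/-- `γ`, restricted to the interval `I`, is a smooth future-pointing causal curve. -/
def IsFutureCausalCurveOn (M : StandardStaticSpacetime E S) (γ : ℝ → ℝ × S) (I : Set ℝ) : Prop :=
  I.OrdConnected ∧ ContMDiffOn 𝓘(ℝ, ℝ) (𝓘(ℝ, ℝ).prod 𝓘(ℝ, E)) ∞ γ I ∧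
    ∀ s ∈ I, M.IsFutureCausal (velocity E γ I s)

/-! ### Causal future and past, Cauchy developments -/

/-- The hypersurface `Σ_t = {t} × S`. -/
def slice (S : Type*) (t : ℝ) : Set (ℝ × S) := {p | p.1 = t}

/-- The causal future `J⁺(A)`: the points of `A` and the endpoints of smooth future-pointing causal
curves that start in `A`. -/
def Jplus (M : StandardStaticSpacetime E S) (A : Set (ℝ × S)) : Set (ℝ × S) :=
  {q | q ∈ A ∨ ∃ (a b : ℝ) (γ : ℝ → ℝ × S), a < b ∧
    M.IsFutureCausalCurveOn γ (Icc a b) ∧ γ a ∈ A ∧ γ b = q}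

/-- The causal past `J⁻(A)`. -/
def Jminus (M : StandardStaticSpacetime E S) (A : Set (ℝ × S)) : Set (ℝ × S) :=
  {q | q ∈ A ∨ ∃ (a b : ℝ) (γ : ℝ → ℝ × S), a < b ∧
    M.IsFutureCausalCurveOn γ (Icc a b) ∧ γ b ∈ A ∧ γ a = q}

/-- `J(A) = J⁺(A) ∪ J⁻(A)`. -/
def J (M : StandardStaticSpacetime E S) (A : Set (ℝ × S)) : Set (ℝ × S) :=
  M.Jplus A ∪ M.Jminus A

/-- The curve `γ` with parameter interval `I` has no past endpoint: `γ(s)` has no limit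
as `s` decreases through `I` to the lower end of `I`. -/
def PastInextendible {X : Type*} [TopologicalSpace X] (γ : ℝ → X) (I : Set ℝ) : Prop :=
  ¬ ∃ q : X, ∀ U ∈ 𝓝 q, ∃ s ∈ I, ∀ s' ∈ I, s' ≤ s → γ s' ∈ U

/-- The curve `γ` with parameter interval `I` has no future endpoint. -/
def FutureInextendible {X : Type*} [TopologicalSpace X] (γ : ℝ → X) (I : Set ℝ) : Prop :=
  ¬ ∃ q : X, ∀ U ∈ 𝓝 q, ∃ s ∈ I, ∀ s' ∈ I, s ≤ s' → γ s' ∈ U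

/-- The future Cauchy development `D⁺(A)`: the points `p` such that every past-inextendible
future-pointing smooth causal curve through `p` meets `A`. -/
def Dplus (M : StandardStaticSpacetime E S) (A : Set (ℝ × S)) : Set (ℝ × S) :=
  {p | ∀ (γ : ℝ → ℝ × S) (I : Set ℝ), M.IsFutureCausalCurveOn γ I → PastInextendible γ I →
    (∃ s ∈ I, γ s = p) → ∃ s ∈ I, γ s ∈ A}

/-- The past Cauchy development `D⁻(A)`. -/
def Dminus (M : StandardStaticSpacetime E S) (A : Set (ℝ × S)) : Set (ℝ × S) :=
  {p | ∀ (γ : ℝ → ℝ × S) (I : Set ℝ), M.IsFutureCausalCurveOn γ I → FutureInextendible γ I →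
    (∃ s ∈ I, γ s = p) → ∃ s ∈ I, γ s ∈ A}

/-- The Cauchy development `D(A) = D⁺(A) ∪ D⁻(A)`. -/
def D (M : StandardStaticSpacetime E S) (A : Set (ℝ × S)) : Set (ℝ × S) :=
  M.Dplus A ∪ M.Dminus A

/-! ### The times attached to `K` -/

/-- `t^∞(K) = sup {t ≥ 0 | J⁺(K) ∩ Σ_t is compact}`, an element of `[0, ∞]`. -/
def tInfty (M : StandardStaticSpacetime E S) (K : Set (ℝ × S)) : ℝ≥0∞ :=
  sSup (ENNReal.ofReal '' {t : ℝ | 0 ≤ t ∧ IsCompact (M.Jplus K ∩ slice S t)})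

open Classical in
/-- The iterated times `t_0(K) = 0`, `t_{n+1}(K) = sup {t ≥ 0 | J⁺(K) ∩ Σ_t ⊆ D(Σ_{t_n(K)})}`,
elements of `[0, ∞]`; once the value `∞` is reached it is kept. -/
def tSeq (M : StandardStaticSpacetime E S) (K : Set (ℝ × S)) : ℕ → ℝ≥0∞
  | 0 => 0
  | n + 1 =>
    if M.tSeq K n = ⊤ then ⊤
    else sSup (ENNReal.ofReal ''
      {t : ℝ | 0 ≤ t ∧ M.Jplus K ∩ slice S t ⊆ M.D (slice S (M.tSeq K n).toReal)})

end

end StandardStaticSpacetime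

/-! Causality is conformally invariant, so g may be replaced by dt² − V⁻²h: a curve is future causal
when its time component has positive derivative and dominates the V⁻²h-speed of its projection
(`isFutureCausal_velocity_iff`). Hence J(K) ∩ Σ_t contains every point at distance less than |t|
from π(K) and none at distance more than |t|. It is compact exactly when the ball C(π(K), |t|) is
compact (`isCompact_J_inter_slice_iff`). As S is locally compact, the radii t ≥ 0 with compact balls
form an interval [0, t^∞(K)).

For τ < t, the point (t, x) lies in D(Σ_τ) iff C({x}, t − τ) is compact (`mem_D_slice_iff`). Over a
compact ball a causal curve cannot end before it meets Σ_τ. At the first non-compact radius there is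
a minimising ray without end point (`exists_minimizing_ray`), and its graph, run into the past, is
inextendible and stays above Σ_τ. Over all points of J(K) ∩ Σ_t the radii add up: the slice lies in
D(Σ_τ) iff C(π(K), 2t − τ) is compact (`J_inter_slice_subset_D_iff`). So t_{n+1} is the midpoint of
t_n and t^∞, and the remaining time is halved at each step. Completeness is linked to compact balls
by the Hopf–Rinow argument for length spaces.

The difficulty is regularity: causal curves are smooth, the distance is defined by C¹ curves, and
limits of curves are merely Lipschitz. Two results bridge this. `reachDist_eq_dist` obtains the
distance from smooth curves of speed at most 1 that rest at both ends.
`contMDiffOn_of_forall_dist_eq` shows that isometrically parametrised curves are smooth: in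
coordinates such a curve minimises the energy among Lipschitz curves, hence solves an integrated
Euler–Lagrange equation (du Bois-Reymond), and bootstrapping applies. No exponential map is used. -/

open Set Filter Bundle Manifold
open scoped ContDiff ENNReal Topology
set_option linter.unusedSectionVars false

/-! ### The metric V⁻²h in Euclidean coordinates, and lengths of curves. -/

namespace StandardStaticSpacetime

noncomputable section

variable {E : Type*} [NormedAddCommGroup E] [NormedSpace ℝ E]
  {S : Type*} [TopologicalSpace S] [ChartedSpace E S] [IsManifold 𝓘(ℝ, E) ∞ S]

/-- The squared speed, for `V⁻² h`, at parameter `s` of a curve with parameter domain `I`. -/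
def speedSq (M : StandardStaticSpacetime E S) (c : ℝ → S) (I : Set ℝ) (s : ℝ) : ℝ :=
  M.conformalMetric.inner (c s) (mfderivWithin 𝓘(ℝ, ℝ) 𝓘(ℝ, E) c I s (1 : ℝ))
    (mfderivWithin 𝓘(ℝ, ℝ) 𝓘(ℝ, E) c I s (1 : ℝ))

/-- The Euclidean space in which the coordinates of `S` take their values. -/
abbrev CoordSpace (E : Type*) [NormedAddCommGroup E] [NormedSpace ℝ E] : Type :=
  EuclideanSpace ℝ (Fin (Module.finrank ℝ E))

variable [FiniteDimensional ℝ E]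

/-- Euclidean coordinates around `x₀`. -/
def coord (x₀ : S) (x : S) : CoordSpace E := toEuclidean (extChartAt 𝓘(ℝ, E) x₀ x)

/-- The inverse of `coord x₀`. -/
def param (x₀ : S) (y : CoordSpace E) : S := (extChartAt 𝓘(ℝ, E) x₀).symm (toEuclidean.symm y)

/-- The image of `coord x₀`. -/
def coordTarget (x₀ : S) : Set (CoordSpace E) :=
  toEuclidean.symm ⁻¹' (extChartAt 𝓘(ℝ, E) x₀).target

lemma isOpen_coordTarget (x₀ : S) : IsOpen (coordTarget (E := E) x₀) :=
  (isOpen_extChartAt_target x₀).preimage toEuclidean.symm.continuous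

lemma coord_mem {x₀ x : S} (hx : x ∈ (chartAt E x₀).source) :
    coord (E := E) x₀ x ∈ coordTarget x₀ := by
  have := (extChartAt 𝓘(ℝ, E) x₀).map_source (by simpa using hx)
  simpa only [coord, coordTarget, mem_preimage, ContinuousLinearEquiv.symm_apply_apply] using this

lemma param_mem {x₀ : S} {y : CoordSpace E} (hy : y ∈ coordTarget x₀) :
    param x₀ y ∈ (chartAt E x₀).source := by
  have := (extChartAt 𝓘(ℝ, E) x₀).map_target hy
  rwa [extChartAt_source] at this

lemma param_coord {x₀ x : S} (hx : x ∈ (chartAt E x₀).source) :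
    param x₀ (coord (E := E) x₀ x) = x := by
  simp only [param, coord, ContinuousLinearEquiv.symm_apply_apply]
  exact (extChartAt 𝓘(ℝ, E) x₀).left_inv (by simpa using hx)

lemma coord_param {x₀ : S} {y : CoordSpace E} (hy : y ∈ coordTarget x₀) :
    coord x₀ (param x₀ y) = y := by
  simp only [param, coord, (extChartAt 𝓘(ℝ, E) x₀).right_inv hy,
    ContinuousLinearEquiv.apply_symm_apply]

lemma contMDiffOn_param (x₀ : S) :
    ContMDiffOn 𝓘(ℝ, CoordSpace E) 𝓘(ℝ, E) ∞ (param (E := E) x₀) (coordTarget x₀) :=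
  (contMDiffOn_extChartAt_symm (I := 𝓘(ℝ, E)) (n := ∞) x₀).comp
    (toEuclidean (E := E)).symm.contDiff.contMDiff.contMDiffOn fun _ h => h

lemma contMDiffOn_coord (x₀ : S) :
    ContMDiffOn 𝓘(ℝ, E) 𝓘(ℝ, CoordSpace E) ∞ (coord (E := E) x₀) (chartAt E x₀).source :=
  (toEuclidean (E := E)).contDiff.contMDiff.comp_contMDiffOn contMDiffOn_extChartAt

lemma mdifferentiableAt_param {x₀ : S} {y : CoordSpace E} (hy : y ∈ coordTarget x₀) :
    MDifferentiableAt 𝓘(ℝ, CoordSpace E) 𝓘(ℝ, E) (param x₀) y :=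
  ((contMDiffOn_param x₀).contMDiffAt ((isOpen_coordTarget x₀).mem_nhds hy)).mdifferentiableAt
    (by simp)

lemma mdifferentiableAt_coord {x₀ x : S} (hx : x ∈ (chartAt E x₀).source) :
    MDifferentiableAt 𝓘(ℝ, E) 𝓘(ℝ, CoordSpace E) (coord (E := E) x₀) x :=
  ((contMDiffOn_coord x₀).contMDiffAt ((chartAt E x₀).open_source.mem_nhds hx)).mdifferentiableAt
    (by simp)

/-- The derivative of `param x₀`. -/
def dparam (x₀ : S) (y : CoordSpace E) : CoordSpace E →L[ℝ] TangentSpace 𝓘(ℝ, E) (param x₀ y) :=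
  mfderiv 𝓘(ℝ, CoordSpace E) 𝓘(ℝ, E) (param x₀) y

/-- By the chain rule the derivative of `coord x₀` is a left inverse. Injectivity is what makes
`metricOp` positive definite. -/
lemma dparam_injective {x₀ : S} {y : CoordSpace E} (hy : y ∈ coordTarget x₀) {v : CoordSpace E}
    (h : dparam x₀ y v = 0) : v = 0 := by
  have h1 : HasMFDerivAt 𝓘(ℝ, CoordSpace E) 𝓘(ℝ, CoordSpace E) (coord x₀ ∘ param x₀) y _ :=
    (mdifferentiableAt_coord (param_mem hy)).hasMFDerivAt.comp y
      (mdifferentiableAt_param hy).hasMFDerivAt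
  have h2 : coord x₀ ∘ param x₀ =ᶠ[𝓝 y] id := by
    filter_upwards [(isOpen_coordTarget x₀).mem_nhds hy] with z hz
    exact coord_param hz
  have h3 := hasMFDerivAt_unique (h1.congr_of_eventuallyEq h2.symm) (hasMFDerivAt_id y)
  have h5 : mfderiv 𝓘(ℝ, E) 𝓘(ℝ, CoordSpace E) (coord x₀) (param x₀ y) (dparam x₀ y v) = v :=
    congrArg (fun L => L v) h3
  rw [h, map_zero] at h5
  exact h5.symm

/-- The metric `V⁻² h` in the coordinates around `x₀`. -/
def coordMetric (M : StandardStaticSpacetime E S) (x₀ : S) (y v w : CoordSpace E) : ℝ :=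
  M.conformalMetric.inner (param x₀ y) (dparam x₀ y v) (dparam x₀ y w)

/-- The symmetric operator which represents the metric `V⁻² h` in the coordinates around `x₀`. -/
def metricOp (M : StandardStaticSpacetime E S) (x₀ : S) (y : CoordSpace E) :
    CoordSpace E →L[ℝ] CoordSpace E :=
  LinearMap.toContinuousLinearMap
    { toFun := fun v => WithLp.toLp 2 fun i =>
        M.coordMetric x₀ y v (EuclideanSpace.single i (1 : ℝ))
      map_add' := fun v w => by
        ext i
        simp only [coordMetric, map_add, add_apply, PiLp.add_apply]
      map_smul' := fun a v => by
        ext i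
        simp only [coordMetric, map_smul, smul_apply, PiLp.smul_apply, RingHom.id_apply] }

variable (M : StandardStaticSpacetime E S)

lemma metricOp_apply (x₀ : S) (y v : CoordSpace E) (i : Fin (Module.finrank ℝ E)) :
    M.metricOp x₀ y v i = M.coordMetric x₀ y v (EuclideanSpace.single i (1 : ℝ)) := rfl

lemma inner_metricOp (x₀ : S) (y v w : CoordSpace E) :
    inner ℝ (M.metricOp x₀ y v) w = M.coordMetric x₀ y v w := by
  have h : w = ∑ i, w i • EuclideanSpace.single i (1 : ℝ) := by
    ext j
    simp [Finset.sum_apply, Pi.single_apply]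
  rw [PiLp.inner_apply]
  conv_rhs => rw [h]
  simp only [coordMetric, map_sum, map_smul, smul_eq_mul, metricOp_apply]
  simp

lemma inner_metricOp_symm (x₀ : S) (y v w : CoordSpace E) :
    inner ℝ (M.metricOp x₀ y v) w = inner ℝ (M.metricOp x₀ y w) v := by
  rw [inner_metricOp, inner_metricOp, coordMetric, coordMetric, M.conformalMetric.symm]

lemma inner_metricOp_pos {x₀ : S} {y : CoordSpace E} (hy : y ∈ coordTarget x₀) {v : CoordSpace E}
    (hv : v ≠ 0) : 0 < inner ℝ (M.metricOp x₀ y v) v := by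
  rw [inner_metricOp]
  exact M.conformalMetric.pos _ _ fun h => hv (dparam_injective hy h)

/-- The vectors `dparam x₀ y v` are the tangent map of the parametrisation applied to the constant
field `v`, hence depend smoothly on `y`. The smooth bundle metric is evaluated on such fields, entry
by entry. -/
lemma contDiffOn_metricOp (x₀ : S) :
    ContDiffOn ℝ ∞ (M.metricOp x₀) (coordTarget x₀) := by
  have key (v : CoordSpace E) : ContMDiffOn 𝓘(ℝ, CoordSpace E) (𝓘(ℝ, E).prod 𝓘(ℝ, E)) ∞
      (fun y => (⟨param x₀ y, dparam x₀ y v⟩ : TangentBundle 𝓘(ℝ, E) S)) (coordTarget x₀) := by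
    have h1 := (contMDiffOn_param (E := E) x₀).contMDiffOn_tangentMapWithin
      (m := ∞) (by simp) (isOpen_coordTarget x₀).uniqueMDiffOn
    have h2 : ContMDiffOn 𝓘(ℝ, CoordSpace E) (𝓘(ℝ, CoordSpace E).prod 𝓘(ℝ, CoordSpace E)) ∞
      (fun y : CoordSpace E => (⟨y, v⟩ : TangentBundle 𝓘(ℝ, CoordSpace E) (CoordSpace E)))
      (coordTarget x₀) := fun y hy =>
        contMDiffWithinAt_vectorSpace_iff_contDiffWithinAt.2 contDiffWithinAt_const
    refine (h1.comp h2 fun y hy => hy).congr fun y hy => ?_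
    simp only [Function.comp_apply, tangentMapWithin, dparam]
    rw [mfderivWithin_of_isOpen (isOpen_coordTarget x₀) hy]
    rfl
  rw [contDiffOn_clm_apply]
  intro v
  rw [contDiffOn_euclidean]
  intro i
  rw [← contMDiffOn_iff_contDiffOn]
  intro y hy
  have h3 : ContMDiffWithinAt 𝓘(ℝ, CoordSpace E) (𝓘(ℝ, E).prod 𝓘(ℝ)) ∞
      (fun y ↦ TotalSpace.mk' ℝ (E := Bundle.Trivial S ℝ) (param x₀ y)
        (M.metricOp x₀ y v i)) (coordTarget x₀) y := by
    simp only [metricOp_apply, coordMetric]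
    apply ContMDiffWithinAt.clm_bundle_apply₂ (F₁ := E) (F₂ := E)
    · exact (M.conformalMetric.contMDiff _).comp_contMDiffWithinAt y (contMDiffOn_param x₀ y hy)
    · exact key v y hy
    · exact key _ y hy
  simp only [contMDiffWithinAt_totalSpace] at h3
  exact h3.2

lemma speedSq_congr {c c' : ℝ → S} {I : Set ℝ} {s : ℝ} (h : c =ᶠ[𝓝[I] s] c') (hs : c s = c' s) :
    M.speedSq c I s = M.speedSq c' I s := by
  have h1 : (mfderivWithin 𝓘(ℝ, ℝ) 𝓘(ℝ, E) c I s (1 : ℝ) : E) =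
      (mfderivWithin 𝓘(ℝ, ℝ) 𝓘(ℝ, E) c' I s (1 : ℝ) : E) :=
    congrArg (fun L : ℝ →L[ℝ] E => L 1) (h.mfderivWithin_eq hs)
  -- All tangent spaces are `E` by definition, so the velocities can be compared in `E` before the
  -- base points are identified.
  have h2 (p q : S) (v w : E) (hp : p = q) (hv : v = w) :
      M.conformalMetric.inner p v v = M.conformalMetric.inner q w w := by
    subst hp hv; rfl
  exact h2 _ _ _ _ hs h1

/-- In coordinates, the squared speed is computed by `metricOp`. -/
lemma speedSq_param {x₀ : S} {w : ℝ → CoordSpace E} {v : CoordSpace E} {I : Set ℝ} {s : ℝ}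
    (hw : HasDerivWithinAt w v I s) (hI : UniqueDiffWithinAt ℝ I s) (hs : w s ∈ coordTarget x₀) :
    M.speedSq (fun t => param x₀ (w t)) I s = inner ℝ (M.metricOp x₀ (w s) v) v := by
  have h1 : HasMFDerivWithinAt 𝓘(ℝ, ℝ) 𝓘(ℝ, E) (param x₀ ∘ w) I s _ :=
    (mdifferentiableAt_param hs).hasMFDerivAt.comp_hasMFDerivWithinAt s
      hw.hasFDerivWithinAt.hasMFDerivWithinAt
  have h2 := congrArg (fun L : ℝ →L[ℝ] E => L 1) (h1.mfderivWithin hI.uniqueMDiffWithinAt)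
  have h3 : (mfderivWithin 𝓘(ℝ, ℝ) 𝓘(ℝ, E) (param x₀ ∘ w) I s (1 : ℝ) : E) =
      dparam x₀ (w s) v := by
    refine h2.trans ?_
    change mfderiv 𝓘(ℝ, CoordSpace E) 𝓘(ℝ, E) (param x₀) (w s) ((1 : ℝ) • v) = _
    rw [one_smul]
    rfl
  rw [inner_metricOp, coordMetric, speedSq]
  exact congrArg (fun a : E => M.conformalMetric.inner (param x₀ (w s)) a a) h3

lemma eventuallyEq_param_coord {x₀ : S} {c : ℝ → S} {I : Set ℝ} {s : ℝ}
    (hc : ContinuousWithinAt c I s) (hs : c s ∈ (chartAt E x₀).source) :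
    c =ᶠ[𝓝[I] s] fun t => param x₀ (coord (E := E) x₀ (c t)) := by
  filter_upwards [hc.preimage_mem_nhdsWithin ((chartAt E x₀).open_source.mem_nhds hs)] with t ht
  exact (param_coord ht).symm

lemma speedSq_eq_inner_metricOp {x₀ : S} {c : ℝ → S} {v : CoordSpace E} {I : Set ℝ} {s : ℝ}
    (hc : ContinuousWithinAt c I s) (hw : HasDerivWithinAt (fun t => coord x₀ (c t)) v I s)
    (hI : UniqueDiffWithinAt ℝ I s) (hs : c s ∈ (chartAt E x₀).source) :
    M.speedSq c I s = inner ℝ (M.metricOp x₀ (coord x₀ (c s)) v) v := by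
  rw [← M.speedSq_param hw hI (coord_mem hs)]
  exact M.speedSq_congr (eventuallyEq_param_coord hc hs) (param_coord hs).symm

lemma speedSq_mono {c : ℝ → S} {I J : Set ℝ} {s : ℝ} (hIJ : J ⊆ I)
    (hc : MDifferentiableWithinAt 𝓘(ℝ, ℝ) 𝓘(ℝ, E) c I s) (hJ : UniqueDiffWithinAt ℝ J s) :
    M.speedSq c J s = M.speedSq c I s := by
  rw [speedSq, speedSq, mfderivWithin_subset hIJ hJ.uniqueMDiffWithinAt hc]

/-! ### The distance -/

/-- The distance of `V⁻² h` as an extended metric compatible with the topology. -/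
@[reducible] def toEMetricSpace [T3Space S] : EMetricSpace S :=
  letI : RiemannianBundle (fun x : S => TangentSpace 𝓘(ℝ, E) x) :=
    ⟨M.conformalMetric.toRiemannianMetric⟩
  haveI : IsManifold 𝓘(ℝ, E) 1 S := IsManifold.of_le (n := ∞) (by simp)
  haveI : IsContinuousRiemannianBundle E (fun x : S => TangentSpace 𝓘(ℝ, E) x) :=
    ⟨M.conformalMetric.inner, M.conformalMetric.contMDiff.continuous, fun _ _ _ => rfl⟩
  EMetricSpace.ofRiemannianMetric 𝓘(ℝ, E) S

lemma speedSq_eq_norm_sq (c : ℝ → S) (I : Set ℝ) (s : ℝ) :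
    letI : RiemannianBundle (fun x : S => TangentSpace 𝓘(ℝ, E) x) :=
      ⟨M.conformalMetric.toRiemannianMetric⟩
    M.speedSq c I s = ‖mfderivWithin 𝓘(ℝ, ℝ) 𝓘(ℝ, E) c I s (1 : ℝ)‖ ^ 2 := by
  let _ : RiemannianBundle (fun x : S => TangentSpace 𝓘(ℝ, E) x) :=
      ⟨M.conformalMetric.toRiemannianMetric⟩
  rw [← real_inner_self_eq_norm_sq]
  rfl

lemma enorm_eq_speedSq (c : ℝ → S) (I : Set ℝ) (s : ℝ) :
    letI : RiemannianBundle (fun x : S => TangentSpace 𝓘(ℝ, E) x) :=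
      ⟨M.conformalMetric.toRiemannianMetric⟩
    ‖mfderivWithin 𝓘(ℝ, ℝ) 𝓘(ℝ, E) c I s (1 : ℝ)‖ₑ = ENNReal.ofReal √(M.speedSq c I s) := by
  let _ : RiemannianBundle (fun x : S => TangentSpace 𝓘(ℝ, E) x) :=
      ⟨M.conformalMetric.toRiemannianMetric⟩
  rw [M.speedSq_eq_norm_sq c I s, Real.sqrt_sq (norm_nonneg _), ofReal_norm]

/-- A `C¹` curve whose speed is at most `τ'` has length at most `τ b - τ a`. -/
lemma dist_le_of_speedSq_le {c : ℝ → S} {a b : ℝ} (hab : a ≤ b)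
    (hc : ContMDiffOn 𝓘(ℝ, ℝ) 𝓘(ℝ, E) 1 c (Icc a b)) {τ : ℝ → ℝ} {τ' : ℝ → ℝ}
    (hτ : ∀ s ∈ Icc a b, HasDerivWithinAt τ (τ' s) (Icc a b) s)
    (hτ' : ∀ s ∈ Icc a b, 0 ≤ τ' s)
    (h : ∀ s ∈ Icc a b, M.speedSq c (Icc a b) s ≤ τ' s ^ 2) :
    M.dist (c a) (c b) ≤ ENNReal.ofReal (τ b - τ a) := by
  let _ : RiemannianBundle (fun x : S => TangentSpace 𝓘(ℝ, E) x) :=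
      ⟨M.conformalMetric.toRiemannianMetric⟩
  refine (riemannianEDist_le_pathELength (I := 𝓘(ℝ, E)) hc rfl rfl hab).trans ?_
  rw [pathELength_eq_lintegral_mfderivWithin_Icc]
  have hcont : ContinuousOn τ (Icc a b) := fun s hs => (hτ s hs).continuousWithinAt
  have hd : ∀ s ∈ Ioo a b, HasDerivAt τ (τ' s) s := fun s hs =>
    (hτ s (Ioo_subset_Icc_self hs)).hasDerivAt (Icc_mem_nhds hs.1 hs.2)
  -- No continuity of τ' is assumed; a nonnegative derivative is automatically integrable.
  have hi : IntervalIntegrable τ' MeasureTheory.volume a b := by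
    rw [intervalIntegrable_iff_integrableOn_Ioc_of_le hab]
    exact intervalIntegral.integrableOn_deriv_of_nonneg hcont hd
      fun s hs => hτ' s (Ioo_subset_Icc_self hs)
  rw [← intervalIntegral.integral_eq_sub_of_hasDerivAt_of_le hab hcont hd hi,
    intervalIntegral.integral_of_le hab, ← MeasureTheory.integral_Icc_eq_integral_Ioc,
    MeasureTheory.ofReal_integral_eq_lintegral_ofReal]
  · refine MeasureTheory.setLIntegral_mono' measurableSet_Icc fun s hs => ?_
    exact (M.enorm_eq_speedSq c (Icc a b) s).le.trans
      (ENNReal.ofReal_le_ofReal (Real.sqrt_le_iff.2 ⟨hτ' s hs, h s hs⟩))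
  · rw [← MeasureTheory.IntegrableOn, integrableOn_Icc_iff_integrableOn_Ioc]
    exact (intervalIntegrable_iff_integrableOn_Ioc_of_le hab).1 hi
  · exact (MeasureTheory.ae_restrict_mem measurableSet_Icc).mono fun s hs => hτ' s hs

/-- If `d(p, q) < T`, there is a `C¹` curve from `p` to `q` whose length is less than `T`. -/
lemma exists_contMDiffOn_of_dist_lt {p q : S} {T : ℝ≥0∞} (h : M.dist p q < T) :
    ∃ c : ℝ → S, c 0 = p ∧ c 1 = q ∧ ContMDiffOn 𝓘(ℝ, ℝ) 𝓘(ℝ, E) 1 c (Icc 0 1) ∧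
      ∫⁻ s in Icc (0 : ℝ) 1, ENNReal.ofReal √(M.speedSq c (Icc 0 1) s) < T := by
  let _ : RiemannianBundle (fun x : S => TangentSpace 𝓘(ℝ, E) x) :=
      ⟨M.conformalMetric.toRiemannianMetric⟩
  obtain ⟨c, h0, h1, hc, hl⟩ := exists_lt_of_riemannianEDist_lt (I := 𝓘(ℝ, E)) h
  refine ⟨c, h0, h1, hc, ?_⟩
  rw [pathELength_eq_lintegral_mfderivWithin_Icc] at hl
  exact lt_of_eq_of_lt (MeasureTheory.lintegral_congr fun s =>
    (M.enorm_eq_speedSq c (Icc 0 1) s).symm) hl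

end
end StandardStaticSpacetime

/-! ### Analysis in Euclidean space: smooth steps, comparison of scalar products, lengths of
Lipschitz curves. -/

/-- A smooth step from `0` to `1` during a time `T`, with slope at most `1 / L` for a given
`L < T`. -/
lemma exists_smooth_step {L T : ℝ} (hL : 0 < L) (hT : L < T) :
    ∃ l : ℝ → ℝ, ContDiff ℝ ∞ l ∧ (∀ t ≤ 0, l t = 0) ∧ (∀ t, T ≤ t → l t = 1) ∧
      (∀ t, l t ∈ Icc (0 : ℝ) 1) ∧ ∀ t, deriv l t ^ 2 ≤ (L⁻¹) ^ 2 := by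
  -- The cutoff χ equals 1 on [k, T − k], which has length L by the choice of k. So its integral I
  -- is at least L, and the primitive of χ / I has slope at most 1 / L.
  set k := (T - L) / 2 with hk
  have hk0 : 0 < k := by rw [hk]; linarith
  let χ : ℝ → ℝ := fun t => Real.smoothTransition (t / k) * Real.smoothTransition ((T - t) / k)
  have hχs : ContDiff ℝ ∞ χ := by
    refine (Real.smoothTransition.contDiff.comp (by fun_prop)).mul
      (Real.smoothTransition.contDiff.comp (by fun_prop))
  have hχ0 (t) : 0 ≤ χ t :=
    mul_nonneg (Real.smoothTransition.nonneg _) (Real.smoothTransition.nonneg _)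
  have hχ1 (t) : χ t ≤ 1 :=
    mul_le_one₀ (Real.smoothTransition.le_one _) (Real.smoothTransition.nonneg _)
      (Real.smoothTransition.le_one _)
  have hint (a b : ℝ) : IntervalIntegrable χ MeasureTheory.volume a b :=
    hχs.continuous.intervalIntegrable _ _
  set I := ∫ t in (0 : ℝ)..T, χ t with hI
  have hIL : L ≤ I := by
    have h1 : ∫ t in k..(T - k), χ t = L := by
      rw [intervalIntegral.integral_congr (g := fun _ => (1 : ℝ))]
      · simp; rw [hk]; ring
      · intro t ht
        rw [uIcc_of_le (by rw [hk]; linarith)] at ht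
        simp only [χ]
        rw [Real.smoothTransition.one_of_one_le, Real.smoothTransition.one_of_one_le, one_mul]
        · rw [le_div_iff₀ hk0]; linarith [ht.2]
        · rw [le_div_iff₀ hk0]; linarith [ht.1]
    rw [← h1]
    exact intervalIntegral.integral_mono_interval hk0.le (by rw [hk]; linarith) (by linarith)
      (Eventually.of_forall hχ0) (hint _ _)
  have hI0 : 0 < I := hL.trans_le hIL
  have hd (t) : HasDerivAt (fun t => (∫ s in (0 : ℝ)..t, χ s) / I) (χ t / I) t :=
    (intervalIntegral.integral_hasDerivAt_right (hint _ _)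
      (hχs.continuous.stronglyMeasurableAtFilter _ _) hχs.continuous.continuousAt).div_const _
  have hz (a b : ℝ) (h : ∀ t ∈ uIcc a b, t ≤ 0 ∨ T ≤ t) : ∫ t in a..b, χ t = 0 := by
    rw [intervalIntegral.integral_congr (g := fun _ => (0 : ℝ))]
    · simp
    · intro t ht
      simp only [χ]
      rcases h t ht with h | h
      · rw [Real.smoothTransition.zero_of_nonpos (div_nonpos_of_nonpos_of_nonneg h hk0.le), zero_mul]
      · rw [Real.smoothTransition.zero_of_nonpos (x := (T - t) / k)
          (div_nonpos_of_nonpos_of_nonneg (by linarith) hk0.le), mul_zero]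
  have hl0 (t) (ht : t ≤ 0) : (∫ s in (0 : ℝ)..t, χ s) / I = 0 := by
    rw [hz, zero_div]
    intro s hs
    rw [uIcc_of_ge ht] at hs
    exact Or.inl hs.2
  have hl1 (t) (ht : T ≤ t) : (∫ s in (0 : ℝ)..t, χ s) / I = 1 := by
    have := intervalIntegral.integral_add_adjacent_intervals (hint 0 T) (hint T t)
    rw [hz T t fun s hs => Or.inr (by rw [uIcc_of_le ht] at hs; exact hs.1)] at this
    rw [← this, add_zero, div_self hI0.ne']
  have hmono : Monotone fun t => (∫ s in (0 : ℝ)..t, χ s) / I :=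
    monotone_of_hasDerivAt_nonneg hd fun t => div_nonneg (hχ0 t) hI0.le
  refine ⟨fun t => (∫ s in (0 : ℝ)..t, χ s) / I, ?_, hl0, hl1,
    fun t => ⟨?_, ?_⟩, fun t => ?_⟩
  · rw [show ((⊤ : ℕ∞) : WithTop ℕ∞) = (⊤ : ℕ∞) + 1 from rfl, contDiff_succ_iff_deriv]
    refine ⟨fun t => (hd t).differentiableAt, by simp, ?_⟩
    rw [show deriv _ = fun t => χ t / I from funext fun t => (hd t).deriv]
    exact hχs.div_const _
  · exact (hl0 _ (min_le_right t 0)).symm.le.trans (hmono (min_le_left t 0))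
  · exact (hmono (le_max_left t T)).trans (hl1 _ (le_max_right t T)).le
  · rw [(hd t).deriv]
    have h1 : χ t / I ≤ L⁻¹ := by
      rw [inv_eq_one_div]
      exact div_le_div₀ zero_le_one (hχ1 t) hL hIL
    exact pow_le_pow_left₀ (div_nonneg (hχ0 t) hI0.le) h1 2

/-- By homogeneity the minimum on the compact unit sphere serves as `m`. In dimension zero the
sphere is empty and any `m` works. -/
lemma exists_forall_mul_sq_le_of_pos {E : Type*} [NormedAddCommGroup E] [InnerProductSpace ℝ E]
    [FiniteDimensional ℝ E] (B : E →L[ℝ] E) (hB : ∀ v, v ≠ 0 → 0 < inner ℝ (B v) v) :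
    ∃ m > 0, ∀ v, m * ‖v‖ ^ 2 ≤ inner ℝ (B v) v := by
  have hc : Continuous fun v => inner ℝ (B v) v := by fun_prop
  rcases (Metric.sphere (0 : E) 1).eq_empty_or_nonempty with h | h
  · refine ⟨1, one_pos, fun v => ?_⟩
    by_cases hv : v = 0
    · simp [hv]
    · exfalso
      have : ‖v‖⁻¹ • v ∈ Metric.sphere (0 : E) 1 := by
        simp [norm_smul, norm_ne_zero_iff.2 hv]
      rw [h] at this
      exact this
  · obtain ⟨v₀, hv₀, hmin⟩ := (isCompact_sphere (0 : E) 1).exists_isMinOn h hc.continuousOn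
    have hv₀' : v₀ ≠ 0 := by
      rintro rfl
      simp at hv₀
    refine ⟨inner ℝ (B v₀) v₀, hB _ hv₀', fun v => ?_⟩
    by_cases hv : v = 0
    · simp [hv]
    · have hn : ‖v‖ ≠ 0 := norm_ne_zero_iff.2 hv
      have h1 : inner ℝ (B v₀) v₀ ≤ inner ℝ (B (‖v‖⁻¹ • v)) (‖v‖⁻¹ • v) := hmin (by
        simp [norm_smul, hn])
      simp only [map_smul, real_inner_smul_left, real_inner_smul_right] at h1
      calc inner ℝ (B v₀) v₀ * ‖v‖ ^ 2 ≤ (‖v‖⁻¹ * (‖v‖⁻¹ * inner ℝ (B v) v)) * ‖v‖ ^ 2 := by gcongr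
        _ = inner ℝ (B v) v := by field_simp

/-- Nearby values of a continuous field of scalar products are nearly isometric. -/
lemma eventually_le_mul_of_continuousAt {E : Type*} [NormedAddCommGroup E] [InnerProductSpace ℝ E]
    [FiniteDimensional ℝ E] {G : E → E →L[ℝ] E} {y₀ : E} (hG : ContinuousAt G y₀)
    (hpos : ∀ v, v ≠ 0 → 0 < inner ℝ (G y₀ v) v) {C : ℝ} (hC : 1 < C) :
    ∀ᶠ y in 𝓝 y₀, ∀ v, inner ℝ (G y v) v ≤ C * inner ℝ (G y₀ v) v ∧ inner ℝ (G y₀ v) v ≤ C * inner ℝ (G y v) v := by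
  obtain ⟨m, hm, hmv⟩ := exists_forall_mul_sq_le_of_pos _ hpos
  have hC0 : 0 < 1 - C⁻¹ := by
    have := inv_lt_one_of_one_lt₀ hC
    linarith
  -- The term C − 1 gives the upper estimate for G y, the term 1 − C⁻¹ the lower one, G y ≥ C⁻¹ G
  -- y₀. The factor m converts operator norms into the form of G y₀.
  have hε : 0 < min (C - 1) (1 - C⁻¹) * m := mul_pos (lt_min (by linarith) hC0) hm
  have hG' : Tendsto (fun y => ‖G y - G y₀‖) (𝓝 y₀) (𝓝 0) :=
    tendsto_iff_norm_sub_tendsto_zero.1 hG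
  filter_upwards [hG'.eventually_lt_const hε] with y hy v
  have h1 : |inner ℝ ((G y - G y₀) v) v| ≤ min (C - 1) (1 - C⁻¹) * inner ℝ (G y₀ v) v := by
    calc |inner ℝ ((G y - G y₀) v) v| ≤ ‖G y - G y₀‖ * ‖v‖ * ‖v‖ :=
        (abs_real_inner_le_norm _ _).trans (by gcongr; exact (G y - G y₀).le_opNorm v)
      _ ≤ (min (C - 1) (1 - C⁻¹) * m) * ‖v‖ * ‖v‖ := by
        gcongr
      _ = min (C - 1) (1 - C⁻¹) * (m * ‖v‖ ^ 2) := by ring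
      _ ≤ _ := mul_le_mul_of_nonneg_left (hmv v) (lt_min (sub_pos.2 hC) hC0).le
  have h2 : 0 ≤ inner ℝ (G y₀ v) v := le_trans (by positivity) (hmv v)
  simp only [sub_apply, inner_sub_left] at h1
  rw [abs_le] at h1
  have h3 : min (C - 1) (1 - C⁻¹) * inner ℝ (G y₀ v) v ≤ (C - 1) * inner ℝ (G y₀ v) v :=
    mul_le_mul_of_nonneg_right (min_le_left _ _) h2
  have h4 : min (C - 1) (1 - C⁻¹) * inner ℝ (G y₀ v) v ≤ (1 - C⁻¹) * inner ℝ (G y₀ v) v :=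
    mul_le_mul_of_nonneg_right (min_le_right _ _) h2
  refine ⟨by linarith, ?_⟩
  have h5 : C⁻¹ * inner ℝ (G y₀ v) v ≤ inner ℝ (G y v) v := by linarith
  rwa [inv_mul_le_iff₀ (by linarith)] at h5

/-- A distance which is infinitesimally bounded by a Riemannian metric is bounded by
the length of Lipschitz curves. -/
lemma le_lintegral_of_lipschitzOnWith {E : Type*} [NormedAddCommGroup E] [InnerProductSpace ℝ E]
    {G : E → E →L[ℝ] E} {ρ : E → E → ℝ≥0∞} (htri : ∀ x y z, ρ x z ≤ ρ x y + ρ y z)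
    (hself : ∀ x, ρ x x = 0) {U : Set E} {L : ℝ}
    (hL : ∀ y ∈ U, ∀ z ∈ U, ρ y z ≤ ENNReal.ofReal (L * ‖z - y‖))
    (hG : ∀ y ∈ U, ∀ C : ℝ, 1 < C → ∀ᶠ p : E × E in 𝓝 (y, y),
      ρ p.1 p.2 ≤ ENNReal.ofReal (C * √(inner ℝ (G y (p.2 - p.1)) (p.2 - p.1))))
    {w f : ℝ → E} {a b : ℝ} (hab : a ≤ b) {K : NNReal} (hw : LipschitzOnWith K w (Icc a b))
    (hwU : MapsTo w (Icc a b) U)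
    (hf : ∀ᵐ s, s ∈ Ioc a b → HasDerivAt w (f s) s) :
    ρ (w a) (w b) ≤ ∫⁻ s in Ioc a b, ENNReal.ofReal √(inner ℝ (G (w s) (f s)) (f s)) := by
  -- The function F is Lipschitz, hence the integral of its derivative. Almost everywhere `hG`
  -- bounds that derivative by C times the speed, for every C > 1.
  set F : ℝ → ℝ := fun s => (ρ (w a) (w s)).toReal with hF
  have haI : a ∈ Icc a b := left_mem_Icc.2 hab
  have hfin : ∀ s ∈ Icc a b, ρ (w a) (w s) ≠ ⊤ := fun s hs =>
    ((hL _ (hwU haI) _ (hwU hs)).trans_lt ENNReal.ofReal_lt_top).ne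
  have hfin' : ∀ s ∈ Icc a b, ∀ s' ∈ Icc a b, ρ (w s) (w s') ≠ ⊤ := fun s hs s' hs' =>
    ((hL _ (hwU hs) _ (hwU hs')).trans_lt ENNReal.ofReal_lt_top).ne
  have hFle : ∀ s ∈ Icc a b, ∀ s' ∈ Icc a b, ∀ r : ℝ, 0 ≤ r → ρ (w s) (w s') ≤ ENNReal.ofReal r →
      F s' - F s ≤ r := by
    intro s hs s' hs' r hr h
    have h1 := ENNReal.toReal_mono (ENNReal.add_ne_top.2 ⟨hfin s hs, hfin' s hs s' hs'⟩)
      (htri (w a) (w s) (w s'))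
    rw [ENNReal.toReal_add (hfin s hs) (hfin' s hs s' hs')] at h1
    have h2 := ENNReal.toReal_le_of_le_ofReal hr h
    simp only [hF]
    linarith
  have hFabs : ∀ s ∈ Icc a b, ∀ s' ∈ Icc a b, ∀ r : ℝ, 0 ≤ r → ρ (w s) (w s') ≤ ENNReal.ofReal r →
      ρ (w s') (w s) ≤ ENNReal.ofReal r → |F s' - F s| ≤ r := fun s hs s' hs' r hr h h' =>
    abs_le.2 ⟨by linarith [hFle s' hs' s hs r hr h'], hFle s hs s' hs' r hr h⟩
  have hFlip : LipschitzOnWith (L.toNNReal * K) F (uIcc a b) := by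
    rw [uIcc_of_le hab]
    refine LipschitzOnWith.of_dist_le_mul fun s hs s' hs' => ?_
    have hL' : L ≤ L.toNNReal := Real.le_coe_toNNReal L
    have h1 : ‖w s - w s'‖ ≤ K * dist s s' := by
      rw [← dist_eq_norm]; exact hw.dist_le_mul _ hs _ hs'
    have h2 : L * ‖w s - w s'‖ ≤ (L.toNNReal * K) * dist s s' := by
      rw [mul_assoc]
      exact mul_le_mul hL' h1 (norm_nonneg _) (by positivity)
    rw [Real.dist_eq]
    push_cast
    refine hFabs s' hs' s hs _ (by positivity) ((hL _ (hwU hs') _ (hwU hs)).trans ?_)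
      ((hL _ (hwU hs) _ (hwU hs')).trans ?_)
    · exact ENNReal.ofReal_le_ofReal h2
    · rw [norm_sub_rev]; exact ENNReal.ofReal_le_ofReal h2
  have hac := hFlip.absolutelyContinuousOnInterval
  have hFb : F b = ∫ s in a..b, deriv F s := by
    rw [hac.integral_deriv_eq_sub]
    simp [hF, hself]
  have hder : ∀ᵐ s, s ∈ Ioc a b → ‖deriv F s‖ₑ ≤ ENNReal.ofReal √(inner ℝ (G (w s) (f s)) (f s)) := by
    have hne : ∀ᵐ s : ℝ, s ≠ b := by simp [MeasureTheory.ae_iff]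
    filter_upwards [hf, hac.ae_differentiableAt, hne] with s h1 h2 h3 hs
    have hsb : s < b := lt_of_le_of_ne hs.2 h3
    have hsI : Icc a b ∈ 𝓝 s := Icc_mem_nhds hs.1 hsb
    have hws := h1 hs
    have hFs := (h2 (by rw [uIcc_of_le hab]; exact Ioc_subset_Icc_self hs)).hasDerivAt
    rw [← ofReal_norm]
    refine ENNReal.ofReal_le_ofReal ?_
    have key : ∀ C : ℝ, 1 < C → ‖deriv F s‖ ≤ C * √(inner ℝ (G (w s) (f s)) (f s)) := by
      intro C hC
      have hsl := hasDerivAt_iff_tendsto_slope.1 hFs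
      have hwl := hasDerivAt_iff_tendsto_slope.1 hws
      have hcont : Continuous fun v => C * √(inner ℝ (G (w s) v) v) := by fun_prop
      refine le_of_tendsto_of_tendsto hsl.norm ((hcont.tendsto _).comp hwl) ?_
      have h5 : Tendsto (fun t => (w s, w t)) (𝓝 s) (𝓝 (w s, w s)) :=
        tendsto_const_nhds.prodMk_nhds hws.continuousAt
      have h6 : Tendsto (fun t => (w t, w s)) (𝓝 s) (𝓝 (w s, w s)) :=
        hws.continuousAt.tendsto.prodMk_nhds tendsto_const_nhds
      have h7 := hG _ (hwU (Ioc_subset_Icc_self hs)) C hC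
      filter_upwards [nhdsWithin_le_nhds (h5.eventually h7), nhdsWithin_le_nhds (h6.eventually h7),
        nhdsWithin_le_nhds hsI, self_mem_nhdsWithin] with t h8 h9 htI hts
      -- No symmetry of ρ is assumed: ρ (w s) (w t) and ρ (w t) (w s) are bounded separately, by the
      -- same number since quadratic forms are even.
      have h10 : inner ℝ (G (w s) (w s - w t)) (w s - w t) = inner ℝ (G (w s) (w t - w s)) (w t - w s) := by
        rw [← neg_sub (w t) (w s)]; simp only [map_neg, inner_neg_neg]
      simp only [h10] at h9
      have h11 := hFabs s (Ioc_subset_Icc_self hs) t htI _ (by positivity) h8 h9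
      simp only [Function.comp, slope_def_module, smul_eq_mul, map_smul, real_inner_smul_left,
        real_inner_smul_right, norm_mul,
        norm_inv, Real.norm_eq_abs]
      rw [← mul_assoc, Real.sqrt_mul (mul_self_nonneg _), Real.sqrt_mul_self_eq_abs, abs_inv]
      calc |t - s|⁻¹ * |F t - F s| ≤ |t - s|⁻¹ * (C * √(inner ℝ (G (w s) (w t - w s)) (w t - w s))) := by
            gcongr
        _ = _ := by ring
    have hlim : Tendsto (fun C : ℝ => C * √(inner ℝ (G (w s) (f s)) (f s))) (𝓝[>] 1)
        (𝓝 (1 * √(inner ℝ (G (w s) (f s)) (f s)))) :=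
      (tendsto_id.mul_const _).mono_left nhdsWithin_le_nhds
    rw [one_mul] at hlim
    exact ge_of_tendsto hlim (eventually_mem_nhdsWithin.mono fun C hC => key C hC)
  calc ρ (w a) (w b) = ENNReal.ofReal (F b) :=
        (ENNReal.ofReal_toReal (hfin b (right_mem_Icc.2 hab))).symm
    _ ≤ ‖F b‖ₑ := by rw [← ofReal_norm]; exact ENNReal.ofReal_le_ofReal (Real.le_norm_self _)
    _ = ‖∫ s in Ioc a b, deriv F s‖ₑ := by rw [hFb, intervalIntegral.integral_of_le hab]
    _ ≤ ∫⁻ s in Ioc a b, ‖deriv F s‖ₑ := MeasureTheory.enorm_integral_le_lintegral_enorm _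
    _ ≤ _ := MeasureTheory.setLIntegral_mono_ae' measurableSet_Ioc hder

/-! ### The distance computed by smooth curves of speed at most 1. -/

namespace StandardStaticSpacetime

noncomputable section

variable {E : Type*} [NormedAddCommGroup E] [NormedSpace ℝ E] [FiniteDimensional ℝ E]
  {S : Type*} [TopologicalSpace S] [ChartedSpace E S] [IsManifold 𝓘(ℝ, E) ∞ S]
  (M : StandardStaticSpacetime E S)

/-- There is a smooth curve of speed at most `1` which rests at `p` until the time `0` and rests
at `q` from the time `T` on. -/
def Reach (p q : S) (T : ℝ) : Prop :=
  ∃ c : ℝ → S, ContMDiff 𝓘(ℝ, ℝ) 𝓘(ℝ, E) ∞ c ∧ (∀ t ≤ 0, c t = p) ∧ (∀ t, T ≤ t → c t = q) ∧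
    ∀ t, M.speedSq c univ t ≤ 1

variable {M}

lemma speedSq_const (p : S) (I : Set ℝ) (t : ℝ) : M.speedSq (fun _ => p) I t = 0 := by
  rw [speedSq, mfderivWithin_const]
  exact (congrArg _ (zero_apply _)).trans (map_zero _)

lemma reach_refl (p : S) (T : ℝ) : M.Reach p p T :=
  ⟨fun _ => p, contMDiff_const, fun _ _ => rfl, fun _ _ => rfl, fun t => by
    rw [speedSq_const]; exact zero_le_one⟩

lemma speedSq_comp_sub {c : ℝ → S} (hc : ContMDiff 𝓘(ℝ, ℝ) 𝓘(ℝ, E) ∞ c) (a t : ℝ) :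
    M.speedSq (fun s => c (s - a)) univ t = M.speedSq c univ (t - a) := by
  have h1 : HasMFDerivAt 𝓘(ℝ, ℝ) 𝓘(ℝ, E) (c ∘ fun s => s - a) t _ :=
    ((hc.mdifferentiable (by simp)) (t - a)).hasMFDerivAt.comp t
      ((hasDerivAt_id t).sub_const a).hasFDerivAt.hasMFDerivAt
  have h2 := congrArg (fun L : ℝ →L[ℝ] E => L 1) h1.mfderiv
  have h3 : (mfderiv 𝓘(ℝ, ℝ) 𝓘(ℝ, E) (c ∘ fun s => s - a) t (1 : ℝ) : E) =
      mfderiv 𝓘(ℝ, ℝ) 𝓘(ℝ, E) c (t - a) (1 : ℝ) := by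
    refine h2.trans ?_
    change mfderiv 𝓘(ℝ, ℝ) 𝓘(ℝ, E) c (t - a) ((1 : ℝ) • (1 : ℝ)) = _
    rw [one_smul]
  rw [speedSq, speedSq, mfderivWithin_univ, mfderivWithin_univ]
  exact congrArg (fun v : E => M.conformalMetric.inner (c (t - a)) v v) h3

/-- Since the curves rest at their ends, concatenation creates no corner. The surplus `ε` provides
an open interval of times in which both curves sit at `q`. -/
lemma Reach.trans {p q r : S} {T T' ε : ℝ} (hT' : 0 < T') (hT : 0 < T) (hε : 0 < ε)
    (h : M.Reach p q T) (h' : M.Reach q r T') : M.Reach p r (T + T' + ε) := by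
  obtain ⟨c, hc, hc0, hcT, hcs⟩ := h
  obtain ⟨c', hc', hc'0, hc'T, hc's⟩ := h'
  have hd : ContMDiff 𝓘(ℝ, ℝ) 𝓘(ℝ, E) ∞ fun t => c' (t - (T + ε)) :=
    hc'.comp (contDiff_id.sub contDiff_const).contMDiff
  set z : ℝ → S := fun t => if t < T + ε / 2 then c t else c' (t - (T + ε)) with hz
  have h1 : ∀ t < T + ε, z t = c t := by
    intro t ht
    simp only [hz]
    split_ifs with h
    · rfl
    · rw [hcT _ (by linarith), hc'0 _ (by linarith)]
  have h2 : ∀ t, T < t → z t = c' (t - (T + ε)) := by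
    intro t ht
    simp only [hz]
    split_ifs with h
    · rw [hcT _ (by linarith), hc'0 _ (by linarith)]
    · rfl
  have h3 : ∀ t, z =ᶠ[𝓝 t] c ∨ z =ᶠ[𝓝 t] fun t => c' (t - (T + ε)) := by
    intro t
    rcases lt_or_ge t (T + ε) with ht | ht
    · exact Or.inl (by filter_upwards [Iio_mem_nhds ht] with s hs using h1 s hs)
    · exact Or.inr (by
        filter_upwards [Ioi_mem_nhds (show T < t by linarith)] with s hs using h2 s hs)
  refine ⟨z, fun t => ?_, fun t ht => ?_, fun t ht => ?_, fun t => ?_⟩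
  · rcases h3 t with h | h
    · exact hc.contMDiffAt.congr_of_eventuallyEq h
    · exact hd.contMDiffAt.congr_of_eventuallyEq h
  · rw [h1 t (by linarith), hc0 t ht]
  · rw [h2 t (by linarith), hc'T _ (by linarith)]
  · rcases h3 t with h | h
    · rw [M.speedSq_congr (c' := c) (by rwa [nhdsWithin_univ]) h.self_of_nhds]
      exact hcs t
    · rw [M.speedSq_congr (c' := fun t => c' (t - (T + ε))) (by rwa [nhdsWithin_univ])
        h.self_of_nhds, speedSq_comp_sub hc']
      exact hc's _

variable (M) in
/-- The infimum of the times in which `q` can be reached from `p`. -/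
def reachDist (p q : S) : ℝ≥0∞ :=
  ⨅ (T : ℝ) (_ : 0 < T ∧ M.Reach p q T), ENNReal.ofReal T

lemma reachDist_le {p q : S} {T : ℝ} (hT : 0 < T) (h : M.Reach p q T) :
    M.reachDist p q ≤ ENNReal.ofReal T := iInf₂_le T ⟨hT, h⟩

lemma exists_reach_of_reachDist_lt {p q : S} {r : ℝ≥0∞} (h : M.reachDist p q < r) :
    ∃ T : ℝ, 0 < T ∧ M.Reach p q T ∧ ENNReal.ofReal T < r := by
  simp only [reachDist, iInf_lt_iff] at h
  obtain ⟨T, ⟨h1, h2⟩, h3⟩ := h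
  exact ⟨T, h1, h2, h3⟩

lemma reachDist_self (p : S) : M.reachDist p p = 0 := by
  refine le_antisymm (le_of_forall_gt fun r hr => ?_) zero_le
  obtain ⟨T, hT0, hT⟩ := ENNReal.lt_iff_exists_real_btwn.1 hr
  refine (reachDist_le (T := T) ?_ (reach_refl p T)).trans_lt hT.2
  simpa using hT.1

lemma reachDist_triangle (p q r : S) :
    M.reachDist p r ≤ M.reachDist p q + M.reachDist q r := by
  by_cases h1 : M.reachDist p q = ⊤
  · simp [h1]
  by_cases h2 : M.reachDist q r = ⊤
  · simp [h2]
  refine ENNReal.le_of_forall_pos_le_add fun ε hε _ => ?_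
  -- Two thirds of ε pay for the almost optimal times, the last one for the gap required by
  -- `Reach.trans`.
  have hε3 : (0 : ℝ≥0∞) < ENNReal.ofReal (ε / 3) := by
    rw [ENNReal.ofReal_pos]; positivity
  obtain ⟨T, hT, hR, hlt⟩ := exists_reach_of_reachDist_lt (ENNReal.lt_add_right h1 hε3.ne')
  obtain ⟨T', hT', hR', hlt'⟩ := exists_reach_of_reachDist_lt (ENNReal.lt_add_right h2 hε3.ne')
  have hε3' : (0 : ℝ) < ε / 3 := by positivity
  calc M.reachDist p r ≤ ENNReal.ofReal (T + T' + ε / 3) :=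
        reachDist_le (by positivity) (hR.trans hT' hT hε3' hR')
    _ = ENNReal.ofReal T + ENNReal.ofReal T' + ENNReal.ofReal (ε / 3) := by
        rw [ENNReal.ofReal_add (by positivity) hε3'.le, ENNReal.ofReal_add hT.le hT'.le]
    _ ≤ (M.reachDist p q + ENNReal.ofReal (ε / 3)) + (M.reachDist q r + ENNReal.ofReal (ε / 3)) +
        ENNReal.ofReal (ε / 3) := by gcongr
    _ = M.reachDist p q + M.reachDist q r +
        (ENNReal.ofReal (ε / 3) + ENNReal.ofReal (ε / 3) + ENNReal.ofReal (ε / 3)) := by ring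
    _ = M.reachDist p q + M.reachDist q r + ε := by
        rw [← ENNReal.ofReal_add hε3'.le hε3'.le, ← ENNReal.ofReal_add (by positivity) hε3'.le,
          add_thirds, ENNReal.ofReal_coe_nnreal]

lemma inner_metricOp_nonneg (x₀ : S) (y v : CoordSpace E) :
    0 ≤ inner ℝ (M.metricOp x₀ y v) v := by
  rw [inner_metricOp, coordMetric]
  by_cases h : dparam x₀ y v = 0
  · rw [h, map_zero]
  · exact (M.conformalMetric.pos _ _ h).le

lemma continuousAt_metricOp {x₀ : S} {y₀ : CoordSpace E} (hy₀ : y₀ ∈ coordTarget x₀) :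
    ContinuousAt (M.metricOp x₀) y₀ :=
  (M.contDiffOn_metricOp x₀).continuousOn.continuousAt ((isOpen_coordTarget x₀).mem_nhds hy₀)

/-- Coordinate segments can be followed in a time close to their length. -/
lemma eventually_reach_param {x₀ : S} {y₀ : CoordSpace E} (hy₀ : y₀ ∈ coordTarget x₀) {C : ℝ}
    (hC : 1 < C) :
    ∀ᶠ p : CoordSpace E × CoordSpace E in 𝓝 (y₀, y₀), ∀ T, 0 < T →
      C * √(inner ℝ (M.metricOp x₀ y₀ (p.2 - p.1)) (p.2 - p.1)) < T →
        M.Reach (param x₀ p.1) (param x₀ p.2) T := by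
  have hC0 : 0 < C := by linarith
  have h1 := eventually_le_mul_of_continuousAt (continuousAt_metricOp hy₀)
    (fun v hv => M.inner_metricOp_pos hy₀ hv) (one_lt_pow₀ hC two_ne_zero)
  obtain ⟨r, hr, hball⟩ := Metric.mem_nhds_iff.1
    (inter_mem ((isOpen_coordTarget (E := E) x₀).mem_nhds hy₀) h1)
  rw [nhds_prod_eq]
  filter_upwards [prod_mem_prod (Metric.ball_mem_nhds y₀ hr) (Metric.ball_mem_nhds y₀ hr)]
    with p hp T hT0 hT
  set v := p.2 - p.1 with hv
  -- On the ball the forms exceed that at y₀ by a factor of at most C². With a step of slope at most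
  -- 1 / L, the squared speed is at most L⁻² C² ⟨G y₀ v, v⟩ = 1, where G is `metricOp`.
  set L := C * √(inner ℝ (M.metricOp x₀ y₀ v) v) with hL
  by_cases hv0 : v = 0
  · rw [sub_eq_zero.1 (hv.symm.trans hv0)]
    exact reach_refl _ _
  have hpos := M.inner_metricOp_pos hy₀ hv0
  have hL0 : 0 < L := mul_pos hC0 (Real.sqrt_pos.2 hpos)
  have hL2 : L ^ 2 = C ^ 2 * inner ℝ (M.metricOp x₀ y₀ v) v := by
    rw [hL, mul_pow, Real.sq_sqrt hpos.le]
  obtain ⟨l, hls, hl0, hlT, hl01, hld⟩ := exists_smooth_step hL0 hT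
  have hmem (t) : p.1 + l t • v ∈ Metric.ball y₀ r := by
    have := (convex_ball y₀ r).add_smul_sub_mem hp.1 hp.2 (hl01 t)
    exact this
  have hder (t) : HasDerivAt (fun t => p.1 + l t • v) (deriv l t • v) t :=
    (((hls.differentiable (by simp)) t).hasDerivAt.smul_const v).const_add _
  refine ⟨fun t => param x₀ (p.1 + l t • v), ?_, fun t ht => ?_, fun t ht => ?_, fun t => ?_⟩
  · have h2 : ContMDiff 𝓘(ℝ, ℝ) 𝓘(ℝ, CoordSpace E) ∞ (fun t => p.1 + l t • v) :=
      (contDiff_const.add (hls.smul contDiff_const)).contMDiff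
    exact (contMDiffOn_param x₀).comp_contMDiff h2 fun t => (hball (hmem t)).1
  · simp [hl0 t ht]
  · simp [hlT t ht, hv]
  · rw [M.speedSq_param (hder t).hasDerivWithinAt uniqueDiffWithinAt_univ (hball (hmem t)).1,
      map_smul, real_inner_smul_left, real_inner_smul_right, ← mul_assoc, ← sq]
    calc deriv l t ^ 2 * inner ℝ (M.metricOp x₀ (p.1 + l t • v) v) v
        ≤ (L⁻¹) ^ 2 * (C ^ 2 * inner ℝ (M.metricOp x₀ y₀ v) v) :=
          mul_le_mul (hld t) ((hball (hmem t)).2 v).1 (inner_metricOp_nonneg _ _ _) (by positivity)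
      _ = 1 := by rw [← hL2, ← mul_pow, inv_mul_cancel₀ hL0.ne', one_pow]

lemma eventually_reachDist_param_le {x₀ : S} {y₀ : CoordSpace E} (hy₀ : y₀ ∈ coordTarget x₀) {C : ℝ}
    (hC : 1 < C) :
    ∀ᶠ p : CoordSpace E × CoordSpace E in 𝓝 (y₀, y₀),
      M.reachDist (param x₀ p.1) (param x₀ p.2) ≤
        ENNReal.ofReal (C * √(inner ℝ (M.metricOp x₀ y₀ (p.2 - p.1)) (p.2 - p.1))) := by
  filter_upwards [eventually_reach_param (M := M) hy₀ hC] with p hp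
  refine le_of_forall_gt fun r hr => ?_
  obtain ⟨T, hT0, hT⟩ := ENNReal.lt_iff_exists_real_btwn.1 hr
  have hT1 := (ENNReal.ofReal_lt_ofReal_iff' .. ).1 hT.1
  exact (reachDist_le hT1.2 (hp T hT1.2 hT1.1)).trans_lt hT.2

/-- The constant is crude but uniform near `y₀`. It supplies the finiteness and Lipschitz continuity
used in `le_lintegral_of_lipschitzOnWith`, whose sharp hypothesis is only infinitesimal. -/
lemma exists_reachDist_param_le {x₀ : S} {y₀ : CoordSpace E} (hy₀ : y₀ ∈ coordTarget x₀) :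
    ∃ L : ℝ, ∃ U ⊆ coordTarget x₀, IsOpen U ∧ y₀ ∈ U ∧ ∀ y ∈ U, ∀ z ∈ U,
      M.reachDist (param x₀ y) (param x₀ z) ≤ ENNReal.ofReal (L * ‖z - y‖) := by
  have h1 := eventually_reachDist_param_le (M := M) hy₀ one_lt_two
  rw [nhds_prod_eq] at h1
  obtain ⟨U, hU, h2⟩ := mem_prod_self_iff.1 h1
  obtain ⟨V, hVU, hVo, hV⟩ := mem_nhds_iff.1
    (inter_mem hU ((isOpen_coordTarget (E := E) x₀).mem_nhds hy₀))
  refine ⟨2 * √‖M.metricOp x₀ y₀‖, V, fun y hy => (hVU hy).2, hVo, hV, fun y hy z hz => ?_⟩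
  refine (h2 (mk_mem_prod (hVU hy).1 (hVU hz).1)).trans (ENNReal.ofReal_le_ofReal ?_)
  simp only
  rw [mul_assoc]
  gcongr
  refine Real.sqrt_le_iff.2 ⟨by positivity, ?_⟩
  rw [mul_pow, Real.sq_sqrt (norm_nonneg _)]
  calc _ ≤ ‖M.metricOp x₀ y₀ (z - y)‖ * ‖z - y‖ := real_inner_le_norm _ _
    _ ≤ ‖M.metricOp x₀ y₀‖ * ‖z - y‖ * ‖z - y‖ := by
      gcongr; exact (M.metricOp x₀ y₀).le_opNorm _
    _ = _ := by ring

/-- In coordinates, `reachDist` is bounded by the length of Lipschitz curves. -/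
lemma reachDist_param_le_lintegral {x₀ : S} {L : ℝ} {U : Set (CoordSpace E)}
    (hU : U ⊆ coordTarget x₀) (hL : ∀ y ∈ U, ∀ z ∈ U,
      M.reachDist (param x₀ y) (param x₀ z) ≤ ENNReal.ofReal (L * ‖z - y‖))
    {w f : ℝ → CoordSpace E} {a b : ℝ} (hab : a ≤ b) {K : NNReal}
    (hw : LipschitzOnWith K w (Icc a b)) (hwU : MapsTo w (Icc a b) U)
    (hf : ∀ᵐ s, s ∈ Ioc a b → HasDerivAt w (f s) s) :
    M.reachDist (param x₀ (w a)) (param x₀ (w b)) ≤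
      ∫⁻ s in Ioc a b, ENNReal.ofReal √(inner ℝ (M.metricOp x₀ (w s) (f s)) (f s)) :=
  le_lintegral_of_lipschitzOnWith (G := M.metricOp x₀)
    (ρ := fun y z => M.reachDist (param x₀ y) (param x₀ z))
    (fun _ _ _ => reachDist_triangle _ _ _) (fun _ => reachDist_self _) hL
    (fun _ hy _ hC => eventually_reachDist_param_le (hU hy) hC) hab hw hwU hf

lemma dist_le_of_reach {p q : S} {T : ℝ} (hT : 0 < T) (h : M.Reach p q T) :
    M.dist p q ≤ ENNReal.ofReal T := by
  obtain ⟨c, hc, hc0, hcT, hcs⟩ := h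
  have h1 := M.dist_le_of_speedSq_le (c := c) (τ := id) (τ' := fun _ => 1) hT.le
    (hc.contMDiffOn.of_le (by simp)) (fun s _ => hasDerivWithinAt_id _ _)
    (fun _ _ => zero_le_one) (fun s hs => by
      rw [M.speedSq_mono (subset_univ _) (hc.mdifferentiable (by simp) s).mdifferentiableWithinAt
        (uniqueDiffOn_Icc hT s hs), one_pow]
      exact hcs s)
  rwa [hc0 0 le_rfl, hcT T le_rfl, id, id, sub_zero] at h1

lemma dist_le_reachDist (p q : S) : M.dist p q ≤ M.reachDist p q := by
  refine le_of_forall_gt fun r hr => ?_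
  obtain ⟨T, hT, h, hlt⟩ := exists_reach_of_reachDist_lt hr
  exact (dist_le_of_reach hT h).trans_lt hlt

lemma reachDist_le_lintegral_of_mapsTo {c : ℝ → S} {I : Set ℝ}
    (hc : ContMDiffOn 𝓘(ℝ, ℝ) 𝓘(ℝ, E) 1 c I) {x₀ : S} {L : ℝ} {U : Set (CoordSpace E)}
    (hU : U ⊆ coordTarget x₀) (hL : ∀ y ∈ U, ∀ z ∈ U,
      M.reachDist (param x₀ y) (param x₀ z) ≤ ENNReal.ofReal (L * ‖z - y‖))
    {a b : ℝ} (hab : a ≤ b) (hI : Icc a b ⊆ I)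
    (hcU : MapsTo c (Icc a b) ((chartAt E x₀).source ∩ coord x₀ ⁻¹' U)) :
    M.reachDist (c a) (c b) ≤ ∫⁻ s in Ioc a b, ENNReal.ofReal √(M.speedSq c I s) := by
  have hw : ContDiffOn ℝ 1 (fun s => coord (E := E) x₀ (c s)) (Icc a b) := by
    rw [← contMDiffOn_iff_contDiffOn]
    exact ((contMDiffOn_coord x₀).of_le (by simp)).comp (hc.mono hI) fun s hs => (hcU hs).1
  obtain ⟨K, hK⟩ := hw.exists_lipschitzOnWith one_ne_zero (convex_Icc _ _) isCompact_Icc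
  have hne : ∀ᵐ s : ℝ, s ≠ b := by simp [MeasureTheory.ae_iff]
  have hd : ∀ s ∈ Ioc a b, s ≠ b → HasDerivAt (fun s => coord (E := E) x₀ (c s))
      (deriv (fun s => coord (E := E) x₀ (c s)) s) s := fun s hs hsb =>
    ((hw.differentiableOn one_ne_zero s (Ioc_subset_Icc_self hs)).differentiableAt
      (Icc_mem_nhds hs.1 (lt_of_le_of_ne hs.2 hsb))).hasDerivAt
  have h1 := reachDist_param_le_lintegral hU hL hab hK (fun s hs => (hcU hs).2)
    (by filter_upwards [hne] with s h hs using hd s hs h)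
  rw [param_coord (hcU (left_mem_Icc.2 hab)).1, param_coord (hcU (right_mem_Icc.2 hab)).1] at h1
  refine h1.trans (MeasureTheory.setLIntegral_mono_ae' measurableSet_Ioc ?_)
  filter_upwards [hne] with s hsb hs
  have hsI : I ∈ 𝓝 s := mem_of_superset (Icc_mem_nhds hs.1 (lt_of_le_of_ne hs.2 hsb)) hI
  rw [M.speedSq_eq_inner_metricOp (hc.continuousOn s (hI (Ioc_subset_Icc_self hs)))
    (hd s hs hsb).hasDerivWithinAt (uniqueDiffWithinAt_of_mem_nhds hsI)
    (hcU (Ioc_subset_Icc_self hs)).1]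

/-- By compactness of [0, 1], a C¹ curve of length less than `r` is cut into finitely many arcs,
each inside one good chart. The bounds for the arcs add up by the triangle inequality, so the C¹
curve itself need not be smoothed. -/
lemma reachDist_le_dist (p q : S) : M.reachDist p q ≤ M.dist p q := by
  refine le_of_forall_gt fun r hr => ?_
  obtain ⟨c, rfl, rfl, hc, hlt⟩ := M.exists_contMDiffOn_of_dist_lt hr
  choose L U hU hUo hmem hL using fun x : S =>
    exists_reachDist_param_le (M := M) (coord_mem (E := E) (mem_chart_source E x))
  have hcont : Continuous ((Icc (0 : ℝ) 1).domRestrict c) := hc.continuousOn.domRestrict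
  obtain ⟨t, ht0, htm, ⟨m, hm⟩, htc⟩ := exists_monotone_Icc_subset_open_cover_Icc
    (zero_le_one' ℝ)
    (c := fun s : Icc (0 : ℝ) 1 => (Icc (0 : ℝ) 1).domRestrict c ⁻¹'
      ((chartAt E (c s)).source ∩ coord (c s) ⁻¹' U (c s)))
    (fun s => (((contMDiffOn_coord (c s)).continuousOn.isOpen_inter_preimage
      (chartAt E (c s)).open_source (hUo (c s))).preimage hcont))
    (fun s _ => mem_iUnion.2 ⟨s, mem_chart_source E (c s), hmem (c s)⟩)
  have key : ∀ n, M.reachDist (c 0) (c (t n)) ≤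
      ∫⁻ s in Ioc (0 : ℝ) (t n), ENNReal.ofReal √(M.speedSq c (Icc 0 1) s) := by
    intro n
    induction n with
    | zero => rw [ht0, reachDist_self]; exact zero_le
    | succ n ih =>
      obtain ⟨i, hi⟩ := htc n
      have hle : (t n : ℝ) ≤ t (n + 1) := htm (Nat.le_succ n)
      have h0 : (0 : ℝ) ≤ t n := (t n).2.1
      have h1 := reachDist_le_lintegral_of_mapsTo hc (hU _) (hL _) hle
        (Icc_subset_Icc h0 (t (n + 1)).2.2) (x₀ := c i) (fun s hs =>
          hi (show (⟨s, h0.trans hs.1, hs.2.trans (t (n + 1)).2.2⟩ : Icc (0 : ℝ) 1) ∈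
            Icc (t n) (t (n + 1)) from hs))
      refine (reachDist_triangle _ (c (t n)) _).trans ((add_le_add ih h1).trans_eq ?_)
      rw [← Ioc_union_Ioc_eq_Ioc h0 hle, MeasureTheory.lintegral_union measurableSet_Ioc]
      rw [Set.disjoint_left]
      intro s hs hs'
      exact absurd hs.2 (not_le.2 hs'.1)
  have h1 := key m
  rw [hm m le_rfl] at h1
  refine h1.trans_lt (lt_of_le_of_lt ?_ hlt)
  exact MeasureTheory.lintegral_mono_set Ioc_subset_Icc_self

lemma reachDist_eq_dist (p q : S) : M.reachDist p q = M.dist p q :=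
  le_antisymm (reachDist_le_dist p q) (dist_le_reachDist p q)

/-- The bridge from the distance to smooth causal curves. Waiting at `q` makes every time beyond the
distance available. -/
lemma exists_reach_of_dist_lt {p q : S} {T : ℝ} (h : M.dist p q < ENNReal.ofReal T) :
    M.Reach p q T := by
  rw [← reachDist_eq_dist] at h
  obtain ⟨T', hT', ⟨c, h1, h2, h3, h4⟩, hlt⟩ := exists_reach_of_reachDist_lt h
  have hlt' := (ENNReal.ofReal_lt_ofReal_iff'.1 hlt).1
  exact ⟨c, h1, h2, fun t ht => h3 t (hlt'.le.trans ht), h4⟩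

end
end StandardStaticSpacetime

/-! ### Calculus of variations: Lipschitz minimisers of the energy are smooth. -/

lemma LipschitzOnWith.intervalIntegral_of_norm_le {F : Type*} [NormedAddCommGroup F]
    [NormedSpace ℝ F] {h : ℝ → F} {a b C : ℝ} (hab : a ≤ b)
    (hi : IntervalIntegrable h MeasureTheory.volume a b) (hC : ∀ s ∈ Ioc a b, ‖h s‖ ≤ C) :
    LipschitzOnWith C.toNNReal (fun s => ∫ t in a..s, h t) (Icc a b) := by
  refine LipschitzOnWith.of_dist_le_mul fun s hs s' hs' => ?_
  have hint (x : ℝ) (hx : x ∈ Icc a b) : IntervalIntegrable h MeasureTheory.volume a x :=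
    hi.mono_set (by rw [uIcc_of_le hab, uIcc_of_le hx.1]; exact Icc_subset_Icc_right hx.2)
  rw [dist_eq_norm, intervalIntegral.integral_interval_sub_left (hint s hs) (hint s' hs'),
    Real.dist_eq]
  refine (intervalIntegral.norm_integral_le_of_norm_le_const (C := C) fun t ht => ?_).trans
    (mul_le_mul_of_nonneg_right (Real.le_coe_toNNReal C) (abs_nonneg _))
  refine hC t ⟨(le_min hs'.1 hs.1).trans_lt ht.1, ht.2.trans (max_le hs'.2 hs.2)⟩

/-- The lemma of du Bois-Reymond. -/
lemma exists_ae_eq_const_add_integral {p q : ℝ → ℝ} {a b C : ℝ} (hab : a < b)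
    (hp : IntervalIntegrable p MeasureTheory.volume a b)
    (hq : IntervalIntegrable q MeasureTheory.volume a b)
    (hqC : ∀ s ∈ Ioc a b, |q s| ≤ C)
    (h : ∀ (ψ : ℝ → ℝ) (K : NNReal), LipschitzOnWith K ψ (Icc a b) → ψ a = 0 → ψ b = 0 →
      ∫ s in a..b, (p s * ψ s + q s * deriv ψ s) = 0) :
    ∃ m : ℝ, ∀ᵐ s, s ∈ Ioc a b → q s = m + ∫ t in a..s, p t := by
  set Q : ℝ → ℝ := fun s => ∫ t in a..s, p t with hQ
  have hQac : AbsolutelyContinuousOnInterval Q a b :=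
    hp.absolutelyContinuousOnInterval_intervalIntegral left_mem_uIcc
  have hQc : ContinuousOn Q (uIcc a b) := hQac.continuousOn
  have hQi : IntervalIntegrable Q MeasureTheory.volume a b := hQc.intervalIntegrable
  obtain ⟨D, hD⟩ := hQac.exists_bound
  -- The mean of q − Q: with it the primitive ψ of k = q − Q − m vanishes at both ends, so it is an
  -- admissible test function. Testing with it gives ∫ k² = 0.
  set m := (∫ s in a..b, (q s - Q s)) / (b - a) with hm
  set k : ℝ → ℝ := fun s => q s - Q s - m with hk
  have hki : IntervalIntegrable k MeasureTheory.volume a b :=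
    (hq.sub hQi).sub intervalIntegrable_const
  set ψ : ℝ → ℝ := fun s => ∫ t in a..s, k t with hψ
  have hkb : ∀ s ∈ Ioc a b, |k s| ≤ C + D + |m| := fun s hs => by
    have h1 := hqC s hs
    have h2 := hD s (by rw [uIcc_of_le hab.le]; exact Ioc_subset_Icc_self hs)
    rw [Real.norm_eq_abs] at h2
    calc |q s - Q s - m| ≤ |q s - Q s| + |m| := abs_sub _ _
      _ ≤ |q s| + |Q s| + |m| := by gcongr; exact abs_sub _ _
      _ ≤ _ := by gcongr
  have hψl := LipschitzOnWith.intervalIntegral_of_norm_le hab.le hki hkb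
  have hψa : ψ a = 0 := by simp [hψ]
  have hψb : ψ b = 0 := by
    simp only [hψ, hk]
    rw [intervalIntegral.integral_sub (hq.sub hQi) intervalIntegrable_const,
      intervalIntegral.integral_const, hm, smul_eq_mul, mul_div_cancel₀ _ (sub_pos.2 hab).ne',
      sub_self]
  have hψac : AbsolutelyContinuousOnInterval ψ a b :=
    hki.absolutelyContinuousOnInterval_intervalIntegral left_mem_uIcc
  have h1 := h ψ _ hψl hψa hψb
  have hdψ : ∀ᵐ s, s ∈ uIcc a b → deriv ψ s = k s := by
    filter_upwards [hki.ae_hasDerivAt_integral] with s hs hsI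
    exact (hs hsI a left_mem_uIcc).deriv
  have hdQ : ∀ᵐ s, s ∈ uIcc a b → deriv Q s = p s := by
    filter_upwards [hp.ae_hasDerivAt_integral] with s hs hsI
    exact (hs hsI a left_mem_uIcc).deriv
  -- Integration by parts for absolutely continuous functions; the boundary terms vanish with ψ.
  have h2 : ∫ s in a..b, p s * ψ s = - ∫ s in a..b, Q s * k s := by
    have h3 := hQac.integral_mul_deriv_eq_deriv_mul hψac
    rw [hψa, hψb, mul_zero, mul_zero, sub_zero, zero_sub] at h3
    rw [← neg_eq_iff_eq_neg, intervalIntegral.integral_congr_ae (g := fun s => deriv Q s * ψ s),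
      ← h3]
    · refine intervalIntegral.integral_congr_ae ?_
      filter_upwards [hdψ] with s hs hsI
      rw [hs (uIoc_subset_uIcc hsI)]
    · filter_upwards [hdQ] with s hs hsI
      rw [hs (uIoc_subset_uIcc hsI)]
  have hdψi : ∫ s in a..b, q s * deriv ψ s = ∫ s in a..b, q s * k s := by
    refine intervalIntegral.integral_congr_ae ?_
    filter_upwards [hdψ] with s hs hsI
    rw [hs (uIoc_subset_uIcc hsI)]
  have hbdd {x y : ℝ → ℝ} {B : ℝ} (hx : IntervalIntegrable x MeasureTheory.volume a b)
      (hy : IntervalIntegrable y MeasureTheory.volume a b) (hB : ∀ s ∈ Ioc a b, |x s| ≤ B) :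
      IntervalIntegrable (fun s => x s * y s) MeasureTheory.volume a b := by
    rw [intervalIntegrable_iff_integrableOn_Ioc_of_le hab.le] at *
    refine MeasureTheory.Integrable.bdd_mul (c := B) hy hx.aestronglyMeasurable ?_
    filter_upwards [MeasureTheory.ae_restrict_mem measurableSet_Ioc] with s hs using hB s hs
  have hqk := hbdd hq hki hqC
  have hQk := hki.continuousOn_mul hQc
  have hkk := hbdd hki hki hkb
  have h4 : ∫ s in a..b, k s * k s = 0 := by
    have h5 : ∫ s in a..b, (q s * k s - Q s * k s) = 0 := by
      rw [intervalIntegral.integral_sub hqk hQk, ← hdψi, ← neg_add_eq_sub, ← h2,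
        ← intervalIntegral.integral_add (hp.mul_continuousOn hψac.continuousOn)]
      · exact h1
      · rw [intervalIntegrable_congr_ae (g := fun s => q s * k s)]
        · exact hqk
        · rw [EventuallyEq, MeasureTheory.ae_restrict_iff' measurableSet_uIoc]
          filter_upwards [hdψ] with s hs hsI
          rw [hs (uIoc_subset_uIcc hsI)]
    have h6 : ∫ s in a..b, m * k s = 0 := by
      rw [intervalIntegral.integral_const_mul]
      exact mul_eq_zero_of_right _ hψb
    calc ∫ s in a..b, k s * k s = ∫ s in a..b, ((q s * k s - Q s * k s) - m * k s) := by
          refine intervalIntegral.integral_congr fun s _ => ?_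
          simp only [hk]; ring
      _ = 0 := by
          rw [intervalIntegral.integral_sub (hqk.sub hQk) (hki.const_mul m), h5, h6, sub_zero]
  refine ⟨m, ?_⟩
  rw [intervalIntegral.integral_of_le hab.le,
    MeasureTheory.integral_eq_zero_iff_of_nonneg (fun s => mul_self_nonneg _)
      ((intervalIntegrable_iff_integrableOn_Ioc_of_le hab.le).1 hkk), EventuallyEq,
    MeasureTheory.ae_restrict_iff' measurableSet_Ioc] at h4
  filter_upwards [h4] with s hs hsI
  have := mul_self_eq_zero.1 (hs hsI)
  simp only [hk] at this
  linarith

lemma hasDerivWithinAt_integral_of_continuousOn {F : Type*} [NormedAddCommGroup F]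
    [NormedSpace ℝ F] [CompleteSpace F] {k : ℝ → F} {a b : ℝ}
    (hk : ContinuousOn k (Icc a b)) {s : ℝ} (hs : s ∈ Icc a b) :
    HasDerivWithinAt (fun s => ∫ t in a..s, k t) (k s) (Icc a b) s := by
  have hab : a ≤ b := hs.1.trans hs.2
  have : Fact (s ∈ Icc a b) := ⟨hs⟩
  refine intervalIntegral.integral_hasDerivWithinAt_right ?_
    (hk.stronglyMeasurableAtFilter_nhdsWithin measurableSet_Icc s) (hk s hs)
  exact (hk.mono (by rw [uIcc_of_le hs.1]; exact Icc_subset_Icc_right hs.2)).intervalIntegrable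

/-- Bootstrapping for the Euler-Lagrange equation. -/
lemma contDiffOn_of_euler_lagrange {F : Type*} [NormedAddCommGroup F] [InnerProductSpace ℝ F]
    [FiniteDimensional ℝ F] {A : F → F →L[ℝ] F} {U : Set F} (hU : IsOpen U)
    (hA : ContDiffOn ℝ ∞ A U) (hunit : ∀ y ∈ U, IsUnit (A y)) {u k : ℝ → F} {a b : ℝ} (hab : a < b)
    (hu : ∀ s ∈ Icc a b, HasDerivWithinAt u (k s) (Icc a b) s) (huU : MapsTo u (Icc a b) U)
    (hk : ContinuousOn k (Icc a b)) {ι : Type*} [Fintype ι] (e : ι → F) (m : ι → ℝ)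
    (hkeq : ∀ s ∈ Icc a b, k s = Ring.inverse (A (u s)) (∑ i, (m i +
      ∫ t in a..s, 1 / 2 * inner ℝ (fderiv ℝ A (u t) (e i) (k t)) (k t)) • e i)) :
    ContDiffOn ℝ ∞ u (Icc a b) := by
  have huc : ContinuousOn u (Icc a b) := fun s hs => (hu s hs).continuousWithinAt
  have hdA : ContDiffOn ℝ ∞ (fderiv ℝ A) U := hA.fderiv_of_isOpen hU (by simp)
  have hp (n : ℕ∞) (h1 : ContDiffOn ℝ n u (Icc a b)) (h2 : ContDiffOn ℝ n k (Icc a b)) (i : ι) :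
      ContDiffOn ℝ n (fun t => 1 / 2 * inner ℝ (fderiv ℝ A (u t) (e i) (k t)) (k t)) (Icc a b) :=
    contDiffOn_const.mul (((((hdA.of_le (by exact_mod_cast le_top)).comp h1 huU).clm_apply contDiffOn_const).clm_apply
      h2).inner ℝ h2)
  have hpc (i : ι) : ContinuousOn (fun t => 1 / 2 * inner ℝ (fderiv ℝ A (u t) (e i) (k t)) (k t))
      (Icc a b) :=
    (hp 0 (contDiffOn_zero.2 huc) (contDiffOn_zero.2 hk) i).continuousOn
  -- One derivative is gained per round: u' = k puts u in Cⁿ⁺¹, the integrals in `hkeq` become Cⁿ⁺¹,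
  -- and so does the inverse of A (u s), hence k.
  have key (n : ℕ) : ContDiffOn ℝ n u (Icc a b) ∧ ContDiffOn ℝ n k (Icc a b) := by
    induction n with
    | zero => exact ⟨contDiffOn_zero.2 huc, contDiffOn_zero.2 hk⟩
    | succ n ih =>
      have hu' : ContDiffOn ℝ (n + 1 : ℕ) u (Icc a b) := by
        push_cast
        rw [contDiffOn_succ_iff_derivWithin (uniqueDiffOn_Icc hab)]
        refine ⟨fun s hs => (hu s hs).differentiableWithinAt, by simp, ih.2.congr fun s hs => ?_⟩
        exact (hu s hs).derivWithin (uniqueDiffOn_Icc hab s hs)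
      refine ⟨hu', ?_⟩
      have hR (i : ι) : ContDiffOn ℝ (n + 1 : ℕ)
          (fun s => ∫ t in a..s, 1 / 2 * inner ℝ (fderiv ℝ A (u t) (e i) (k t)) (k t)) (Icc a b) := by
        push_cast
        rw [contDiffOn_succ_iff_derivWithin (uniqueDiffOn_Icc hab)]
        refine ⟨fun s hs => (hasDerivWithinAt_integral_of_continuousOn (hpc i)
          hs).differentiableWithinAt, by simp, (hp n ih.1 ih.2 i).congr fun s hs => ?_⟩
        exact (hasDerivWithinAt_integral_of_continuousOn (hpc i) hs).derivWithin
          (uniqueDiffOn_Icc hab s hs)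
      have hinv : ContDiffOn ℝ (n + 1 : ℕ) (fun s => Ring.inverse (A (u s))) (Icc a b) := by
        intro s hs
        obtain ⟨x, hx⟩ := hunit _ (huU hs)
        have h1 : ContDiffAt ℝ (n + 1 : ℕ) Ring.inverse (A (u s)) := by
          rw [← hx]; exact contDiffAt_ringInverse ℝ x
        exact h1.comp_contDiffWithinAt s
          (((hA.of_le (by exact_mod_cast le_top)).comp hu' huU) s hs)
      refine ContDiffOn.congr (hinv.clm_apply (ContDiffOn.sum fun i _ =>
        (contDiffOn_const.add (hR i)).smul contDiffOn_const)) hkeq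
  rw [contDiffOn_infty]
  exact fun n => (key n).1

/-- `deriv u` is controlled only inside the interval. Cut off to zero elsewhere, it becomes bounded
and measurable everywhere, as differentiation under the integral requires. -/
lemma LipschitzOnWith.exists_bounded_deriv {F : Type*} [NormedAddCommGroup F]
    [NormedSpace ℝ F] [FiniteDimensional ℝ F] {u : ℝ → F} {a b : ℝ} {K : NNReal}
    (hu : LipschitzOnWith K u (Icc a b)) :
    ∃ f : ℝ → F, MeasureTheory.StronglyMeasurable f ∧ (∀ s, ‖f s‖ ≤ K) ∧
      (∀ᵐ s, s ∈ Ioc a b → HasDerivAt u (f s) s) ∧ ∀ᵐ s, s ∈ Ioc a b → f s = deriv u s := by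
  have : CompleteSpace F := FiniteDimensional.complete ℝ F
  have hne : ∀ᵐ s : ℝ, s ≠ b := by simp [MeasureTheory.ae_iff]
  refine ⟨(Ioo a b).indicator (deriv u), (stronglyMeasurable_deriv u).indicator measurableSet_Ioo,
    fun s => ?_, ?_, ?_⟩
  · by_cases hs : s ∈ Ioo a b
    · rw [indicator_of_mem hs]
      exact norm_deriv_le_of_lipschitzOn (Icc_mem_nhds hs.1 hs.2) hu
    · rw [indicator_of_notMem hs, norm_zero]
      exact K.2
  · filter_upwards [hne, hu.ae_differentiableWithinAt_of_mem] with s h1 h2 hs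
    have hs' : s ∈ Ioo a b := ⟨hs.1, lt_of_le_of_ne hs.2 h1⟩
    rw [indicator_of_mem hs']
    exact ((h2 (Ioo_subset_Icc_self hs')).differentiableAt (Icc_mem_nhds hs'.1 hs'.2)).hasDerivAt
  · filter_upwards [hne] with s h1 hs
    have hs' : s ∈ Ioo a b := ⟨hs.1, lt_of_le_of_ne hs.2 h1⟩
    rw [indicator_of_mem hs']

section

variable {F : Type*} [NormedAddCommGroup F] [InnerProductSpace ℝ F] [FiniteDimensional ℝ F]
  {A : F → F →L[ℝ] F} {U : Set F}

lemma aestronglyMeasurable_inner_clm {a b : ℝ} {w f g : ℝ → F} (hA : ContinuousOn A U)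
    (hw : ContinuousOn w (Icc a b)) (hwU : MapsTo w (Icc a b) U)
    (hf : MeasureTheory.StronglyMeasurable f) (hg : MeasureTheory.StronglyMeasurable g) :
    MeasureTheory.AEStronglyMeasurable (fun s => inner ℝ (A (w s) (f s)) (g s))
      (MeasureTheory.volume.restrict (Ioc a b)) := by
  have h1 := ((hA.comp hw hwU).aestronglyMeasurable (μ := MeasureTheory.volume)
    measurableSet_Icc).mono_measure
      (MeasureTheory.Measure.restrict_mono Ioc_subset_Icc_self le_rfl)
  have h2 : Continuous fun p : (F →L[ℝ] F) × F × F => inner ℝ (p.1 p.2.1) p.2.2 := by fun_prop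
  exact h2.comp_aestronglyMeasurable
    (h1.prodMk (hf.aestronglyMeasurable.prodMk hg.aestronglyMeasurable))

/-- The first variation of the energy. -/
lemma hasDerivAt_energy (hU : IsOpen U) (hA : ContDiffOn ℝ ∞ A U)
    (hsymm : ∀ y ∈ U, ∀ v w, inner ℝ (A y v) w = inner ℝ (A y w) v)
    {u f : ℝ → F} {ψ g : ℝ → ℝ} {a b : ℝ} (hab : a ≤ b) {K C : ℝ}
    (hu : ContinuousOn u (Icc a b)) (huU : MapsTo u (Icc a b) U)
    (hf : MeasureTheory.StronglyMeasurable f) (hfK : ∀ s, ‖f s‖ ≤ K)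
    (hψ : ContinuousOn ψ (Icc a b))
    (hg : MeasureTheory.StronglyMeasurable g) (hgC : ∀ s, ‖g s‖ ≤ C) (e : F) :
    (∀ᶠ ε : ℝ in 𝓝 0, MapsTo (fun s => u s + ε • ψ s • e) (Icc a b) U) ∧
    IntervalIntegrable (fun s => inner ℝ (A (u s) (f s)) (f s)) MeasureTheory.volume a b ∧
    HasDerivAt (fun ε : ℝ => ∫ s in a..b, inner ℝ (A (u s + ε • ψ s • e) (f s + ε • g s • e))
      (f s + ε • g s • e))
      (∫ s in a..b, (inner ℝ (fderiv ℝ A (u s) e (f s)) (f s) * ψ s +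
        2 * inner ℝ (A (u s) (f s)) e * g s)) 0 := by
  have hdA : ContinuousOn (fun y => fderiv ℝ A y e) U :=
    ((hA.fderiv_of_isOpen (m := ∞) hU (by simp)).clm_apply contDiffOn_const).continuousOn
  have hcpt : IsCompact (u '' Icc a b) := isCompact_Icc.image_of_continuousOn hu
  -- For small ε the varied curves stay in the compact neighbourhood N of the image of u. This
  -- yields the constant D that dominates the ε-derivative of the integrand.
  obtain ⟨δ, hδ, hδU⟩ := hcpt.exists_cthickening_subset_open hU huU.image_subset
  set N := Metric.cthickening δ (u '' Icc a b) with hN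
  have hNc : IsCompact N := hcpt.cthickening
  obtain ⟨B, hB⟩ := isCompact_Icc.exists_bound_of_continuousOn hψ
  -- the range of `ε`
  obtain ⟨r, hr, hr1, hrδ⟩ : ∃ r > 0, r ≤ 1 ∧ r * (B * ‖e‖) ≤ δ := by
    refine ⟨min 1 (δ / (|B * ‖e‖| + 1)), by positivity, min_le_left _ _, ?_⟩
    calc min 1 (δ / (|B * ‖e‖| + 1)) * (B * ‖e‖) ≤ (δ / (|B * ‖e‖| + 1)) * (|B * ‖e‖| + 1) := by
          refine (mul_le_mul_of_nonneg_left ((le_abs_self _).trans (le_add_of_nonneg_right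
            zero_le_one)) (by positivity)).trans ?_
          exact mul_le_mul_of_nonneg_right (min_le_right _ _) (by positivity)
      _ = δ := by field_simp
  have hmem (ε : ℝ) (hε : ε ∈ Metric.ball (0 : ℝ) r) (s : ℝ) (hs : s ∈ Icc a b) :
      u s + ε • ψ s • e ∈ N := by
    refine Metric.mem_cthickening_of_dist_le _ (u s) _ _ (mem_image_of_mem _ hs) ?_
    rw [dist_eq_norm, add_sub_cancel_left, norm_smul, norm_smul]
    have hε' : ‖ε‖ ≤ r := by simpa using (Metric.mem_ball.1 hε).le
    exact (mul_le_mul hε' (mul_le_mul_of_nonneg_right (hB s hs) (norm_nonneg _))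
      (by positivity) hr.le).trans hrδ
  have hball : Metric.ball (0 : ℝ) r ∈ 𝓝 0 := Metric.ball_mem_nhds _ hr
  -- the derivative of the integrand
  let Φ : F × F × ℝ × ℝ → ℝ := fun p =>
    inner ℝ (p.2.2.1 • fderiv ℝ A p.1 e p.2.1 + A p.1 (p.2.2.2 • e)) p.2.1 +
      inner ℝ (A p.1 p.2.1) (p.2.2.2 • e)
  have hΦc : ContinuousOn Φ (N ×ˢ Metric.closedBall (0 : F) (K + C * ‖e‖) ×ˢ
      Metric.closedBall (0 : ℝ) B ×ˢ Metric.closedBall (0 : ℝ) C) := by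
    have hc : Continuous fun p : (F →L[ℝ] F) × (F →L[ℝ] F) × F × ℝ × ℝ =>
        inner ℝ (p.2.2.2.1 • p.1 p.2.2.1 + p.2.1 (p.2.2.2.2 • e)) p.2.2.1 +
          inner ℝ (p.2.1 p.2.2.1) (p.2.2.2.2 • e) := by fun_prop
    have h1 : ContinuousOn (fun p : F × F × ℝ × ℝ => A p.1) (N ×ˢ (univ : Set (F × ℝ × ℝ))) :=
      hA.continuousOn.comp continuousOn_fst fun p hp => hδU hp.1
    have h2 : ContinuousOn (fun p : F × F × ℝ × ℝ => fderiv ℝ A p.1 e)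
        (N ×ˢ (univ : Set (F × ℝ × ℝ))) :=
      hdA.comp continuousOn_fst fun p hp => hδU hp.1
    exact (hc.comp_continuousOn (h2.prodMk (h1.prodMk continuousOn_snd))).mono
      (prod_mono le_rfl (subset_univ _))
  obtain ⟨D, hD⟩ := (hNc.prod ((isCompact_closedBall (0 : F) (K + C * ‖e‖)).prod
    ((isCompact_closedBall (0 : ℝ) B).prod
      (isCompact_closedBall (0 : ℝ) C)))).exists_bound_of_continuousOn hΦc
  have hda (ε : ℝ) (hε : ε ∈ Metric.ball (0 : ℝ) r) (s : ℝ) (hs : s ∈ Icc a b) :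
      HasDerivAt (fun ε : ℝ => inner ℝ (A (u s + ε • ψ s • e) (f s + ε • g s • e))
        (f s + ε • g s • e)) (Φ (u s + ε • ψ s • e, f s + ε • g s • e, ψ s, g s)) ε := by
    have h1 : HasDerivAt (fun ε : ℝ => u s + ε • ψ s • e) (ψ s • e) ε := by
      simpa using ((hasDerivAt_id ε).smul_const (ψ s • e)).const_add (u s)
    have h2 : HasDerivAt (fun ε : ℝ => f s + ε • g s • e) (g s • e) ε := by
      simpa using ((hasDerivAt_id ε).smul_const (g s • e)).const_add (f s)
    have h3 : HasFDerivAt A (fderiv ℝ A (u s + ε • ψ s • e)) (u s + ε • ψ s • e) :=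
      (((hA _ (hδU (hmem ε hε s hs))).contDiffAt
        (hU.mem_nhds (hδU (hmem ε hε s hs)))).differentiableAt (by simp)).hasFDerivAt
    have h5 : HasDerivAt (fun ε : ℝ => A (u s + ε • ψ s • e))
        (ψ s • fderiv ℝ A (u s + ε • ψ s • e) e) ε := by
      rw [← map_smul]
      exact h3.comp_hasDerivAt ε h1
    have h4 := (h5.clm_apply h2).inner ℝ h2
    exact h4.congr_deriv (add_comm _ _)
  have hwc (ε : ℝ) : ContinuousOn (fun s => u s + ε • ψ s • e) (Icc a b) := by fun_prop
  have hfm (ε : ℝ) : MeasureTheory.StronglyMeasurable (fun s => f s + ε • g s • e) :=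
    hf.add ((hg.smul_const e).const_smul ε)
  have hmeas (ε : ℝ) (hε : ε ∈ Metric.ball (0 : ℝ) r) :
      MeasureTheory.AEStronglyMeasurable (fun s => inner ℝ (A (u s + ε • ψ s • e)
        (f s + ε • g s • e)) (f s + ε • g s • e)) (MeasureTheory.volume.restrict (Ioc a b)) :=
    aestronglyMeasurable_inner_clm (hA.continuousOn.mono hδU) (hwc ε) (hmem ε hε) (hfm ε) (hfm ε)
  have h0 := Metric.mem_ball_self (x := (0 : ℝ)) hr
  have hint0 : IntervalIntegrable (fun s => inner ℝ (A (u s) (f s)) (f s))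
      MeasureTheory.volume a b := by
    obtain ⟨D', hD'⟩ := hcpt.exists_bound_of_continuousOn (hA.continuousOn.mono huU.image_subset)
    rw [intervalIntegrable_iff_integrableOn_Ioc_of_le hab]
    refine MeasureTheory.IntegrableOn.of_bound (by simp) ?_ (D' * K * K) ?_
    · simpa using hmeas 0 h0
    · filter_upwards [MeasureTheory.ae_restrict_mem measurableSet_Ioc] with s hs
      refine (norm_inner_le_norm _ _).trans ?_
      have h1 := hD' _ (mem_image_of_mem u (Ioc_subset_Icc_self hs))
      have hK : 0 ≤ K := (norm_nonneg _).trans (hfK s)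
      have h2 := ((A (u s)).le_opNorm (f s)).trans
        (mul_le_mul h1 (hfK s) (norm_nonneg _) ((norm_nonneg _).trans h1))
      exact mul_le_mul h2 (hfK s) (norm_nonneg _) ((norm_nonneg _).trans h2)
  have hI : uIoc a b = Ioc a b := uIoc_of_le hab
  have main := (intervalIntegral.hasDerivAt_integral_of_dominated_loc_of_deriv_le
    (μ := MeasureTheory.volume) (a := a) (b := b) (bound := fun _ => D)
    (F := fun (ε : ℝ) s => inner ℝ (A (u s + ε • ψ s • e) (f s + ε • g s • e)) (f s + ε • g s • e))
    (F' := fun (ε : ℝ) s => Φ (u s + ε • ψ s • e, f s + ε • g s • e, ψ s, g s))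
    hball ?_ ?_ ?_ ?_ intervalIntegrable_const ?_).2
  · refine ⟨?_, hint0, ?_⟩
    · filter_upwards [hball] with ε hε s hs using hδU (hmem ε hε s hs)
    -- At ε = 0 the symmetry of A merges the two terms that contain g into one with factor 2.
    · refine main.congr_deriv (Eq.symm ?_)
      refine intervalIntegral.integral_congr fun s hs => ?_
      rw [uIcc_of_le hab] at hs
      simp only [Φ, zero_smul, add_zero, map_smul, inner_add_left, real_inner_smul_left,
        real_inner_smul_right, hsymm _ (huU hs) e (f s)]
      ring
  · rw [hI]
    filter_upwards [hball] with ε hε using hmeas ε hε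
  · simpa using hint0
  · rw [hI]
    simp only [zero_smul, add_zero, Φ]
    have hψm := (hψ.aestronglyMeasurable (μ := MeasureTheory.volume)
      measurableSet_Icc).mono_measure
        (MeasureTheory.Measure.restrict_mono (Ioc_subset_Icc_self (a := a) (b := b)) le_rfl)
    have hum := (hu.aestronglyMeasurable (μ := MeasureTheory.volume)
      measurableSet_Icc).mono_measure
        (MeasureTheory.Measure.restrict_mono (Ioc_subset_Icc_self (a := a) (b := b)) le_rfl)
    have hdAm := ((hdA.comp hu huU).aestronglyMeasurable (μ := MeasureTheory.volume)
      measurableSet_Icc).mono_measure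
        (MeasureTheory.Measure.restrict_mono (Ioc_subset_Icc_self (a := a) (b := b)) le_rfl)
    have hAm := ((hA.continuousOn.comp hu huU).aestronglyMeasurable (μ := MeasureTheory.volume)
      measurableSet_Icc).mono_measure
        (MeasureTheory.Measure.restrict_mono (Ioc_subset_Icc_self (a := a) (b := b)) le_rfl)
    have hc : Continuous fun p : (F →L[ℝ] F) × (F →L[ℝ] F) × F × ℝ × ℝ =>
        inner ℝ (p.2.2.2.1 • p.1 p.2.2.1 + p.2.1 (p.2.2.2.2 • e)) p.2.2.1 +
          inner ℝ (p.2.1 p.2.2.1) (p.2.2.2.2 • e) := by fun_prop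
    exact hc.comp_aestronglyMeasurable (hdAm.prodMk (hAm.prodMk
      (hf.aestronglyMeasurable.prodMk (hψm.prodMk hg.aestronglyMeasurable))))
  · rw [hI]
    refine Eventually.of_forall fun s hs ε hε => ?_
    have hs' := Ioc_subset_Icc_self hs
    refine hD _ ⟨hmem ε hε s hs', ?_, ?_, ?_⟩
    · simp only [mem_closedBall_zero_iff]
      refine (norm_add_le _ _).trans (add_le_add (hfK s) ?_)
      rw [norm_smul, norm_smul]
      have hε' : ‖ε‖ ≤ 1 := by simpa using (Metric.mem_ball.1 hε).le.trans hr1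
      calc ‖ε‖ * (‖g s‖ * ‖e‖) ≤ 1 * (C * ‖e‖) := by gcongr; exact hgC s
        _ = _ := one_mul _
    · simpa using hB s hs'
    · simpa using hgC s
  · rw [hI]
    exact Eventually.of_forall fun s hs ε hε => hda ε hε s (Ioc_subset_Icc_self hs)

/-- Lipschitz curves that minimise the energy are smooth. -/
theorem contDiffOn_of_forall_energy_le (hU : IsOpen U) (hA : ContDiffOn ℝ ∞ A U)
    (hsymm : ∀ y ∈ U, ∀ v w, inner ℝ (A y v) w = inner ℝ (A y w) v)
    (hpos : ∀ y ∈ U, ∀ v, v ≠ 0 → 0 < inner ℝ (A y v) v)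
    {u : ℝ → F} {a b : ℝ} (hab : a < b) {K : NNReal}
    (hu : LipschitzOnWith K u (Icc a b)) (huU : MapsTo u (Icc a b) U)
    (hmin : ∀ (e : F) (ψ : ℝ → ℝ) (L : NNReal), LipschitzOnWith L ψ (Icc a b) → ψ a = 0 → ψ b = 0 →
      ∀ᶠ ε : ℝ in 𝓝 0, ∫ s in a..b, inner ℝ (A (u s) (deriv u s)) (deriv u s) ≤
        ∫ s in a..b, inner ℝ (A (u s + ε • ψ s • e) (deriv u s + ε • deriv ψ s • e))
          (deriv u s + ε • deriv ψ s • e)) :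
    ContDiffOn ℝ ∞ u (Icc a b) := by
  obtain ⟨f, hfm, hfK, hfd, hfe⟩ := hu.exists_bounded_deriv
  have hI : uIoc a b = Ioc a b := uIoc_of_le hab.le
  have hunit : ∀ y ∈ U, IsUnit (A y) := fun y hy => by
    rw [ContinuousLinearMap.isUnit_iff_isUnit_toLinearMap, Module.End.isUnit_iff]
    suffices h : Function.Injective (A y : F →ₗ[ℝ] F) from
      ⟨h, LinearMap.injective_iff_surjective.1 h⟩
    refine (injective_iff_map_eq_zero (A y : F →ₗ[ℝ] F)).2 fun v hv => ?_
    by_contra h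
    have := hpos y hy v h
    rw [show A y v = 0 from hv, inner_zero_left] at this
    exact this.false
  have hdA : ContDiffOn ℝ ∞ (fderiv ℝ A) U := hA.fderiv_of_isOpen hU (by simp)
  have hdAe (e : F) : ContinuousOn (fun y => fderiv ℝ A y e) U :=
    (hdA.clm_apply contDiffOn_const).continuousOn
  have hbdd {B : F → F →L[ℝ] F} (hB : ContinuousOn B U) {g : ℝ → F} {C : ℝ}
      (hg : MeasureTheory.StronglyMeasurable g) (hgC : ∀ s, ‖g s‖ ≤ C) :
      IntervalIntegrable (fun s => inner ℝ (B (u s) (f s)) (g s)) MeasureTheory.volume a b ∧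
      ∃ D, ∀ s ∈ Ioc a b, |inner ℝ (B (u s) (f s)) (g s)| ≤ D := by
    obtain ⟨D', hD'⟩ := isCompact_Icc.exists_bound_of_continuousOn (hB.comp hu.continuousOn huU)
    have hD : ∀ s ∈ Ioc a b, |inner ℝ (B (u s) (f s)) (g s)| ≤ D' * K * C := fun s hs => by
      refine (abs_real_inner_le_norm _ _).trans ?_
      have h1 := hD' _ (Ioc_subset_Icc_self hs)
      have h2 := ((B (u s)).le_opNorm (f s)).trans
        (mul_le_mul h1 (hfK s) (norm_nonneg _) ((norm_nonneg _).trans h1))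
      exact mul_le_mul h2 (hgC s) (norm_nonneg _) ((norm_nonneg _).trans h2)
    refine ⟨?_, _, hD⟩
    rw [intervalIntegrable_iff_integrableOn_Ioc_of_le hab.le]
    refine MeasureTheory.IntegrableOn.of_bound (by simp)
      (aestronglyMeasurable_inner_clm hB hu.continuousOn huU hfm hg) (D' * K * C) ?_
    filter_upwards [MeasureTheory.ae_restrict_mem measurableSet_Ioc] with s hs using hD s hs
  -- the Euler-Lagrange equation in integrated form
  have hEL (e : F) : ∃ m : ℝ, ∀ᵐ s, s ∈ Ioc a b → inner ℝ (A (u s) (f s)) e =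
      m + ∫ t in a..s, 1 / 2 * inner ℝ (fderiv ℝ A (u t) e (f t)) (f t) := by
    obtain ⟨hq, C, hC⟩ := hbdd hA.continuousOn
      (MeasureTheory.stronglyMeasurable_const (b := e)) (C := ‖e‖) fun _ => le_rfl
    refine exists_ae_eq_const_add_integral hab ((hbdd (hdAe e) hfm hfK).1.const_mul _) hq hC
      fun ψ L hψ hψa hψb => ?_
    obtain ⟨g, hgm, hgK, -, hge⟩ := hψ.exists_bounded_deriv
    obtain ⟨-, -, h3⟩ := hasDerivAt_energy hU hA hsymm hab.le hu.continuousOn huU hfm hfK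
      hψ.continuousOn hgm hgK e
    have hloc : IsLocalMin (fun ε : ℝ => ∫ s in a..b, inner ℝ (A (u s + ε • ψ s • e)
        (f s + ε • g s • e)) (f s + ε • g s • e)) 0 := by
      filter_upwards [hmin e ψ L hψ hψa hψb] with ε hε
      simp only [zero_smul, add_zero]
      refine (le_of_eq ?_).trans (hε.trans (le_of_eq ?_))
      · refine intervalIntegral.integral_congr_ae ?_
        rw [hI]
        filter_upwards [hfe] with s hs hsI
        rw [hs hsI]
      · refine intervalIntegral.integral_congr_ae ?_
        rw [hI]
        filter_upwards [hfe, hge] with s hs hs' hsI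
        rw [← hs hsI, ← hs' hsI]
    have h0 := hloc.hasDerivAt_eq_zero h3
    rw [← mul_zero (1 / 2 : ℝ), ← h0, ← intervalIntegral.integral_const_mul]
    refine intervalIntegral.integral_congr_ae ?_
    rw [hI]
    filter_upwards [hge] with s hs hsI
    rw [hs hsI]
    ring
  let e := stdOrthonormalBasis ℝ F
  choose m hm using fun i => hEL (e i)
  set P : ℝ → F := fun s => ∑ i, (m i +
    ∫ t in a..s, 1 / 2 * inner ℝ (fderiv ℝ A (u t) (e i) (f t)) (f t)) • e i with hP
  set k : ℝ → F := fun s => Ring.inverse (A (u s)) (P s) with hk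
  -- Expanded in the orthonormal basis, the momentum A (u s) (f s) equals P s almost everywhere.
  -- Solving for f gives the velocity a continuous representative k.
  have hfk : ∀ᵐ s, s ∈ Ioc a b → f s = k s := by
    filter_upwards [MeasureTheory.ae_all_iff.2 hm] with s hs hsI
    have h1 : A (u s) (f s) = P s := by
      rw [← e.sum_repr' (A (u s) (f s)), hP]
      refine Finset.sum_congr rfl fun i _ => ?_
      rw [real_inner_comm, hs i hsI]
    rw [hk]
    simp only [← h1]
    rw [← mul_apply_eq_comp,
      Ring.inverse_mul_cancel _ (hunit _ (huU (Ioc_subset_Icc_self hsI)))]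
    rfl
  have hkc : ContinuousOn k (Icc a b) := by
    refine ContinuousOn.clm_apply (fun s hs => ?_) ?_
    · obtain ⟨x, hx⟩ := hunit _ (huU hs)
      have h1 : ContinuousAt Ring.inverse (A (u s)) := by
        rw [← hx]; exact NormedRing.inverse_continuousAt x
      exact h1.comp_continuousWithinAt (f := A ∘ u) ((hA.continuousOn.comp hu.continuousOn huU) s hs)
    · refine continuousOn_finsetSum _ fun i _ => ContinuousOn.smul (continuousOn_const.add ?_)
        continuousOn_const
      have := intervalIntegral.continuousOn_primitive_interval'
        ((hbdd (hdAe (e i)) hfm hfK).1.const_mul (1 / 2)) left_mem_uIcc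
      rwa [uIcc_of_le hab.le] at this
  have huk : ∀ s ∈ Icc a b, u s = u a + ∫ t in a..s, k t := by
    have hki : IntervalIntegrable k MeasureTheory.volume a b :=
      ContinuousOn.intervalIntegrable (by rwa [uIcc_of_le hab.le])
    -- Absolute continuity is what lets an almost everywhere vanishing derivative force constancy.
    -- So u is the integral of k up to a constant, hence C¹.
    have hac : AbsolutelyContinuousOnInterval (fun s => u s - ∫ t in a..s, k t) a b := by
      refine AbsolutelyContinuousOnInterval.sub
        (LipschitzOnWith.absolutelyContinuousOnInterval (K := K) (by rwa [uIcc_of_le hab.le])) ?_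
      obtain ⟨D, hD⟩ := isCompact_Icc.exists_bound_of_continuousOn hkc
      refine LipschitzOnWith.absolutelyContinuousOnInterval (K := D.toNNReal) ?_
      rw [uIcc_of_le hab.le]
      exact LipschitzOnWith.intervalIntegral_of_norm_le hab.le hki
        fun s hs => hD s (Ioc_subset_Icc_self hs)
    have hne : ∀ᵐ s : ℝ, s ≠ a := by simp [MeasureTheory.ae_iff]
    have hne' : ∀ᵐ s : ℝ, s ≠ b := by simp [MeasureTheory.ae_iff]
    obtain ⟨c, hc⟩ := hac.const_of_ae_hasDerivAt_zero (by
      filter_upwards [hfk, hfd, hne, hne'] with s h1 h2 h3 h4 hsI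
      rw [uIcc_of_le hab.le] at hsI
      have hs : s ∈ Ioo a b := ⟨lt_of_le_of_ne hsI.1 h3.symm, lt_of_le_of_ne hsI.2 h4⟩
      have h5 := (hasDerivWithinAt_integral_of_continuousOn hkc hsI).hasDerivAt
        (Icc_mem_nhds hs.1 hs.2)
      have h6 := (h2 (Ioo_subset_Ioc_self hs)).sub h5
      rwa [h1 (Ioo_subset_Ioc_self hs), sub_self] at h6)
    rw [uIcc_of_le hab.le] at hc
    intro s hs
    have h1 := hc s hs
    have h2 := hc a (left_mem_Icc.2 hab.le)
    simp only [intervalIntegral.integral_same, sub_zero] at h2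
    rw [h2, ← h1, sub_add_cancel]
  refine contDiffOn_of_euler_lagrange hU hA hunit hab (k := k) (fun s hs => ?_) huU hkc e m
    fun s hs => ?_
  · exact ((hasDerivWithinAt_integral_of_continuousOn hkc hs).const_add (u a)).congr
      (fun t ht => huk t ht) (huk s hs)
  · simp only [hk, hP]
    congr 1
    refine Finset.sum_congr rfl fun i _ => ?_
    congr 2
    refine intervalIntegral.integral_congr_ae ?_
    filter_upwards [hfk] with t ht htI
    rw [uIoc_of_le hs.1] at htI
    have := ht ⟨htI.1, htI.2.trans hs.2⟩
    simp only [hk, hP] at this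
    rw [← this]

end

/-! ### Isometrically parametrised curves in S are smooth. -/

namespace StandardStaticSpacetime

noncomputable section

variable {E : Type*} [NormedAddCommGroup E] [NormedSpace ℝ E] [FiniteDimensional ℝ E]
  {S : Type*} [TopologicalSpace S] [ChartedSpace E S] [IsManifold 𝓘(ℝ, E) ∞ S]
  (M : StandardStaticSpacetime E S)

variable {M}

lemma dist_comm (p q : S) : M.dist p q = M.dist q p := by
  let _ : RiemannianBundle (fun x : S => TangentSpace 𝓘(ℝ, E) x) :=
      ⟨M.conformalMetric.toRiemannianMetric⟩
  exact riemannianEDist_comm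

lemma inner_metricOp_le_sqrt_mul_sqrt {x₀ : S} {y : CoordSpace E} (v w : CoordSpace E) :
    inner ℝ (M.metricOp x₀ y v) w ≤
      √(inner ℝ (M.metricOp x₀ y v) v) * √(inner ℝ (M.metricOp x₀ y w) w) := by
  rw [← Real.sqrt_mul (inner_metricOp_nonneg _ _ _)]
  refine Real.le_sqrt_of_sq_le ?_
  have h := LinearMap.BilinForm.apply_sq_le_of_symm
    (LinearMap.mk₂ ℝ (fun v w => inner ℝ (M.metricOp x₀ y v) w)
      (fun _ _ _ => by simp [inner_add_left]) (fun _ _ _ => by simp [real_inner_smul_left])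
      (fun _ _ _ => by simp [inner_add_right]) (fun _ _ _ => by simp [real_inner_smul_right]))
    (fun v => inner_metricOp_nonneg x₀ y v)
    ⟨fun v w => M.inner_metricOp_symm x₀ y v w⟩ v w
  exact h

/-- Coordinate differences are locally bounded by the distance. -/
lemma eventually_sqrt_inner_metricOp_le [T3Space S] (p₀ : S) {C : ℝ} (hC : 1 < C) :
    ∀ᶠ P : S × S in 𝓝 (p₀, p₀), ∀ T : ℝ, 0 ≤ T → M.dist P.1 P.2 ≤ ENNReal.ofReal T →
      √(inner ℝ (M.metricOp p₀ (coord p₀ p₀) (coord p₀ P.2 - coord p₀ P.1))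
        (coord p₀ P.2 - coord p₀ P.1)) ≤ C * T := by
  let _ := M.toEMetricSpace
  have hy₀ := coord_mem (E := E) (mem_chart_source E p₀)
  have h1 := eventually_le_mul_of_continuousAt (continuousAt_metricOp (M := M) hy₀)
    (fun v hv => M.inner_metricOp_pos hy₀ hv) (one_lt_pow₀ hC two_ne_zero)
  have hN : {x | x ∈ (chartAt E p₀).source ∧ ∀ v,
      inner ℝ (M.metricOp p₀ (coord p₀ p₀) v) v ≤
        C ^ 2 * inner ℝ (M.metricOp p₀ (coord p₀ x) v) v} ∈ 𝓝 p₀ := by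
    have h2 : ContinuousAt (coord (E := E) p₀) p₀ := (mdifferentiableAt_coord
      (mem_chart_source E p₀)).continuousAt
    filter_upwards [(chartAt E p₀).open_source.mem_nhds (mem_chart_source E p₀),
      h2.eventually h1] with x hx hx' using ⟨hx, fun v => (hx' v).2⟩
  obtain ⟨r, hr, hball⟩ := EMetric.mem_nhds_iff.1 hN
  -- Curves of duration at most ρ / 2 that start within ρ / 4 of p₀ stay within 3ρ / 4 of it, where
  -- the form at p₀ is at most C² times the local one.
  obtain ⟨ρ, hρ0, hρ⟩ := ENNReal.lt_iff_exists_real_btwn.1 hr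
  have hρpos : 0 < ρ := by simpa using hρ.1
  have hb := Metric.eball_mem_nhds p₀ (show 0 < ENNReal.ofReal (ρ / 4) by
    rw [ENNReal.ofReal_pos]; positivity)
  rw [nhds_prod_eq]
  filter_upwards [prod_mem_prod hb hb] with ⟨p, q⟩ ⟨hp, hq⟩ T hT hpq
  simp only at hp hq hpq ⊢
  rw [Metric.mem_eball] at hp hq
  have key : ∀ T : ℝ, 0 < T → T ≤ ρ / 2 → M.dist p q < ENNReal.ofReal T →
      √(inner ℝ (M.metricOp p₀ (coord p₀ p₀) (coord p₀ q - coord p₀ p))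
        (coord p₀ q - coord p₀ p)) ≤ C * T := by
    intro T hT hTρ hlt
    obtain ⟨c, hc, hc0, hcT, hcs⟩ := exists_reach_of_dist_lt hlt
    have hcN : ∀ t ∈ Icc 0 T, c t ∈ (chartAt E p₀).source ∧ ∀ v,
        inner ℝ (M.metricOp p₀ (coord p₀ p₀) v) v ≤
          C ^ 2 * inner ℝ (M.metricOp p₀ (coord p₀ (c t)) v) v := by
      intro t ht
      refine hball (Metric.mem_eball.2 ?_)
      have h3 : edist (c t) p ≤ ENNReal.ofReal (ρ / 2) := by
        rw [edist_comm, ← hc0 0 le_rfl]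
        rcases ht.1.eq_or_lt with h0 | h0
        · rw [← h0, edist_self]; exact zero_le
        have := M.dist_le_of_speedSq_le (c := c) (τ := id) (τ' := fun _ => 1) ht.1
          (hc.contMDiffOn.of_le (by simp)) (fun s _ => hasDerivWithinAt_id _ _)
          (fun _ _ => zero_le_one) (fun s hs => by
            rw [M.speedSq_mono (subset_univ _)
              (hc.mdifferentiable (by simp) s).mdifferentiableWithinAt
              (uniqueDiffOn_Icc h0 s hs), one_pow]
            exact hcs s)
        refine this.trans (ENNReal.ofReal_le_ofReal ?_)
        simp only [id]
        linarith [ht.2]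
      calc edist (c t) p₀ ≤ edist (c t) p + edist p p₀ := edist_triangle _ _ _
        _ ≤ ENNReal.ofReal (ρ / 2) + ENNReal.ofReal (ρ / 4) := add_le_add h3 hp.le
        _ = ENNReal.ofReal (ρ / 2 + ρ / 4) := (ENNReal.ofReal_add (by linarith) (by linarith)).symm
        _ ≤ ENNReal.ofReal ρ := ENNReal.ofReal_le_ofReal (by linarith)
        _ < r := hρ.2
    set w : ℝ → CoordSpace E := fun t => coord p₀ (c t) with hw
    set v : CoordSpace E := coord p₀ q - coord p₀ p with hv
    set N := inner ℝ (M.metricOp p₀ (coord p₀ p₀) v) v with hNdef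
    have hder : ∀ t ∈ Icc 0 T, ∃ w', HasDerivAt w w' t ∧ inner ℝ (M.metricOp p₀ (coord p₀ p₀) w') w' ≤ C ^ 2 := by
      intro t ht
      have h4 : MDifferentiableAt 𝓘(ℝ, ℝ) 𝓘(ℝ, CoordSpace E) w t :=
        (mdifferentiableAt_coord (hcN t ht).1).comp t (hc.mdifferentiable (by simp) t)
      have h5 := (mdifferentiableAt_iff_differentiableAt.1 h4).hasDerivAt
      refine ⟨deriv w t, h5, ((hcN t ht).2 _).trans ?_⟩
      rw [← M.speedSq_eq_inner_metricOp (I := univ) hc.continuous.continuousWithinAt h5.hasDerivWithinAt uniqueDiffWithinAt_univ (hcN t ht).1]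
      exact mul_le_of_le_one_right (by positivity) (hcs t)
    choose! w' hw' hw'C using hder
    have hC0 : 0 < C := by linarith
    have hN0 : 0 ≤ N := inner_metricOp_nonneg _ _ _
    -- With G the form at p₀, the function ⟨G v, w t⟩ grows by N = ⟨G v, v⟩ over [0, T] and has
    -- slope at most √N C by Cauchy–Schwarz. Hence N ≤ √N C T.
    have hder' (t : ℝ) (ht : t ∈ Icc 0 T) : HasDerivAt
        (fun t => inner ℝ (M.metricOp p₀ (coord p₀ p₀) v) (w t))
        (inner ℝ (M.metricOp p₀ (coord p₀ p₀) v) (w' t)) t := by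
      simpa using (hasDerivAt_const t (M.metricOp p₀ (coord p₀ p₀) v)).inner ℝ (hw' t ht)
    have h6 := (convex_Icc 0 T).image_sub_le_mul_sub_of_deriv_le
      (f := fun t => inner ℝ (M.metricOp p₀ (coord p₀ p₀) v) (w t)) (C := √N * C)
      (fun t ht => (hder' t ht).continuousAt.continuousWithinAt)
      (fun t ht => (hder' t (interior_subset ht)).differentiableAt.differentiableWithinAt)
      (fun t ht => by
        rw [(hder' t (interior_subset ht)).deriv]
        refine (inner_metricOp_le_sqrt_mul_sqrt _ _).trans (mul_le_mul_of_nonneg_left ?_ (Real.sqrt_nonneg _))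
        exact Real.sqrt_le_iff.2 ⟨hC0.le, hw'C t (interior_subset ht)⟩)
      0 (left_mem_Icc.2 hT.le) T (right_mem_Icc.2 hT.le) hT.le
    have h7 : N ≤ √N * (C * T) := by
      have h8 : w T - w 0 = v := by simp only [hw, hv, hc0 0 le_rfl, hcT T le_rfl]
      rw [← inner_sub_right, h8, sub_zero] at h6
      linarith
    rcases (Real.sqrt_nonneg N).eq_or_lt with h0 | h0
    · rw [← h0]; positivity
    · refine le_of_mul_le_mul_left ?_ h0
      rwa [Real.mul_self_sqrt hN0]
  -- So far the inequality for the distance was strict and T short. Below ρ / 2, a time T'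
  -- decreasing to T suffices; otherwise ρ / 2 already exceeds the distance of p and q.
  rcases lt_or_ge T (ρ / 2) with hTρ | hTρ
  · have hlim : Tendsto (fun T' => C * T') (𝓝[>] T) (𝓝 (C * T)) :=
      ((continuous_const_mul C).tendsto T).mono_left nhdsWithin_le_nhds
    refine ge_of_tendsto hlim ?_
    filter_upwards [Ioo_mem_nhdsGT hTρ] with T' hT'
    refine key T' (hT.trans_lt hT'.1) hT'.2.le (hpq.trans_lt ?_)
    exact (ENNReal.ofReal_lt_ofReal_iff (hT.trans_lt hT'.1)).2 hT'.1
  · refine (key (ρ / 2) (by positivity) le_rfl ?_).trans (by gcongr)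
    calc M.dist p q ≤ edist p p₀ + edist p₀ q := edist_triangle p p₀ q
      _ < ENNReal.ofReal (ρ / 4) + ENNReal.ofReal (ρ / 4) :=
        ENNReal.add_lt_add hp (by rwa [edist_comm])
      _ = ENNReal.ofReal (ρ / 2) := by
        rw [← ENNReal.ofReal_add (by positivity) (by positivity)]; ring_nf

lemma continuousOn_of_forall_dist_le [T3Space S] {γ : ℝ → S} {I : Set ℝ}
    (h : ∀ s ∈ I, ∀ s' ∈ I, M.dist (γ s) (γ s') ≤ ENNReal.ofReal |s' - s|) :
    ContinuousOn γ I := by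
  let _ := M.toEMetricSpace
  refine LipschitzOnWith.continuousOn (K := 1) fun s hs s' hs' => ?_
  rw [ENNReal.coe_one, one_mul, edist_dist, Real.dist_eq, abs_sub_comm]
  exact h s hs s' hs'

/-- The speed of `1`-Lipschitz curves. -/
lemma speedSq_le_one_of_forall_dist_le [T3Space S] {γ : ℝ → S} {I : Set ℝ}
    (h : ∀ s ∈ I, ∀ s' ∈ I, M.dist (γ s) (γ s') ≤ ENNReal.ofReal |s' - s|) {s : ℝ} (hs : s ∈ I)
    (hI : UniqueDiffWithinAt ℝ I s) (hd : MDifferentiableWithinAt 𝓘(ℝ, ℝ) 𝓘(ℝ, E) γ I s) :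
    M.speedSq γ I s ≤ 1 := by
  set p₀ := γ s with hp₀
  set w : ℝ → CoordSpace E := fun t => coord p₀ (γ t) with hw
  have h1 : MDifferentiableWithinAt 𝓘(ℝ, ℝ) 𝓘(ℝ, CoordSpace E) w I s :=
    (mdifferentiableAt_coord (mem_chart_source E p₀)).comp_mdifferentiableWithinAt s hd
  have h2 := (mdifferentiableWithinAt_iff_differentiableWithinAt.1 h1).hasDerivWithinAt
  rw [M.speedSq_eq_inner_metricOp hd.continuousWithinAt h2 hI (mem_chart_source E p₀)]
  set v := derivWithin w I s
  have h3 := hasDerivWithinAt_iff_tendsto_slope.1 h2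
  have : (𝓝[I \ {s}] s).NeBot := by
    have := hI.accPt
    rwa [accPt_principal_iff_nhdsWithin] at this
  -- Close to s the difference quotients have squared length at most C² in the form at p₀. Their
  -- limit is the velocity, and C then tends to 1.
  have key (C : ℝ) (hC : 1 < C) :
      inner ℝ (M.metricOp p₀ (coord p₀ p₀) v) v ≤ C ^ 2 := by
    have hcont : Continuous fun v => inner ℝ (M.metricOp p₀ (coord p₀ p₀) v) v := by fun_prop
    refine le_of_tendsto ((hcont.tendsto v).comp h3) ?_
    have h4 : Tendsto (fun t => (p₀, γ t)) (𝓝[I] s) (𝓝 (p₀, p₀)) :=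
      tendsto_const_nhds.prodMk_nhds hd.continuousWithinAt
    filter_upwards [nhdsWithin_mono s sdiff_subset
      (h4.eventually (eventually_sqrt_inner_metricOp_le (M := M) p₀ hC)), self_mem_nhdsWithin]
      with t ht htI
    have h5 := ht |t - s| (abs_nonneg _) (h s hs t htI.1)
    rw [Real.sqrt_le_iff] at h5
    have hts : 0 < |t - s| := abs_pos.2 (sub_ne_zero.2 htI.2)
    simp only [Function.comp, slope_def_module, map_smul, real_inner_smul_left,
      real_inner_smul_right, hw]
    rw [← mul_assoc, ← mul_inv, inv_mul_le_iff₀ (by rw [← abs_mul_abs_self]; positivity),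
      ← abs_mul_abs_self]
    refine h5.2.trans (le_of_eq (by ring))
  have hlim : Tendsto (fun C : ℝ => C ^ 2) (𝓝[>] 1) (𝓝 1) := by
    simpa using ((continuous_pow (M := ℝ) 2).tendsto 1).mono_left nhdsWithin_le_nhds
  refine ge_of_tendsto hlim ?_
  filter_upwards [self_mem_nhdsWithin] with C hC using key C hC

/-- Isometrically parametrised curves are smooth. -/
theorem contMDiffOn_of_forall_dist_eq [T3Space S] {γ : ℝ → S} {a b : ℝ} (hab : a < b)
    (h : ∀ s ∈ Icc a b, ∀ s' ∈ Icc a b, M.dist (γ s) (γ s') = ENNReal.ofReal |s' - s|) :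
    ContMDiffOn 𝓘(ℝ, ℝ) 𝓘(ℝ, E) ∞ γ (Icc a b) := by
  intro s₀ hs₀
  have hγ := continuousOn_of_forall_dist_le fun s hs s' hs' => (h s hs s' hs').le
  set p₀ := γ s₀ with hp₀
  have hy₀ := coord_mem (E := E) (mem_chart_source E p₀)
  obtain ⟨L, U, hU, hUo, hyU, hL⟩ := exists_reachDist_param_le (M := M) hy₀
  obtain ⟨m, hm, hmv⟩ := exists_forall_mul_sq_le_of_pos (M.metricOp p₀ (coord p₀ p₀))
    fun v hv => M.inner_metricOp_pos hy₀ hv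
  have hpair := eventually_sqrt_inner_metricOp_le (M := M) p₀ one_lt_two
  rw [nhds_prod_eq] at hpair
  obtain ⟨W, hW, hWW⟩ := mem_prod_self_iff.1 hpair
  have hUW : W ∩ ((chartAt E p₀).source ∩ coord p₀ ⁻¹' U) ∈ 𝓝 p₀ :=
    inter_mem hW (((contMDiffOn_coord p₀).continuousOn.isOpen_inter_preimage
      (chartAt E p₀).open_source hUo).mem_nhds ⟨mem_chart_source E p₀, hyU⟩)
  obtain ⟨δ, hδ, hball⟩ := Metric.mem_nhdsWithin_iff.1 (hγ s₀ hs₀ hUW)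
  -- A neighbourhood of s₀ in [a, b], one-sided at the end points, whose image lies in one good
  -- chart.
  set a' := max a (s₀ - δ / 2) with ha'
  set b' := min b (s₀ + δ / 2) with hb'
  have ha'b' : a' < b' := max_lt (lt_min hab (by linarith [hs₀.1]))
    (lt_min (by linarith [hs₀.2]) (by linarith))
  have hsub : Icc a' b' ⊆ Icc a b := Icc_subset_Icc (le_max_left _ _) (min_le_left _ _)
  have hnhds : Icc a' b' ∈ 𝓝[Icc a b] s₀ := by
    rw [show Icc a' b' = Icc a b ∩ Icc (s₀ - δ / 2) (s₀ + δ / 2) from Icc_inter_Icc.symm]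
    exact inter_mem self_mem_nhdsWithin (mem_nhdsWithin_of_mem_nhds
      (Icc_mem_nhds (by linarith) (by linarith)))
  have hmem : ∀ s ∈ Icc a' b', γ s ∈ W ∩ ((chartAt E p₀).source ∩ coord p₀ ⁻¹' U) := by
    refine fun s hs => hball ⟨?_, hsub hs⟩
    rw [Metric.mem_ball, Real.dist_eq, abs_lt]
    constructor
    · linarith [(le_max_right _ _).trans hs.1]
    · linarith [hs.2.trans (min_le_right _ _)]
  set u : ℝ → CoordSpace E := fun s => coord p₀ (γ s) with hu
  have huU : MapsTo u (Icc a' b') U := fun s hs => (hmem s hs).2.2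
  have hγu : ∀ s ∈ Icc a' b', γ s = param p₀ (u s) := fun s hs =>
    (param_coord (hmem s hs).2.1).symm
  have hulip : LipschitzOnWith (2 / √m).toNNReal u (Icc a' b') := by
    refine LipschitzOnWith.of_dist_le_mul fun s hs s' hs' => ?_
    have h1 := hWW (mk_mem_prod (hmem s' hs').1 (hmem s hs).1) |s - s'| (abs_nonneg _)
      (h s' (hsub hs') s (hsub hs)).le
    have h2 := (Real.sqrt_le_sqrt (hmv (u s - u s'))).trans h1
    rw [Real.sqrt_mul hm.le, Real.sqrt_sq (norm_nonneg _)] at h2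
    rw [dist_eq_norm, Real.coe_toNNReal _ (by positivity), Real.dist_eq, div_mul_eq_mul_div,
      le_div_iff₀ (Real.sqrt_pos.2 hm), mul_comm]
    exact h2
  have hsmooth : ContDiffOn ℝ ∞ u (Icc a' b') := by
    refine contDiffOn_of_forall_energy_le (A := M.metricOp p₀) (U := U) hUo
      ((M.contDiffOn_metricOp p₀).mono hU) (fun y _ v w => M.inner_metricOp_symm p₀ y v w)
      (fun y hy v hv => M.inner_metricOp_pos (hU hy) hv) ha'b' hulip huU
      fun e ψ K hψ hψa hψb => ?_
    obtain ⟨f, hfm, hfK, hfd, hfe⟩ := hulip.exists_bounded_deriv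
    obtain ⟨g, hgm, hgK, hgd, hge⟩ := hψ.exists_bounded_deriv
    have hA := (M.contDiffOn_metricOp p₀).mono hU
    have hE := fun (y : CoordSpace E) (_ : y ∈ U) v w => M.inner_metricOp_symm p₀ y v w
    obtain ⟨h1, h2, -⟩ := hasDerivAt_energy hUo hA hE ha'b'.le hulip.continuousOn huU
      hfm hfK hψ.continuousOn hgm hgK e
    -- The speed is at most 1 almost everywhere, so the energy of u is at most b' − a'.
    have hupper : ∫ s in a'..b', inner ℝ (M.metricOp p₀ (u s) (deriv u s)) (deriv u s) ≤
        b' - a' := by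
      rw [intervalIntegral.integral_congr_ae (g := fun s => inner ℝ (M.metricOp p₀ (u s) (f s)) (f s))]
      · rw [← mul_one (b' - a'), ← smul_eq_mul, ← intervalIntegral.integral_const]
        refine intervalIntegral.integral_mono_ae_restrict ha'b'.le h2 intervalIntegrable_const ?_
        rw [MeasureTheory.Measure.restrict_congr_set MeasureTheory.Ioc_ae_eq_Icc.symm,
          EventuallyLE, MeasureTheory.ae_restrict_iff' measurableSet_Ioc]
        have hne : ∀ᵐ s : ℝ, s ≠ b' := by simp [MeasureTheory.ae_iff]
        filter_upwards [hfd, hne] with s hs hsb hsI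
        have hs' := Ioc_subset_Icc_self hsI
        have hI : Icc a' b' ∈ 𝓝 s := Icc_mem_nhds hsI.1 (lt_of_le_of_ne hsI.2 hsb)
        have h3 : MDifferentiableAt 𝓘(ℝ, ℝ) 𝓘(ℝ, E) (fun s => param p₀ (u s)) s :=
          (mdifferentiableAt_param (hU (huU hs'))).comp s
            (hs hsI).differentiableAt.mdifferentiableAt
        have h4 : γ =ᶠ[𝓝 s] fun s => param p₀ (u s) := by filter_upwards [hI] using hγu
        have h5 := speedSq_le_one_of_forall_dist_le (M := M) (γ := γ) (I := Icc a' b')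
          (fun s hs s' hs' => (h s (hsub hs) s' (hsub hs')).le) hs'
          (uniqueDiffWithinAt_of_mem_nhds hI)
          (h4.mdifferentiableAt_iff.2 h3).mdifferentiableWithinAt
        rwa [M.speedSq_eq_inner_metricOp (hγ.mono hsub s hs') (hs hsI).hasDerivWithinAt
          (uniqueDiffWithinAt_of_mem_nhds hI) (hmem s hs').2.1] at h5
      · rw [uIoc_of_le ha'b'.le]
        filter_upwards [hfe] with s hs hsI
        rw [hs hsI]
    filter_upwards [h1] with ε hε
    refine hupper.trans ?_
    have hwlip : LipschitzOnWith ((2 / √m).toNNReal + ‖ε‖₊ * (K * ‖e‖₊))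
        (fun s => u s + ε • ψ s • e) (Icc a' b') := by
      have h3 : LipschitzOnWith (K * ‖e‖₊) (fun s => ψ s • e) (Icc a' b') := by
        refine LipschitzOnWith.of_dist_le_mul fun s hs s' hs' => ?_
        rw [dist_eq_norm, ← sub_smul, norm_smul, ← dist_eq_norm]
        push_cast
        have := hψ.dist_le_mul s hs s' hs'
        calc Dist.dist (ψ s) (ψ s') * ‖e‖ ≤ (K * Dist.dist s s') * ‖e‖ := by gcongr
          _ = _ := by ring
      have h4 : LipschitzOnWith (‖ε‖₊ * (K * ‖e‖₊)) (fun s => ε • ψ s • e) (Icc a' b') := by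
        refine LipschitzOnWith.of_dist_le_mul fun s hs s' hs' => ?_
        rw [dist_eq_norm, ← smul_sub, norm_smul, ← dist_eq_norm]
        push_cast
        have := h3.dist_le_mul s hs s' hs'
        push_cast at this
        rw [mul_assoc]
        gcongr
      exact hulip.add h4
    have hwd : ∀ᵐ s, s ∈ Ioc a' b' →
        HasDerivAt (fun s => u s + ε • ψ s • e) (f s + ε • g s • e) s := by
      filter_upwards [hfd, hgd] with s hs hs' hsI
      exact (hs hsI).add (((hs' hsI).smul_const e).const_smul ε)
    -- The varied curve has the same end points, at distance b' − a', so its length is at least b' −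
    -- a'. By √X ≤ (X + 1) / 2 its energy is at least b' − a' too, which makes u a minimiser.
    have hlen := reachDist_param_le_lintegral hU hL ha'b'.le hwlip hε hwd
    have hXi := (hasDerivAt_energy hUo hA hE ha'b'.le hwlip.continuousOn hε
      (hfm.add ((hgm.smul_const e).const_smul ε))
      (K := (2 / √m).toNNReal + ‖ε‖ * (K * ‖e‖)) (fun s => (norm_add_le _ _).trans
        (add_le_add (hfK s) (by simp only [Pi.smul_apply]; rw [norm_smul, norm_smul]; gcongr; exact hgK s)))
      hψ.continuousOn hgm hgK e).2.1
    set X : ℝ → ℝ := fun s => inner ℝ (M.metricOp p₀ (u s + ε • ψ s • e) (f s + ε • g s • e))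
      (f s + ε • g s • e) with hX
    replace hXi : IntervalIntegrable X MeasureTheory.volume a' b' := hXi
    have hX0 (s) : 0 ≤ X s := inner_metricOp_nonneg _ _ _
    rw [intervalIntegral.integral_congr_ae (g := X)]
    · have hYi : IntervalIntegrable (fun s => (X s + 1) / 2) MeasureTheory.volume a' b' :=
        (hXi.add intervalIntegrable_const).div_const 2
      simp only [hψa, hψb, zero_smul, smul_zero, add_zero] at hlen
      rw [← hγu _ (left_mem_Icc.2 ha'b'.le), ← hγu _ (right_mem_Icc.2 ha'b'.le),
        reachDist_eq_dist, h _ (hsub (left_mem_Icc.2 ha'b'.le)) _ (hsub (right_mem_Icc.2 ha'b'.le)),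
        abs_of_pos (sub_pos.2 ha'b')] at hlen
      have h5 : ENNReal.ofReal (b' - a') ≤ ENNReal.ofReal (∫ s in a'..b', (X s + 1) / 2) := by
        rw [intervalIntegral.integral_of_le ha'b'.le, MeasureTheory.ofReal_integral_eq_lintegral_ofReal
          ((intervalIntegrable_iff_integrableOn_Ioc_of_le ha'b'.le).1 hYi)
          (Eventually.of_forall fun s => div_nonneg (add_nonneg (hX0 s) zero_le_one) zero_le_two)]
        refine hlen.trans (MeasureTheory.lintegral_mono fun s => ENNReal.ofReal_le_ofReal ?_)
        change √(X s) ≤ _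
        nlinarith [Real.sq_sqrt (hX0 s), sq_nonneg (√(X s) - 1)]
      rw [ENNReal.ofReal_le_ofReal_iff (intervalIntegral.integral_nonneg ha'b'.le fun s _ =>
          div_nonneg (add_nonneg (hX0 s) zero_le_one) zero_le_two), intervalIntegral.integral_div,
        intervalIntegral.integral_add hXi intervalIntegrable_const,
        intervalIntegral.integral_const, smul_eq_mul] at h5
      linarith
    · rw [uIoc_of_le ha'b'.le]
      filter_upwards [hfe, hge] with s hs hs' hsI
      simp only [hX, hs hsI, hs' hsI]
  have hmd : ContMDiffOn 𝓘(ℝ, ℝ) 𝓘(ℝ, E) ∞ γ (Icc a' b') :=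
    ((contMDiffOn_param p₀).comp hsmooth.contMDiffOn fun s hs => hU (huU hs)).congr hγu
  have hs₀' : s₀ ∈ Icc a' b' := mem_of_mem_nhdsWithin hs₀ hnhds
  exact (hmd s₀ hs₀').mono_of_mem_nhdsWithin hnhds

end
end StandardStaticSpacetime

/-! ### Compact balls in length spaces: minimising curves, minimising rays, Hopf–Rinow. -/

/-- Points at distance less than `T` are joined by a `1`-Lipschitz curve defined on `[0, T]`. -/
def HasShortCurves (X : Type*) [PseudoEMetricSpace X] : Prop :=
  ∀ (p q : X) (T : ℝ), edist p q < ENNReal.ofReal T →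
    ∃ x : ℝ → X, LipschitzWith 1 x ∧ x 0 = p ∧ x T = q

section

open Metric

variable {X : Type*} [EMetricSpace X]

lemma LipschitzWith.edist_le_ofReal {x : ℝ → X} (hx : LipschitzWith 1 x) (s s' : ℝ) :
    edist (x s) (x s') ≤ ENNReal.ofReal |s' - s| := by
  have := hx s s'
  rwa [ENNReal.coe_one, one_mul, edist_dist, Real.dist_eq, abs_sub_comm] at this

lemma LipschitzWith.mem_cthickening {x : ℝ → X} (hx : LipschitzWith 1 x) {K : Set X}
    (h0 : x 0 ∈ K) {s : ℝ} (hs : 0 ≤ s) : x s ∈ cthickening s K := by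
  rw [mem_cthickening_iff]
  refine (infEDist_le_edist_of_mem h0).trans ((hx.edist_le_ofReal _ _).trans_eq ?_)
  rw [zero_sub, abs_neg, abs_of_nonneg hs]

/-- Distances along a `1`-Lipschitz curve which minimises the distance of its end points. -/
lemma edist_eq_of_forall_edist_le {γ : ℝ → X} {r : ℝ}
    (h : ∀ s ∈ Icc 0 r, ∀ s' ∈ Icc 0 r, edist (γ s) (γ s') ≤ ENNReal.ofReal |s' - s|)
    (hr : ENNReal.ofReal r ≤ edist (γ 0) (γ r)) :
    ∀ s ∈ Icc 0 r, ∀ s' ∈ Icc 0 r, edist (γ s) (γ s') = ENNReal.ofReal |s' - s| := by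
  have key : ∀ s ∈ Icc 0 r, ∀ s' ∈ Icc 0 r, s ≤ s' →
      ENNReal.ofReal (s' - s) ≤ edist (γ s) (γ s') := by
    intro s hs s' hs' hss
    have h0 : (0 : ℝ) ∈ Icc 0 r := left_mem_Icc.2 (hs.1.trans hs.2)
    have h1 : r ∈ Icc 0 r := right_mem_Icc.2 (hs.1.trans hs.2)
    have h2 := h 0 h0 s hs
    have h3 := h s' hs' r h1
    rw [sub_zero, abs_of_nonneg hs.1] at h2
    rw [abs_of_nonneg (sub_nonneg.2 hs'.2)] at h3
    have h4 : ENNReal.ofReal r ≤ (ENNReal.ofReal s + ENNReal.ofReal (r - s')) + edist (γ s) (γ s') := by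
      calc ENNReal.ofReal r ≤ edist (γ 0) (γ s) + edist (γ s) (γ s') + edist (γ s') (γ r) :=
            hr.trans (edist_triangle4 _ _ _ _)
        _ ≤ ENNReal.ofReal s + edist (γ s) (γ s') + ENNReal.ofReal (r - s') := by gcongr
        _ = _ := by ring
    rw [← ENNReal.ofReal_add hs.1 (sub_nonneg.2 hs'.2)] at h4
    rw [show s' - s = r - (s + (r - s')) by ring, ENNReal.ofReal_sub _ (by linarith [hs.1, hs'.2])]
    exact tsub_le_iff_left.2 h4
  intro s hs s' hs'
  refine le_antisymm (h s hs s' hs') ?_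
  rcases le_total s s' with hss | hss
  · rw [abs_of_nonneg (sub_nonneg.2 hss)]
    exact key s hs s' hs' hss
  · rw [abs_of_nonpos (sub_nonpos.2 hss), neg_sub, edist_comm]
    exact key s' hs' s hs hss

/-- Replaces the Arzelà–Ascoli theorem: along an ultrafilter the values converge at all parameters
at once, without a diagonal sequence. The compact set may depend on the parameter, as is needed for
rays that approach a non-compact radius. -/
lemma Ultrafilter.exists_tendsto_of_lipschitz (F : Ultrafilter ℕ) {c : ℕ → ℝ → X}
    (hc : ∀ n, LipschitzWith 1 (c n)) {I : Set ℝ} {C : ℝ → Set X}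
    (hC : ∀ s ∈ I, IsCompact (C s)) (hmem : ∀ s ∈ I, ∀ᶠ n in (F : Filter ℕ), c n s ∈ C s) :
    ∃ γ : ℝ → X, (∀ s ∈ I, γ s ∈ C s ∧ Tendsto (fun n => c n s) F (𝓝 (γ s))) ∧
      ∀ s ∈ I, ∀ s' ∈ I, edist (γ s) (γ s') ≤ ENNReal.ofReal |s' - s| := by
  have : Nonempty X := ⟨c 0 0⟩
  have h1 : ∀ s ∈ I, ∃ x, x ∈ C s ∧ Tendsto (fun n => c n s) F (𝓝 x) := fun s hs => by
    obtain ⟨x, hx, hx'⟩ := (hC s hs).ultrafilter_le_nhds (F.map fun n => c n s)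
      (le_principal_iff.2 (hmem s hs))
    exact ⟨x, hx, hx'⟩
  choose! γ hγ using h1
  exact ⟨γ, hγ, fun s hs s' hs' => le_of_tendsto ((hγ s hs).2.edist (hγ s' hs').2)
    (Eventually.of_forall fun n => (hc n).edist_le_ofReal s s')⟩

lemma tendsto_one_div_add_one_hyperfilter :
    Tendsto (fun n : ℕ => 1 / ((n : ℝ) + 1)) (hyperfilter ℕ) (𝓝 0) :=
  tendsto_one_div_add_atTop_nhds_zero_nat.mono_left
    (hyperfilter_le_cofinite.trans Nat.cofinite_eq_atTop.le)

/-- In a compact ball there are minimising curves to the centre. -/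
lemma exists_minimizing_curve (hX : HasShortCurves X) {K : Set X} (hK : IsCompact K) {r : ℝ}
    (hr : 0 ≤ r) (hB : IsCompact (cthickening r K)) {x : X} (hx : infEDist x K = ENNReal.ofReal r) :
    ∃ γ : ℝ → X, γ 0 ∈ K ∧ γ r = x ∧
      ∀ s ∈ Icc 0 r, ∀ s' ∈ Icc 0 r, edist (γ s) (γ s') = ENNReal.ofReal |s' - s| := by
  -- `HasShortCurves` serves only times strictly beyond the distance. The excess 1 / (n + 1)
  -- disappears in the limit.
  have h1 (n : ℕ) : ∃ q ∈ K, edist x q < ENNReal.ofReal (r + 1 / (n + 1)) := by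
    rw [← infEDist_lt_iff, hx]
    exact (ENNReal.ofReal_lt_ofReal_iff (by positivity)).2 (lt_add_of_pos_right _ (by positivity))
  choose q hqK hq using h1
  have h2 (n : ℕ) := hX (q n) x _ (by rw [edist_comm]; exact hq n)
  choose c hc hc0 hcT using h2
  obtain ⟨γ, hγ, hlip⟩ := (hyperfilter ℕ).exists_tendsto_of_lipschitz hc (I := Icc 0 r)
    (C := fun _ => cthickening r K) (fun _ _ => hB) (fun s hs => Eventually.of_forall fun n =>
      cthickening_mono hs.2 _ ((hc n).mem_cthickening (by rw [hc0]; exact hqK n) hs.1))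
  have h0 : γ 0 ∈ K := hK.isClosed.mem_of_tendsto (hγ 0 (left_mem_Icc.2 hr)).2
    (Eventually.of_forall fun n => by rw [hc0]; exact hqK n)
  have hr' : γ r = x := by
    rw [← edist_le_zero]
    have h3 := (hγ r (right_mem_Icc.2 hr)).2.edist (tendsto_const_nhds (x := x))
    have h4 : Tendsto (fun n : ℕ => ENNReal.ofReal (1 / ((n : ℝ) + 1))) (hyperfilter ℕ) (𝓝 0) := by
      have := ENNReal.tendsto_ofReal tendsto_one_div_add_one_hyperfilter
      rwa [ENNReal.ofReal_zero] at this
    refine le_of_tendsto_of_tendsto h3 h4 (Eventually.of_forall fun n => ?_)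
    have := (hc n).edist_le_ofReal r (r + 1 / (n + 1))
    rw [hcT, add_sub_cancel_left, abs_of_nonneg (by positivity)] at this
    exact this
  refine ⟨γ, h0, hr', edist_eq_of_forall_edist_le hlip ?_⟩
  rw [← hx, hr', edist_comm]
  exact infEDist_le_edist_of_mem h0

lemma exists_curve_of_infEDist_lt (hX : HasShortCurves X) {K : Set X} {x : X} {T : ℝ}
    (hx : infEDist x K < ENNReal.ofReal T) :
    ∃ c : ℝ → X, LipschitzWith 1 c ∧ c 0 ∈ K ∧ c T = x := by
  obtain ⟨q, hq, hlt⟩ := infEDist_lt_iff.1 hx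
  obtain ⟨c, hc, hc0, hcT⟩ := hX q x T (by rwa [edist_comm])
  exact ⟨c, hc, by rwa [hc0], hcT⟩

/-- A curve of duration t + δ from `K` to the given point is, at time t, in the t-thickening and
within δ of its end. The strict inequality `hεδ` is needed because the distance to `K` may not be
realised by a curve. -/
lemma cthickening_subset_cthickening_cthickening (hX : HasShortCurves X) {K : Set X} {t ε δ : ℝ}
    (ht : 0 ≤ t) (hε : 0 ≤ ε) (hεδ : ε < δ) :
    cthickening (t + ε) K ⊆ cthickening δ (cthickening t K) := by
  intro x hx
  obtain ⟨c, hc, hc0, hcT⟩ := exists_curve_of_infEDist_lt hX (T := t + δ)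
    ((mem_cthickening_iff.1 hx).trans_lt
      ((ENNReal.ofReal_lt_ofReal_iff (by linarith)).2 (by linarith)))
  rw [mem_cthickening_iff]
  refine (infEDist_le_edist_of_mem (hc.mem_cthickening hc0 ht)).trans ?_
  have := hc.edist_le_ofReal (t + δ) t
  rwa [hcT, sub_add_cancel_left, abs_neg, abs_of_nonneg (by linarith)] at this

/-- Local compactness gives the ball a compact thickening, which contains a larger ball about `K`
since curves are short. -/
lemma exists_isCompact_cthickening_add (hX : HasShortCurves X) [LocallyCompactSpace X] {K : Set X}
    {t : ℝ} (ht : 0 ≤ t) (hB : IsCompact (cthickening t K)) :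
    ∃ ε > 0, IsCompact (cthickening (t + ε) K) := by
  obtain ⟨δ, hδ, h⟩ := hB.exists_isCompact_cthickening
  exact ⟨δ / 2, by positivity, h.of_isClosed_subset isClosed_cthickening
    (cthickening_subset_cthickening_cthickening hX ht (by positivity) (by linarith))⟩

/-- Stopping early on an almost minimal curve yields points of the open ball close to a given point
of the closed one. -/
lemma cthickening_subset_of_forall_infEDist_lt (hX : HasShortCurves X) {K C : Set X} {t : ℝ}
    (ht : 0 < t) (hC : IsClosed C) (h : ∀ x, infEDist x K < ENNReal.ofReal t → x ∈ C) :
    cthickening t K ⊆ C := by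
  intro x hx
  rw [← hC.closure_eq, EMetric.mem_closure_iff]
  intro ε hε
  obtain ⟨ρ, hρ0, hρ⟩ := ENNReal.lt_iff_exists_real_btwn.1 hε
  have hρpos : 0 < ρ := by simpa using hρ.1
  set δ := min (ρ / 2) t with hδ
  have hδ0 : 0 < δ := lt_min (by positivity) ht
  obtain ⟨c, hc, hc0, hcT⟩ := exists_curve_of_infEDist_lt hX (T := t + ρ / 4)
    ((mem_cthickening_iff.1 hx).trans_lt
      ((ENNReal.ofReal_lt_ofReal_iff (by linarith)).2 (by linarith)))
  refine ⟨c (t - δ), h _ ((mem_cthickening_iff.1 (hc.mem_cthickening hc0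
    (sub_nonneg.2 (min_le_right _ _)))).trans_lt ((ENNReal.ofReal_lt_ofReal_iff ht).2
      (by linarith))), ?_⟩
  have h1 := hc.edist_le_ofReal (t + ρ / 4) (t - δ)
  rw [hcT] at h1
  refine h1.trans_lt (lt_of_le_of_lt (ENNReal.ofReal_le_ofReal ?_) hρ.2)
  rw [abs_le]
  constructor <;> linarith [min_le_left (ρ / 2) t]

lemma isCompact_cthickening_mono {K : Set X} {s t : ℝ} (hst : s ≤ t)
    (h : IsCompact (cthickening t K)) : IsCompact (cthickening s K) :=
  h.of_isClosed_subset isClosed_cthickening (cthickening_mono hst K)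

/-- The radii with compact balls form an initial segment, open by
`exists_isCompact_cthickening_add`. So the infimum of the other radii is one of them, and it is
positive because `K` is compact. -/
lemma exists_minimal_not_isCompact (hX : HasShortCurves X) [LocallyCompactSpace X] {K : Set X}
    (hK : IsCompact K) {t : ℝ} (ht : ¬ IsCompact (cthickening t K)) :
    ∃ R, 0 < R ∧ R ≤ t ∧ ¬ IsCompact (cthickening R K) ∧ ∀ s < R, IsCompact (cthickening s K) := by
  have h0 : IsCompact (cthickening 0 K) := by rwa [cthickening_zero, hK.isClosed.closure_eq]
  set B := {s : ℝ | ¬ IsCompact (cthickening s K)} with hB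
  have hlb : ∀ s ∈ B, 0 ≤ s := fun s hs => by
    by_contra hneg
    exact hs (isCompact_cthickening_mono (not_le.1 hneg).le h0)
  have hbdd : BddBelow B := ⟨0, hlb⟩
  have hne : B.Nonempty := ⟨t, ht⟩
  have hlt : ∀ s < sInf B, IsCompact (cthickening s K) := fun s hs => by
    by_contra hneg
    exact (csInf_le hbdd hneg).not_gt hs
  have hR : ¬ IsCompact (cthickening (sInf B) K) := by
    intro hcpt
    obtain ⟨ε, hε, h⟩ := exists_isCompact_cthickening_add hX (le_csInf hne hlb) hcpt
    obtain ⟨s, hs, hslt⟩ := exists_lt_of_csInf_lt hne (lt_add_of_pos_right (sInf B) hε)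
    exact hs (isCompact_cthickening_mono hslt.le h)
  refine ⟨sInf B, lt_of_le_of_ne (le_csInf hne hlb) fun h => hR (h ▸ h0), csInf_le hbdd ht, hR, hlt⟩

/-- Every point of the ball is close to a slightly smaller ball, which is compact; a finite net of
the latter also serves the former. Thus the ball is totally bounded. -/
lemma isCompact_cthickening_of_isComplete (hX : HasShortCurves X) {K : Set X} {R : ℝ} (hR : 0 < R)
    (h : ∀ s < R, IsCompact (cthickening s K)) (hc : IsComplete (cthickening R K)) :
    IsCompact (cthickening R K) := by
  refine isCompact_iff_totallyBounded_isComplete.2 ⟨EMetric.totallyBounded_iff.2 fun ε hε => ?_, hc⟩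
  obtain ⟨ρ, hρ0, hρ⟩ := ENNReal.lt_iff_exists_real_btwn.1 hε
  have hρpos : 0 < ρ := by simpa using hρ.1
  set δ := min (ρ / 4) R with hδ
  have hδ0 : 0 < δ := lt_min (by positivity) hR
  obtain ⟨t, ht, hcov⟩ := EMetric.totallyBounded_iff.1 (h (R - δ) (by linarith)).totallyBounded
    (ENNReal.ofReal (ρ / 2)) (by rw [gt_iff_lt, ENNReal.ofReal_pos]; positivity)
  refine ⟨t, ht, fun x hx => ?_⟩
  have h1 := cthickening_subset_cthickening_cthickening hX (K := K) (t := R - δ) (ε := δ)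
    (δ := ρ / 3) (sub_nonneg.2 (min_le_right _ _)) hδ0.le
    ((min_le_left _ _).trans_lt (by linarith)) (by rwa [sub_add_cancel])
  obtain ⟨y, hy, hxy⟩ := infEDist_lt_iff.1 ((mem_cthickening_iff.1 h1).trans_lt
    ((ENNReal.ofReal_lt_ofReal_iff (q := ρ / 2) (by linarith)).2 (by linarith)))
  obtain ⟨z, hz, hyz⟩ := mem_iUnion₂.1 (hcov hy)
  refine mem_iUnion₂.2 ⟨z, hz, ?_⟩
  rw [mem_eball] at hyz ⊢
  calc edist x z ≤ edist x y + edist y z := edist_triangle _ _ _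
    _ < ENNReal.ofReal (ρ / 2) + ENNReal.ofReal (ρ / 2) := ENNReal.add_lt_add hxy hyz
    _ = ENNReal.ofReal ρ := by rw [← ENNReal.ofReal_add (by positivity) (by positivity), add_halves]
    _ < ε := hρ.2

lemma isCompact_cthickening_of_completeSpace (hX : HasShortCurves X) [LocallyCompactSpace X]
    [CompleteSpace X] {K : Set X} (hK : IsCompact K) (t : ℝ) : IsCompact (cthickening t K) := by
  by_contra ht
  obtain ⟨R, hR, -, hnc, hlt⟩ := exists_minimal_not_isCompact hX hK ht
  exact hnc (isCompact_cthickening_of_isComplete hX hR hlt isClosed_cthickening.isComplete)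

/-- At the first radius for which a ball is not compact, there is a minimising ray without
end point. -/
lemma exists_minimizing_ray (hX : HasShortCurves X) {K : Set X}
    (hK : IsCompact K) {R : ℝ} (hR : 0 < R) (hnc : ¬ IsCompact (cthickening R K))
    (hlt : ∀ s < R, IsCompact (cthickening s K)) :
    ∃ γ : ℝ → X, γ 0 ∈ K ∧ (∀ s ∈ Ico 0 R, γ s ∈ cthickening s K) ∧
      (∀ s ∈ Ico 0 R, ∀ s' ∈ Ico 0 R, edist (γ s) (γ s') = ENNReal.ofReal |s' - s|) ∧
      ¬ ∃ q, Tendsto γ (𝓝[<] R) (𝓝 q) := by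
  -- a Cauchy sequence without limit
  obtain ⟨y, hyR, hyC, hyn⟩ : ∃ y : ℕ → X, (∀ n, y n ∈ cthickening R K) ∧ CauchySeq y ∧
      ¬ ∃ q, Tendsto y atTop (𝓝 q) := by
    by_contra hcon
    refine hnc (isCompact_cthickening_of_isComplete hX hR hlt
      (completeSpace_coe_iff_isComplete.1 ?_))
    refine EMetric.complete_of_cauchySeq_tendsto fun u hu => ?_
    by_contra hn
    refine hcon ⟨fun n => u n, fun n => (u n).2,
      hu.map uniformContinuous_subtype_val, fun ⟨q, hq⟩ => hn ?_⟩
    have hqm : q ∈ cthickening R K :=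
      isClosed_cthickening.mem_of_tendsto hq (Eventually.of_forall fun n => (u n).2)
    exact ⟨⟨q, hqm⟩, tendsto_subtype_rng.2 hq⟩
  set F := hyperfilter ℕ with hF
  have hFtop : (F : Filter ℕ) ≤ atTop := hyperfilter_le_cofinite.trans Nat.cofinite_eq_atTop.le
  -- no subsequence converges
  have hycl : ∀ q, ¬ Tendsto y F (𝓝 q) := fun q hq =>
    hyn ⟨q, le_nhds_of_cauchy_adhp hyC (ClusterPt.mono (ClusterPt.of_le_nhds hq) (map_mono hFtop))⟩
  -- If y stayed in a smaller, compact ball along F, it would converge along F.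
  have hyK : ∀ s < R, ∀ᶠ n in (F : Filter ℕ), y n ∉ cthickening s K := by
    intro s hs
    by_contra hneg
    have h1 : ∀ᶠ n in (F : Filter ℕ), y n ∈ cthickening s K := by
      have := Ultrafilter.frequently_iff_eventually.1 (not_eventually.1 hneg)
      simpa using this
    obtain ⟨q, -, hq⟩ := (hlt s hs).ultrafilter_le_nhds (F.map y) (le_principal_iff.2 h1)
    exact hycl q hq
  -- curves to the points of the sequence
  have hyT : ∀ n : ℕ, infEDist (y n) K < ENNReal.ofReal (R + 1 / (n + 1)) := fun n =>
    (mem_cthickening_iff.1 (hyR n)).trans_lt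
      ((ENNReal.ofReal_lt_ofReal_iff (by positivity)).2 (lt_add_of_pos_right _ (by positivity)))
  choose c hc hc0 hcT using fun n => exists_curve_of_infEDist_lt hX (hyT n)
  obtain ⟨γ, hγ, hlip⟩ := F.exists_tendsto_of_lipschitz hc (I := Ico 0 R)
    (C := fun s => cthickening s K) (fun s hs => hlt s hs.2) (fun s hs => Eventually.of_forall
      fun n => (hc n).mem_cthickening (hc0 n) hs.1)
  have h0I : (0 : ℝ) ∈ Ico 0 R := ⟨le_rfl, hR⟩
  have hγ0 : γ 0 ∈ K := hK.isClosed.mem_of_tendsto (hγ 0 h0I).2 (Eventually.of_forall hc0)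
  have hinf : ∀ s ∈ Ico 0 R, ENNReal.ofReal s ≤ edist (γ 0) (γ s) := by
    intro s hs
    -- The end point y n is at least R − δ / 2 from K, and the curve needs only R + 1 / (n + 1) − s
    -- to get there from c n s. The difference exceeds s − δ once 1 / (n + 1) < δ / 2.
    have h1 : ∀ δ ∈ Ioo 0 s, ENNReal.ofReal (s - δ) ≤ edist (γ 0) (γ s) := by
      intro δ hδ
      refine ge_of_tendsto ((hγ 0 h0I).2.edist (hγ s hs).2) ?_
      filter_upwards [hyK (R - δ / 2) (by linarith [hδ.1]),
        tendsto_one_div_add_one_hyperfilter.eventually_lt_const (half_pos hδ.1)] with n h2 h3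
      rw [mem_cthickening_iff, not_le] at h2
      have h4 := (hc n).edist_le_ofReal s (R + 1 / (n + 1))
      have h6 : (0 : ℝ) ≤ 1 / (n + 1) := by positivity
      rw [hcT, abs_of_nonneg (by linarith [hs.2])] at h4
      have h5 : ENNReal.ofReal (R - δ / 2) ≤
          edist (c n 0) (c n s) + ENNReal.ofReal (R + 1 / (n + 1) - s) :=
        h2.le.trans ((infEDist_le_edist_of_mem (hc0 n)).trans (by
          rw [edist_comm]
          exact (edist_triangle _ _ _).trans (add_le_add le_rfl h4)))
      rw [add_comm] at h5
      refine le_trans ?_ (tsub_le_iff_left.2 h5)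
      rw [← ENNReal.ofReal_sub _ (by linarith [hs.2])]
      exact ENNReal.ofReal_le_ofReal (by linarith)
    rcases hs.1.eq_or_lt with h | h
    · rw [← h, ENNReal.ofReal_zero]; exact zero_le
    · have hlim : Tendsto (fun δ => ENNReal.ofReal (s - δ)) (𝓝[>] 0) (𝓝 (ENNReal.ofReal (s - 0))) :=
        (ENNReal.tendsto_ofReal (tendsto_const_nhds.sub tendsto_id)).mono_left nhdsWithin_le_nhds
      rw [sub_zero] at hlim
      refine le_of_tendsto hlim ?_
      filter_upwards [Ioo_mem_nhdsGT h] with δ hδ using h1 δ hδ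
  refine ⟨γ, hγ0, fun s hs => (hγ s hs).1, fun s hs s' hs' => ?_, fun ⟨q, hq⟩ => hycl q ?_⟩
  · have hm : max s s' ∈ Ico 0 R := ⟨hs.1.trans (le_max_left _ _), max_lt hs.2 hs'.2⟩
    refine edist_eq_of_forall_edist_le (r := max s s') (fun t ht t' ht' => hlip t
      ⟨ht.1, ht.2.trans_lt hm.2⟩ t' ⟨ht'.1, ht'.2.trans_lt hm.2⟩) (hinf _ hm)
      s ⟨hs.1, le_max_left _ _⟩ s' ⟨hs'.1, le_max_right _ _⟩
  -- An end point q of γ would be a limit of y along F: for s near R, the point y n is close to c n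
  -- s, that to γ s, and that to q.
  · rw [EMetric.tendsto_nhds]
    intro ε hε
    obtain ⟨ρ, hρ0, hρ⟩ := ENNReal.lt_iff_exists_real_btwn.1 hε
    have hρpos : 0 < ρ := by simpa using hρ.1
    have hρ4 : 0 < ENNReal.ofReal (ρ / 4) := by rw [ENNReal.ofReal_pos]; positivity
    obtain ⟨s, hs1, hs2⟩ := ((EMetric.tendsto_nhds.1 hq _ hρ4).and
      (Ioo_mem_nhdsLT (show max 0 (R - ρ / 8) < R from max_lt hR (by linarith)))).exists
    have hsI : s ∈ Ico 0 R := ⟨(le_max_left _ _).trans hs2.1.le, hs2.2⟩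
    have hs3 : R - ρ / 8 < s := (le_max_right _ _).trans_lt hs2.1
    filter_upwards [EMetric.tendsto_nhds.1 (hγ s hsI).2 _ hρ4,
      tendsto_one_div_add_one_hyperfilter.eventually_lt_const (show 0 < ρ / 8 by positivity)]
      with n h1 h2
    have h3 := (hc n).edist_le_ofReal (R + 1 / (n + 1)) s
    have h6 : (0 : ℝ) ≤ 1 / (n + 1) := by positivity
    rw [hcT, abs_of_nonpos (by linarith)] at h3
    calc edist (y n) q ≤ edist (y n) (c n s) + edist (c n s) (γ s) + edist (γ s) q :=
          edist_triangle4 _ _ _ _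
      _ ≤ ENNReal.ofReal (ρ / 4) + ENNReal.ofReal (ρ / 4) + ENNReal.ofReal (ρ / 4) := by
        gcongr
        exact h3.trans (ENNReal.ofReal_le_ofReal (by linarith))
      _ = ENNReal.ofReal (ρ / 4 + ρ / 4 + ρ / 4) := by
        rw [ENNReal.ofReal_add (by positivity) (by positivity),
          ENNReal.ofReal_add (by positivity) (by positivity)]
      _ ≤ ENNReal.ofReal ρ := ENNReal.ofReal_le_ofReal (by linarith)
      _ < ε := hρ.2

end

/-! ### Causal curves in terms of time and the distance on S. -/

namespace StandardStaticSpacetime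

noncomputable section

variable {E : Type*} [NormedAddCommGroup E] [NormedSpace ℝ E] [FiniteDimensional ℝ E]
  {S : Type*} [TopologicalSpace S] [ChartedSpace E S] [IsManifold 𝓘(ℝ, E) ∞ S]
  (M : StandardStaticSpacetime E S)

variable {M}

lemma dtime_timeField (p : ℝ × S) : dtime (timeField E p) = 1 := by
  have h1 : HasMFDerivAt 𝓘(ℝ, ℝ) (𝓘(ℝ, ℝ).prod 𝓘(ℝ, E)) (fun t : ℝ => (t, p.2)) p.1 _ :=
    (hasMFDerivAt_id p.1).prodMk (hasMFDerivAt_const p.2 p.1)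
  have h2 : HasMFDerivAt (𝓘(ℝ, ℝ).prod 𝓘(ℝ, E)) 𝓘(ℝ, ℝ) (Prod.fst : ℝ × S → ℝ) p _ :=
    hasMFDerivAt_fst p
  rw [timeField, dtime, h2.mfderiv]
  refine (congrArg (fun L : ℝ →L[ℝ] ℝ × E => (L 1).1) h1.mfderiv).trans ?_
  rfl

lemma dspace_timeField (p : ℝ × S) : dspace (timeField E p) = 0 := by
  have h1 : HasMFDerivAt 𝓘(ℝ, ℝ) (𝓘(ℝ, ℝ).prod 𝓘(ℝ, E)) (fun t : ℝ => (t, p.2)) p.1 _ :=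
    (hasMFDerivAt_id p.1).prodMk (hasMFDerivAt_const p.2 p.1)
  have h2 : HasMFDerivAt (𝓘(ℝ, ℝ).prod 𝓘(ℝ, E)) 𝓘(ℝ, E) (Prod.snd : ℝ × S → S) p _ :=
    hasMFDerivAt_snd p
  rw [timeField, dspace, h2.mfderiv]
  refine (congrArg (fun L : ℝ →L[ℝ] ℝ × E => (L 1).2) h1.mfderiv).trans ?_
  rfl

lemma dtime_velocity {γ : ℝ → ℝ × S} {I : Set ℝ} {s : ℝ}
    (hγ : MDifferentiableWithinAt 𝓘(ℝ, ℝ) (𝓘(ℝ, ℝ).prod 𝓘(ℝ, E)) γ I s)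
    (hI : UniqueDiffWithinAt ℝ I s) :
    dtime (velocity E γ I s) = derivWithin (fun s => (γ s).1) I s := by
  have h1 : HasMFDerivWithinAt 𝓘(ℝ, ℝ) 𝓘(ℝ, ℝ) (Prod.fst ∘ γ) I s _ :=
    (mdifferentiableAt_fst (x := γ s)).hasMFDerivAt.comp_hasMFDerivWithinAt s hγ.hasMFDerivWithinAt
  have h2 := congrArg (fun L : ℝ →L[ℝ] ℝ => L 1) (h1.mfderivWithin hI.uniqueMDiffWithinAt)
  refine h2.symm.trans ?_
  rw [mfderivWithin_eq_fderivWithin]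
  rfl

lemma dspace_velocity {γ : ℝ → ℝ × S} {I : Set ℝ} {s : ℝ}
    (hγ : MDifferentiableWithinAt 𝓘(ℝ, ℝ) (𝓘(ℝ, ℝ).prod 𝓘(ℝ, E)) γ I s)
    (hI : UniqueDiffWithinAt ℝ I s) :
    dspace (velocity E γ I s) =
      mfderivWithin 𝓘(ℝ, ℝ) 𝓘(ℝ, E) (fun s => (γ s).2) I s (1 : ℝ) := by
  have h1 : HasMFDerivWithinAt 𝓘(ℝ, ℝ) 𝓘(ℝ, E) (Prod.snd ∘ γ) I s _ :=
    (mdifferentiableAt_snd (x := γ s)).hasMFDerivAt.comp_hasMFDerivWithinAt s hγ.hasMFDerivWithinAt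
  exact (congrArg (fun L : ℝ →L[ℝ] E => L 1) (h1.mfderivWithin hI.uniqueMDiffWithinAt)).symm

/-- Both products carry the factor V², so only dt² − V⁻²h matters. A positive time component already
excludes the zero vector. -/
lemma isFutureCausal_velocity_iff {γ : ℝ → ℝ × S} {I : Set ℝ} {s : ℝ}
    (hγ : MDifferentiableWithinAt 𝓘(ℝ, ℝ) (𝓘(ℝ, ℝ).prod 𝓘(ℝ, E)) γ I s)
    (hI : UniqueDiffWithinAt ℝ I s) :
    M.IsFutureCausal (velocity E γ I s) ↔ 0 < derivWithin (fun s => (γ s).1) I s ∧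
      M.speedSq (fun s => (γ s).2) I s ≤ derivWithin (fun s => (γ s).1) I s ^ 2 := by
  have hV := M.V_pos (γ s).2
  have h1 : M.g (γ s) (velocity E γ I s) (timeField E (γ s)) =
      M.V (γ s).2 ^ 2 * derivWithin (fun s => (γ s).1) I s := by
    rw [g, dtime_timeField, dspace_timeField, map_zero, dtime_velocity hγ hI]
    ring
  have h2 : M.g (γ s) (velocity E γ I s) (velocity E γ I s) =
      M.V (γ s).2 ^ 2 * (derivWithin (fun s => (γ s).1) I s ^ 2 -
        M.speedSq (fun s => (γ s).2) I s) := by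
    have h3 : M.speedSq (fun s => (γ s).2) I s = (M.V (γ s).2 ^ 2)⁻¹ * M.h.inner (γ s).2
      (mfderivWithin 𝓘(ℝ, ℝ) 𝓘(ℝ, E) (fun s => (γ s).2) I s (1 : ℝ))
      (mfderivWithin 𝓘(ℝ, ℝ) 𝓘(ℝ, E) (fun s => (γ s).2) I s (1 : ℝ)) := rfl
    rw [g, dtime_velocity hγ hI, dspace_velocity hγ hI, h3]
    field_simp
  rw [IsFutureCausal, h1, h2]
  constructor
  · rintro ⟨-, h3, h4⟩
    exact ⟨pos_of_mul_pos_right h4 (by positivity), by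
      have := nonneg_of_mul_nonneg_right h3 (by positivity : 0 < M.V (γ s).2 ^ 2)
      linarith⟩
  · rintro ⟨h3, h4⟩
    refine ⟨fun h => ?_, mul_nonneg (by positivity) (sub_nonneg.2 h4), by positivity⟩
    have h5 : dtime (velocity E γ I s) = 0 := by rw [h]; exact map_zero _
    rw [dtime_velocity hγ hI] at h5
    exact h3.ne' h5

lemma uniqueDiffOn_of_ordConnected {I : Set ℝ} (hI : I.OrdConnected) {s s' : ℝ} (hs : s ∈ I)
    (hs' : s' ∈ I) (hss : s < s') : UniqueDiffOn ℝ I := by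
  refine uniqueDiffOn_convex hI.convex ?_
  have h1 : Ioo s s' ⊆ interior I :=
    interior_maximal (Ioo_subset_Icc_self.trans (hI.out hs hs')) isOpen_Ioo
  exact (nonempty_Ioo.2 hss).mono h1

lemma mdifferentiableWithinAt_of_contMDiffOn {γ : ℝ → ℝ × S} {I : Set ℝ}
    (hγ : ContMDiffOn 𝓘(ℝ, ℝ) (𝓘(ℝ, ℝ).prod 𝓘(ℝ, E)) ∞ γ I) {s : ℝ} (hs : s ∈ I) :
    MDifferentiableWithinAt 𝓘(ℝ, ℝ) (𝓘(ℝ, ℝ).prod 𝓘(ℝ, E)) γ I s :=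
  (hγ s hs).mdifferentiableWithinAt (by simp)

/-- The graph of a smooth `1`-Lipschitz curve is causal. -/
lemma isFutureCausalCurveOn_graph [T3Space S] {x : ℝ → S} {I : Set ℝ} (hI : I.OrdConnected)
    (hI' : UniqueDiffOn ℝ I) (hx : ContMDiffOn 𝓘(ℝ, ℝ) 𝓘(ℝ, E) ∞ x I)
    (hlip : ∀ s ∈ I, ∀ s' ∈ I, M.dist (x s) (x s') ≤ ENNReal.ofReal |s' - s|) :
    M.IsFutureCausalCurveOn (fun s => (s, x s)) I := by
  have h1 : ContMDiffOn 𝓘(ℝ, ℝ) (𝓘(ℝ, ℝ).prod 𝓘(ℝ, E)) ∞ (fun s => (s, x s)) I :=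
    contMDiffOn_id.prodMk hx
  refine ⟨hI, h1, fun s hs => ?_⟩
  rw [isFutureCausal_velocity_iff (mdifferentiableWithinAt_of_contMDiffOn h1 hs) (hI' s hs)]
  have h2 : derivWithin (fun s : ℝ => s) I s = 1 := derivWithin_id' _ _ (hI' s hs)
  simp only
  rw [h2, one_pow]
  exact ⟨one_pos, speedSq_le_one_of_forall_dist_le hlip hs (hI' s hs)
    ((hx s hs).mdifferentiableWithinAt (by simp))⟩

/-- Along a causal curve, the time increases at least as much as the distance. -/
lemma IsFutureCausalCurveOn.lt_and_dist_le {γ : ℝ → ℝ × S} {I : Set ℝ}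
    (h : M.IsFutureCausalCurveOn γ I) {s s' : ℝ} (hs : s ∈ I) (hs' : s' ∈ I) (hss : s < s') :
    (γ s).1 < (γ s').1 ∧ M.dist (γ s).2 (γ s').2 ≤ ENNReal.ofReal ((γ s').1 - (γ s).1) := by
  obtain ⟨hI, hγ, hc⟩ := h
  have hI' := uniqueDiffOn_of_ordConnected hI hs hs' hss
  have hsub : Icc s s' ⊆ I := hI.out hs hs'
  have hx : ContMDiffOn 𝓘(ℝ, ℝ) 𝓘(ℝ, E) ∞ (fun s => (γ s).2) I :=
    contMDiff_snd.comp_contMDiffOn hγ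
  have ht : ContMDiffOn 𝓘(ℝ, ℝ) 𝓘(ℝ, ℝ) ∞ (fun s => (γ s).1) I :=
    contMDiff_fst.comp_contMDiffOn hγ
  have ht' := ht.contDiffOn
  have key : ∀ u ∈ I, _ := fun u hu => (isFutureCausal_velocity_iff (M := M)
    (mdifferentiableWithinAt_of_contMDiffOn hγ hu) (hI' u hu)).1 (hc u hu)
  have hd : ∀ u ∈ Icc s s', HasDerivWithinAt (fun s => (γ s).1)
      (derivWithin (fun s => (γ s).1) I u) (Icc s s') u := fun u hu =>
    (((ht'.differentiableOn (by simp)) u (hsub hu)).hasDerivWithinAt).mono hsub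
  refine ⟨?_, ?_⟩
  · refine (strictMonoOn_of_deriv_pos (convex_Icc s s') (ht.continuousOn.mono hsub) fun u hu => ?_)
      (left_mem_Icc.2 hss.le) (right_mem_Icc.2 hss.le) hss
    rw [interior_Icc] at hu
    rw [((hd u (Ioo_subset_Icc_self hu)).hasDerivAt (Icc_mem_nhds hu.1 hu.2)).deriv]
    exact (key u (hsub (Ioo_subset_Icc_self hu))).1
  · refine M.dist_le_of_speedSq_le (c := fun s => (γ s).2) hss.le ((hx.mono hsub).of_le (by simp)) hd
      (fun u hu => (key u (hsub hu)).1.le) fun u hu => ?_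
    rw [M.speedSq_mono hsub ((hx u (hsub hu)).mdifferentiableWithinAt (by simp))
      (uniqueDiffOn_Icc hss u hu)]
    exact (key u (hsub hu)).2

end
end StandardStaticSpacetime

/-! ### Slices of J(K) and balls around the projection of K. -/

namespace StandardStaticSpacetime

noncomputable section

variable {E : Type*} [NormedAddCommGroup E] [NormedSpace ℝ E] [FiniteDimensional ℝ E]
  {S : Type*} [TopologicalSpace S] [ChartedSpace E S] [IsManifold 𝓘(ℝ, E) ∞ S]
  (M : StandardStaticSpacetime E S)

variable {M}

lemma exists_contMDiff_lipschitz_of_dist_lt {p q : S} {T : ℝ}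
    (h : M.dist p q < ENNReal.ofReal T) :
    ∃ c : ℝ → S, ContMDiff 𝓘(ℝ, ℝ) 𝓘(ℝ, E) ∞ c ∧ c 0 = p ∧ c T = q ∧
      ∀ s s', M.dist (c s) (c s') ≤ ENNReal.ofReal |s' - s| := by
  obtain ⟨c, hc, hc0, hcT, hcs⟩ := exists_reach_of_dist_lt h
  have key : ∀ s s', s < s' → M.dist (c s) (c s') ≤ ENNReal.ofReal (s' - s) := fun s s' hss =>
    M.dist_le_of_speedSq_le (c := c) (τ := id) (τ' := fun _ => 1) hss.le
      (hc.contMDiffOn.of_le (by simp)) (fun s _ => hasDerivWithinAt_id _ _)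
      (fun _ _ => zero_le_one) (fun u hu => by
        rw [M.speedSq_mono (subset_univ _)
          (hc.mdifferentiable (by simp) u).mdifferentiableWithinAt
          (uniqueDiffOn_Icc hss u hu), one_pow]
        exact hcs u)
  refine ⟨c, hc, hc0 0 le_rfl, hcT T le_rfl, fun s s' => ?_⟩
  rcases lt_trichotomy s s' with hss | rfl | hss
  · rw [abs_of_pos (sub_pos.2 hss)]
    exact key s s' hss
  · rw [← reachDist_eq_dist, reachDist_self]
    exact zero_le
  · rw [abs_of_neg (sub_neg.2 hss), neg_sub, dist_comm]
    exact key s' s hss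

lemma hasShortCurves [T3Space S] :
    letI := M.toEMetricSpace
    HasShortCurves S := by
  let _ := M.toEMetricSpace
  intro p q T h
  obtain ⟨c, -, h0, hT, hlip⟩ := exists_contMDiff_lipschitz_of_dist_lt (M := M) h
  refine ⟨c, fun s s' => ?_, h0, hT⟩
  rw [ENNReal.coe_one, one_mul, edist_dist, Real.dist_eq, abs_sub_comm]
  exact hlip s s'

lemma closedThickening_eq_cthickening [T3Space S] (A : Set S) (t : ℝ) :
    letI := M.toEMetricSpace
    M.closedThickening A t = Metric.cthickening t A := rfl

lemma mem_closedThickening_of_dist_le {A : Set S} {t : ℝ} {p q : S} (hq : q ∈ A)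
    (h : M.dist p q ≤ ENNReal.ofReal t) : p ∈ M.closedThickening A t :=
  (iInf₂_le (f := fun q (_ : q ∈ A) => M.dist p q) q hq).trans h

lemma isCompact_closedThickening_mono [T3Space S] {A : Set S} {s t : ℝ} (hst : s ≤ t)
    (h : IsCompact (M.closedThickening A t)) : IsCompact (M.closedThickening A s) := by
  let _ := M.toEMetricSpace
  exact isCompact_cthickening_mono hst h

/-! ### The slices of the causal future and past -/

lemma mem_Jplus_of_curve [T3Space S] {K : Set (ℝ × S)} {t : ℝ} (ht : 0 < t) {x : ℝ → S}
    (hx : ContMDiffOn 𝓘(ℝ, ℝ) 𝓘(ℝ, E) ∞ x (Icc 0 t))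
    (hlip : ∀ s ∈ Icc 0 t, ∀ s' ∈ Icc 0 t, M.dist (x s) (x s') ≤ ENNReal.ofReal |s' - s|)
    (h0 : ((0 : ℝ), x 0) ∈ K) : (t, x t) ∈ M.Jplus K :=
  Or.inr ⟨0, t, fun s => (s, x s), ht,
    isFutureCausalCurveOn_graph ordConnected_Icc (uniqueDiffOn_Icc ht) hx hlip, h0, rfl⟩

lemma mem_Jminus_of_curve [T3Space S] {K : Set (ℝ × S)} {t : ℝ} (ht : 0 < t) {x : ℝ → S}
    (hx : ContMDiffOn 𝓘(ℝ, ℝ) 𝓘(ℝ, E) ∞ x (Icc 0 t))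
    (hlip : ∀ s ∈ Icc 0 t, ∀ s' ∈ Icc 0 t, M.dist (x s) (x s') ≤ ENNReal.ofReal |s' - s|)
    (h0 : ((0 : ℝ), x 0) ∈ K) : (-t, x t) ∈ M.Jminus K := by
  have hmaps : MapsTo (fun s : ℝ => -s) (Icc (-t) 0) (Icc 0 t) := fun s hs =>
    ⟨by linarith [hs.2], by linarith [hs.1]⟩
  refine Or.inr ⟨-t, 0, fun s => (s, x (-s)), by linarith,
    isFutureCausalCurveOn_graph ordConnected_Icc (uniqueDiffOn_Icc (by linarith)) ?_ ?_, ?_, ?_⟩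
  · exact hx.comp contDiff_neg.contMDiff.contMDiffOn hmaps
  · intro s hs s' hs'
    refine (hlip _ (hmaps hs) _ (hmaps hs')).trans_eq ?_
    rw [neg_sub_neg, abs_sub_comm]
  · simpa using h0
  · simp

variable {K : Set (ℝ × S)}

lemma mem_J_of_curve [T3Space S] {t : ℝ} (ht : t ≠ 0) {x : ℝ → S}
    (hx : ContMDiffOn 𝓘(ℝ, ℝ) 𝓘(ℝ, E) ∞ x (Icc 0 |t|))
    (hlip : ∀ s ∈ Icc 0 |t|, ∀ s' ∈ Icc 0 |t|, M.dist (x s) (x s') ≤ ENNReal.ofReal |s' - s|)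
    (h0 : ((0 : ℝ), x 0) ∈ K) : (t, x |t|) ∈ M.J K := by
  rcases lt_or_gt_of_ne ht with h | h
  · have := mem_Jminus_of_curve (abs_pos.2 ht) hx hlip h0
    rw [abs_of_neg h, neg_neg] at this
    rw [abs_of_neg h]
    exact Or.inr this
  · have := mem_Jplus_of_curve (abs_pos.2 ht) hx hlip h0
    rw [abs_of_pos h] at this
    rw [abs_of_pos h]
    exact Or.inl this

lemma mk_zero_mem_iff (hK0 : K ⊆ slice S 0) {y : S} :
    ((0 : ℝ), y) ∈ K ↔ y ∈ Prod.snd '' K := by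
  refine ⟨fun h => ⟨_, h, rfl⟩, ?_⟩
  rintro ⟨⟨a, z⟩, h, rfl⟩
  have : a = 0 := hK0 h
  rwa [← this]

lemma mem_J_of_dist_lt [T3Space S] (hK0 : K ⊆ slice S 0) {t : ℝ} {q y : S}
    (hq : q ∈ Prod.snd '' K) (h : M.dist y q < ENNReal.ofReal |t|) : (t, y) ∈ M.J K := by
  have ht : t ≠ 0 := by
    rintro rfl
    simp at h
  rw [dist_comm] at h
  obtain ⟨c, hc, hc0, hcT, hlip⟩ := exists_contMDiff_lipschitz_of_dist_lt h
  rw [← hcT]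
  refine mem_J_of_curve ht hc.contMDiffOn (fun s _ s' _ => hlip s s') ?_
  rwa [hc0, mk_zero_mem_iff hK0]

/-- If `(t, y)` lies in `J(K)`, then it lies in `K`, or it can be reached with positive `|t|`. -/
lemma of_mem_J (hK0 : K ⊆ slice S 0) {t : ℝ} {y : S} :
    ((t, y) ∈ M.Jplus K → (t, y) ∈ K ∨ 0 < t ∧ ∃ q ∈ Prod.snd '' K,
      M.dist y q ≤ ENNReal.ofReal t) ∧
    ((t, y) ∈ M.Jminus K → (t, y) ∈ K ∨ t < 0 ∧ ∃ q ∈ Prod.snd '' K,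
      M.dist y q ≤ ENNReal.ofReal (-t)) := by
  refine ⟨?_, ?_⟩
  · rintro (h | ⟨a, b, γ, hab, hγ, ha, hb⟩)
    · exact Or.inl h
    · obtain ⟨h1, h2⟩ := hγ.lt_and_dist_le (left_mem_Icc.2 hab.le) (right_mem_Icc.2 hab.le) hab
      have h0 : (γ a).1 = 0 := hK0 ha
      rw [hb, h0] at h1 h2
      refine Or.inr ⟨h1, (γ a).2, mem_image_of_mem _ ha, ?_⟩
      rwa [dist_comm, ← sub_zero t]
  · rintro (h | ⟨a, b, γ, hab, hγ, hb, ha⟩)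
    · exact Or.inl h
    · obtain ⟨h1, h2⟩ := hγ.lt_and_dist_le (left_mem_Icc.2 hab.le) (right_mem_Icc.2 hab.le) hab
      have h0 : (γ b).1 = 0 := hK0 hb
      rw [ha, h0] at h1 h2
      refine Or.inr ⟨h1, (γ b).2, mem_image_of_mem _ hb, ?_⟩
      rwa [← zero_sub]

lemma Jplus_inter_slice (hK0 : K ⊆ slice S 0) {t : ℝ} (ht : 0 ≤ t) :
    M.Jplus K ∩ slice S t = M.J K ∩ slice S t := by
  refine subset_antisymm (inter_subset_inter_left _ subset_union_left) ?_
  rintro ⟨s, y⟩ ⟨h | h, hs⟩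
  · exact ⟨h, hs⟩
  · obtain rfl : s = t := hs
    rcases (of_mem_J hK0).2 h with h | h
    · exact ⟨Or.inl h, rfl⟩
    · exact absurd h.1 (not_lt.2 ht)

lemma mem_closedThickening_of_mem_J [T3Space S] (hK0 : K ⊆ slice S 0) {t : ℝ} {y : S}
    (h : (t, y) ∈ M.J K) : y ∈ M.closedThickening (Prod.snd '' K) |t| := by
  have hmem : (t, y) ∈ K → y ∈ M.closedThickening (Prod.snd '' K) |t| := fun h =>
    mem_closedThickening_of_dist_le (mem_image_of_mem _ h) (by
      rw [← reachDist_eq_dist, reachDist_self]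
      exact zero_le)
  rcases h with h | h
  · rcases (of_mem_J hK0).1 h with h | ⟨ht, q, hq, hle⟩
    · exact hmem h
    · exact mem_closedThickening_of_dist_le hq (by rwa [abs_of_pos ht])
  · rcases (of_mem_J hK0).2 h with h | ⟨ht, q, hq, hle⟩
    · exact hmem h
    · exact mem_closedThickening_of_dist_le hq (by rwa [abs_of_neg ht])

/-- At distance less than |t| a smooth curve exists in any case. At distance exactly |t| > 0
compactness provides a minimising curve, and `contMDiffOn_of_forall_dist_eq` makes it smooth, so
that its graph is causal. -/
lemma mem_J_of_isCompact [T3Space S] (hK : IsCompact K) (hK0 : K ⊆ slice S 0) {t : ℝ}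
    (hB : IsCompact (M.closedThickening (Prod.snd '' K) |t|)) {y : S}
    (hy : y ∈ M.closedThickening (Prod.snd '' K) |t|) : (t, y) ∈ M.J K := by
  let _ := M.toEMetricSpace
  have hK' : IsCompact (Prod.snd '' K) := hK.image continuous_snd
  have hy' : Metric.infEDist y (Prod.snd '' K) ≤ ENNReal.ofReal |t| := hy
  rcases hy'.lt_or_eq with hlt | heq
  · obtain ⟨q, hq, h⟩ := Metric.infEDist_lt_iff.1 hlt
    exact mem_J_of_dist_lt hK0 hq h
  · by_cases ht : t = 0
    · subst ht
      rw [abs_zero, ENNReal.ofReal_zero, ← Metric.mem_closure_iff_infEDist_zero,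
        hK'.isClosed.closure_eq] at heq
      exact Or.inl (Or.inl ((mk_zero_mem_iff hK0).2 heq))
    · obtain ⟨γ, h0, hr, hγ⟩ := exists_minimizing_curve (hasShortCurves (M := M)) hK'
        (abs_nonneg t) hB heq
      rw [← hr]
      exact mem_J_of_curve ht (contMDiffOn_of_forall_dist_eq (M := M) (abs_pos.2 ht) hγ)
        (fun s hs s' hs' => (hγ s hs s' hs').le) ((mk_zero_mem_iff hK0).2 h0)

/-- The slices of `J(K)` are compact if and only if the corresponding balls are. -/
theorem isCompact_J_inter_slice_iff [T3Space S] (hK : IsCompact K) (hK0 : K ⊆ slice S 0) {t : ℝ} :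
    IsCompact (M.J K ∩ slice S t) ↔ IsCompact (M.closedThickening (Prod.snd '' K) |t|) := by
  let _ := M.toEMetricSpace
  have hK' : IsCompact (Prod.snd '' K) := hK.image continuous_snd
  constructor
  · intro h
    have h1 : IsCompact (Prod.snd '' (M.J K ∩ slice S t)) := h.image continuous_snd
    by_cases ht : t = 0
    · rw [closedThickening_eq_cthickening, ht, abs_zero, Metric.cthickening_zero,
        hK'.isClosed.closure_eq]
      exact hK'
    -- The projected slice contains all points at distance less than |t|; being compact, it is
    -- closed and contains the closed ball.
    · refine h1.of_isClosed_subset Metric.isClosed_cthickening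
        (cthickening_subset_of_forall_infEDist_lt (hasShortCurves (M := M)) (abs_pos.2 ht)
          h1.isClosed fun y hy => ?_)
      obtain ⟨q, hq, hlt⟩ := Metric.infEDist_lt_iff.1 hy
      exact ⟨(t, y), ⟨mem_J_of_dist_lt hK0 hq hlt, rfl⟩, rfl⟩
  · intro h
    have h1 : M.J K ∩ slice S t = (fun y => (t, y)) '' M.closedThickening (Prod.snd '' K) |t| := by
      ext ⟨s, y⟩
      constructor
      · rintro ⟨hJ, hs⟩
        obtain rfl : s = t := hs
        exact ⟨y, mem_closedThickening_of_mem_J hK0 hJ, rfl⟩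
      · rintro ⟨z, hz, hzy⟩
        simp only [Prod.mk.injEq] at hzy
        obtain ⟨rfl, rfl⟩ := hzy
        exact ⟨mem_J_of_isCompact hK hK0 h hz, rfl⟩
    rw [h1]
    exact h.image (by fun_prop)

end
end StandardStaticSpacetime

/-! ### Cauchy developments of slices and compactness of balls. -/

namespace StandardStaticSpacetime

noncomputable section

variable {E : Type*} [NormedAddCommGroup E] [NormedSpace ℝ E] [FiniteDimensional ℝ E]
  {S : Type*} [TopologicalSpace S] [ChartedSpace E S] [IsManifold 𝓘(ℝ, E) ∞ S]
  (M : StandardStaticSpacetime E S)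

variable {M}

/-- A curve in a compact set whose variation is bounded by that of a convergent function
converges. -/
lemma _root_.IsCompact.exists_tendsto_of_edist_le {X ι : Type*} [EMetricSpace X] {C : Set X}
    (hC : IsCompact C) {l : Filter ι} [l.NeBot] {f : ι → X} {g : ι → ℝ} {a : ℝ} {A : Set ι}
    (hA : A ∈ l) (hg : Tendsto g l (𝓝 a)) (hf : ∀ i ∈ A, f i ∈ C)
    (h : ∀ i ∈ A, ∀ j ∈ A, edist (f i) (f j) ≤ ENNReal.ofReal |g j - g i|) :
    ∃ q, Tendsto f l (𝓝 q) := by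
  suffices hc : Cauchy (map f l) by
    obtain ⟨q, -, hq⟩ := hC.isComplete (map f l) hc
      (le_principal_iff.2 (mem_map.2 (mem_of_superset hA hf)))
    exact ⟨q, hq⟩
  refine EMetric.cauchy_iff.2 ⟨NeBot.ne inferInstance, fun ε hε => ?_⟩
  obtain ⟨t, ht, hte⟩ := (EMetric.cauchy_iff.1 hg.cauchy_map).2 ε hε
  refine ⟨f '' (A ∩ g ⁻¹' t), image_mem_map (inter_mem hA ht), ?_⟩
  rintro _ ⟨i, ⟨hi, hi'⟩, rfl⟩ _ ⟨j, ⟨hj, hj'⟩, rfl⟩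
  refine (h i hi j hj).trans_lt ?_
  have := hte _ hi' _ hj'
  rwa [edist_dist, Real.dist_eq, abs_sub_comm] at this

/-! ### Cauchy developments -/

/-- A causal curve through (t, x) that misses Σ_τ stays above it. Towards the past its time is
monotone and bounded, hence converges. Its projection stays in the compact ball and varies no more
than the time, so the curve has a past endpoint. -/
lemma mem_Dplus_of_isCompact [T3Space S] {τ t : ℝ} {x : S} (hτ : τ < t)
    (hB : IsCompact (M.closedThickening {x} (t - τ))) : (t, x) ∈ M.Dplus (slice S τ) := by
  let _ := M.toEMetricSpace
  rintro γ I hγ hinext ⟨s₀, hs₀, hp⟩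
  by_contra hcon
  refine hinext ?_
  have ht : ContinuousOn (fun s => (γ s).1) I := continuous_fst.comp_continuousOn hγ.2.1.continuousOn
  have ht₀ : (γ s₀).1 = t := by rw [hp]
  have hlow : ∀ s ∈ I, τ < (γ s).1 := by
    intro s hs
    by_contra hle
    obtain ⟨u, hu, hut⟩ := hγ.1.isPreconnected.intermediate_value hs hs₀ ht
      (show τ ∈ Icc (γ s).1 (γ s₀).1 from ⟨not_lt.1 hle, by rw [ht₀]; exact hτ.le⟩)
    exact hcon ⟨u, hu, hut⟩
  have hmono : ∀ s ∈ I, ∀ s' ∈ I, s ≤ s' → (γ s).1 ≤ (γ s').1 := fun s hs s' hs' hss =>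
    hss.eq_or_lt.elim (fun h => by rw [h]) fun h => (hγ.lt_and_dist_le hs hs' h).1.le
  have hdist : ∀ s ∈ I, ∀ s' ∈ I, s ≤ s' →
      edist (γ s).2 (γ s').2 ≤ ENNReal.ofReal |(γ s').1 - (γ s).1| := by
    intro s hs s' hs' hss
    rcases hss.eq_or_lt with h | h
    · rw [h, edist_self]; exact zero_le
    · exact (hγ.lt_and_dist_le hs hs' h).2.trans (ENNReal.ofReal_le_ofReal (le_abs_self _))
  have : Nonempty I := ⟨⟨s₀, hs₀⟩⟩
  have h1 : Tendsto (fun s : I => (γ s).1) atBot (𝓝 (⨅ s : I, (γ s).1)) :=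
    tendsto_atBot_ciInf (fun s s' h => hmono s s.2 s' s'.2 h)
      ⟨τ, by rintro _ ⟨s, rfl⟩; exact (hlow s s.2).le⟩
  obtain ⟨q, hq⟩ := hB.exists_tendsto_of_edist_le (l := (atBot : Filter I))
    (A := Iic ⟨s₀, hs₀⟩) (f := fun s : I => (γ s).2) (Iic_mem_atBot _) h1
    (fun s hs => by
      refine mem_closedThickening_of_dist_le (q := x) rfl ?_
      have h2 := hdist s s.2 s₀ hs₀ hs
      have h3 := hmono s s.2 s₀ hs₀ hs
      rw [ht₀] at h2 h3
      rw [abs_of_nonneg (sub_nonneg.2 h3), hp] at h2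
      exact h2.trans (ENNReal.ofReal_le_ofReal (by linarith [hlow s s.2])))
    (fun i _ j _ => by
      rcases le_total i j with h | h
      · exact hdist i i.2 j j.2 h
      · rw [edist_comm, abs_sub_comm]
        exact hdist j j.2 i i.2 h)
  refine ⟨(⨅ s : I, (γ s).1, q), fun U hU => ?_⟩
  have h4 : Tendsto (fun s : I => γ s) atBot (𝓝 (⨅ s : I, (γ s).1, q)) := h1.prodMk_nhds hq
  obtain ⟨s, hs⟩ := mem_atBot_sets.1 (h4 hU)
  exact ⟨s, s.2, fun s' hs' hle => hs ⟨s', hs'⟩ hle⟩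

/-- The vertical half-line above (t, x) is future-inextendible and never meets an earlier slice. -/
lemma notMem_Dminus_slice [T3Space S] {τ t : ℝ} {x : S} (hτ : τ < t) :
    (t, x) ∉ M.Dminus (slice S τ) := by
  intro h
  suffices hext : FutureInextendible (fun s : ℝ => (s, x)) (Ici t) by
    obtain ⟨s, hs, hsτ⟩ := h (fun s => (s, x)) (Ici t)
      (isFutureCausalCurveOn_graph ordConnected_Ici (uniqueDiffOn_Ici t) contMDiffOn_const
        fun s _ s' _ => by
          rw [← reachDist_eq_dist, reachDist_self]
          exact zero_le) hext ⟨t, self_mem_Ici, rfl⟩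
    have h1 : s = τ := hsτ
    have h2 : t ≤ s := hs
    linarith
  rintro ⟨q, hq⟩
  obtain ⟨s, hs, h1⟩ := hq {p | p.1 < q.1 + 1}
    ((isOpen_lt continuous_fst continuous_const).mem_nhds (by simp))
  have h2 := h1 (max s (q.1 + 1)) ((show t ≤ s from hs).trans (le_max_left _ _))
    (le_max_left _ _)
  exact (le_max_right s (q.1 + 1)).not_gt h2

/-- Otherwise some minimising ray from `x`, of length R ≤ t − τ, has no end point. Its graph run
into the past is inextendible and lives at times greater than t − R ≥ τ, so it misses Σ_τ. -/
lemma isCompact_of_mem_Dplus [T3Space S] [LocallyCompactSpace S] {τ t : ℝ} {x : S}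
    (h : (t, x) ∈ M.Dplus (slice S τ)) : IsCompact (M.closedThickening {x} (t - τ)) := by
  let _ := M.toEMetricSpace
  by_contra hnc
  obtain ⟨R, hR, hRt, hncR, hlt⟩ := exists_minimal_not_isCompact (hasShortCurves (M := M))
    isCompact_singleton hnc
  obtain ⟨γ, hγ0, -, hγ, hlim⟩ := exists_minimizing_ray (hasShortCurves (M := M))
    isCompact_singleton hR hncR hlt
  have hmaps : MapsTo (fun s : ℝ => t - s) (Ioc (t - R) t) (Ico 0 R) := fun s hs =>
    ⟨by linarith [hs.2], by linarith [hs.1]⟩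
  have hγs : ContMDiffOn 𝓘(ℝ, ℝ) 𝓘(ℝ, E) ∞ γ (Ico 0 R) := by
    intro s hs
    obtain ⟨r, hr1, hr2⟩ := exists_between hs.2
    have h1 := contMDiffOn_of_forall_dist_eq (M := M) (hs.1.trans_lt hr1) (γ := γ)
      fun u hu u' hu' => hγ u ⟨hu.1, hu.2.trans_lt hr2⟩ u' ⟨hu'.1, hu'.2.trans_lt hr2⟩
    refine (h1 s ⟨hs.1, hr1.le⟩).mono_of_mem_nhdsWithin ?_
    filter_upwards [self_mem_nhdsWithin, mem_nhdsWithin_of_mem_nhds (Iio_mem_nhds hr1)]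
      with u hu hu' using ⟨hu.1, hu'.le⟩
  suffices hext : PastInextendible (fun s : ℝ => (s, γ (t - s))) (Ioc (t - R) t) by
    obtain ⟨s, hs, hsτ⟩ := h (fun s => (s, γ (t - s))) (Ioc (t - R) t)
      (isFutureCausalCurveOn_graph ordConnected_Ioc
        (uniqueDiffOn_of_ordConnected ordConnected_Ioc (s := t - R / 2) (s' := t)
          ⟨by linarith, by linarith⟩ ⟨by linarith, le_rfl⟩ (by linarith))
        (hγs.comp (contDiff_const.sub contDiff_id).contMDiff.contMDiffOn hmaps)
        fun s hs s' hs' => by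
          refine (hγ _ (hmaps hs) _ (hmaps hs')).le.trans_eq ?_
          rw [sub_sub_sub_cancel_left, abs_sub_comm])
      hext ⟨t, ⟨by linarith, le_rfl⟩, by rw [sub_self, show γ 0 = x from hγ0]⟩
    have h1 : s = τ := hsτ
    have h2 := hs.1
    linarith
  rintro ⟨q, hq⟩
  refine hlim ⟨q.2, fun U hU => ?_⟩
  obtain ⟨s, hs, h1⟩ := hq (Prod.snd ⁻¹' U) (continuous_snd.continuousAt hU)
  rw [mem_map]
  filter_upwards [Ioo_mem_nhdsLT (show t - s < R by linarith [hs.1])] with u hu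
  have h2 := h1 (t - u) ⟨by linarith [hu.2], by linarith [hu.1, hs.2]⟩ (by linarith [hu.1])
  simpa using h2

/-- The points of the Cauchy development of a slice in its future. -/
theorem mem_D_slice_iff [T3Space S] [LocallyCompactSpace S] {τ t : ℝ} {x : S} (hτ : τ < t) :
    (t, x) ∈ M.D (slice S τ) ↔ IsCompact (M.closedThickening {x} (t - τ)) := by
  refine ⟨fun h => h.elim isCompact_of_mem_Dplus fun h => absurd h (notMem_Dminus_slice hτ),
    fun h => Or.inl (mem_Dplus_of_isCompact hτ h)⟩

lemma slice_subset_D (τ : ℝ) : slice S τ ⊆ M.D (slice S τ) :=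
  fun p hp => Or.inl fun _ _ _ _ ⟨s, hs, hsp⟩ => ⟨s, hs, by rwa [hsp]⟩

/-- Points of J(K) ∩ Σ_t are within t of `K` and each needs a compact ball of radius t − τ; the
radii add to 2t − τ. Conversely, a minimising ray from `K` that breaks off at R ≤ 2t − τ has a point
of J(K) ∩ Σ_t within t − τ of its missing end, and the ball about it cannot be compact. -/
theorem J_inter_slice_subset_D_iff [T3Space S] [LocallyCompactSpace S] {K : Set (ℝ × S)}
    (hK : IsCompact K) (hK0 : K ⊆ slice S 0) {τ t : ℝ} (hτ : 0 ≤ τ) (hτt : τ ≤ t)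
    (hBτ : IsCompact (M.closedThickening (Prod.snd '' K) τ)) :
    M.J K ∩ slice S t ⊆ M.D (slice S τ) ↔
      IsCompact (M.closedThickening (Prod.snd '' K) (2 * t - τ)) := by
  let _ := M.toEMetricSpace
  have hK' : IsCompact (Prod.snd '' K) := hK.image continuous_snd
  have ht0 : 0 ≤ t := hτ.trans hτt
  constructor
  · intro h
    by_contra hnc
    obtain ⟨R, hR, hRt, hncR, hlt⟩ := exists_minimal_not_isCompact (hasShortCurves (M := M))
      hK' hnc
    obtain ⟨γ, hγ0, hγK, hγ, hlim⟩ := exists_minimizing_ray (hasShortCurves (M := M))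
      hK' hR hncR hlt
    -- This excludes t = τ, where R ≤ 2t − τ = τ and `mem_D_slice_iff` would not apply.
    have hτR : τ < R := by
      by_contra hle
      exact hncR (isCompact_closedThickening_mono (not_lt.1 hle) hBτ)
    have htτ : τ < t := by linarith
    -- a point of `J(K)` at time `t` which is close to the end of the ray
    obtain ⟨s, hs, hsR, hsJ⟩ : ∃ s ∈ Ico 0 R, R - s ≤ t - τ ∧ (t, γ s) ∈ M.J K := by
      -- For t < R the ray is followed up to time t, and R − t ≤ t − τ because R ≤ 2t − τ. For R ≤ t
      -- every point of the ray is reached with time to spare, so one near the end is taken.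
      rcases lt_or_ge t R with htR | htR
      · refine ⟨t, ⟨ht0, htR⟩, by linarith, mem_J_of_isCompact hK hK0 ?_ ?_⟩
        · rw [abs_of_nonneg ht0]
          exact hlt t htR
        · rw [abs_of_nonneg ht0]
          exact hγK t ⟨ht0, htR⟩
      · have hs : max 0 (R - (t - τ)) ∈ Ico 0 R := ⟨le_max_left _ _, max_lt hR (by linarith)⟩
        refine ⟨_, hs, by linarith [le_max_right 0 (R - (t - τ))], ?_⟩
        refine mem_J_of_dist_lt hK0 hγ0 ?_
        have h1 := hγ _ hs 0 ⟨le_rfl, hR⟩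
        refine h1.trans_lt ?_
        rw [zero_sub, abs_neg, abs_of_nonneg hs.1, abs_of_nonneg ht0,
          ENNReal.ofReal_lt_ofReal_iff (by linarith)]
        exact hs.2.trans_le htR
    have hcpt := (mem_D_slice_iff htτ).1 (h ⟨hsJ, rfl⟩)
    refine hlim (hcpt.exists_tendsto_of_edist_le (A := Ioo s R) (g := id) (a := R)
      (Ioo_mem_nhdsLT hs.2) (tendsto_id.mono_left nhdsWithin_le_nhds) (fun u hu => ?_)
      fun u hu u' hu' => ?_)
    · refine mem_closedThickening_of_dist_le (q := γ s) rfl ?_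
      have h1 := hγ u ⟨hs.1.trans hu.1.le, hu.2⟩ s hs
      refine h1.le.trans (ENNReal.ofReal_le_ofReal ?_)
      rw [abs_of_nonpos (by linarith [hu.1])]
      linarith [hu.2]
    · exact (hγ u ⟨hs.1.trans hu.1.le, hu.2⟩ u' ⟨hs.1.trans hu'.1.le, hu'.2⟩).le
  · rintro hB ⟨u, y⟩ ⟨hJ, hu⟩
    obtain rfl : u = t := hu
    rcases hτt.eq_or_lt with heq | hlt
    · rw [heq]
      exact slice_subset_D u rfl
    · rw [mem_D_slice_iff hlt]
      refine hB.of_isClosed_subset Metric.isClosed_cthickening fun z hz => ?_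
      have h1 := mem_closedThickening_of_mem_J hK0 hJ
      rw [abs_of_nonneg ht0] at h1
      have h2 : Metric.infEDist y (Prod.snd '' K) ≤ ENNReal.ofReal u := h1
      have h3 : Metric.infEDist z {y} ≤ ENNReal.ofReal (u - τ) := hz
      rw [Metric.infEDist_singleton] at h3
      have h4 : Metric.infEDist z (Prod.snd '' K) ≤ ENNReal.ofReal u + ENNReal.ofReal (u - τ) :=
        Metric.infEDist_le_infEDist_add_edist.trans (add_le_add h2 h3)
      rw [← ENNReal.ofReal_add ht0 (by linarith)] at h4
      exact h4.trans (ENNReal.ofReal_le_ofReal (by linarith))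

end
end StandardStaticSpacetime

/-! ### The halving recursion for t_n(K), and completeness. -/

namespace StandardStaticSpacetime

noncomputable section

variable {E : Type*} [NormedAddCommGroup E] [NormedSpace ℝ E] [FiniteDimensional ℝ E]
  {S : Type*} [TopologicalSpace S] [ChartedSpace E S] [IsManifold 𝓘(ℝ, E) ∞ S]
  (M : StandardStaticSpacetime E S)

variable {M} {K : Set (ℝ × S)}

/-! ### The times attached to a compact set -/

/-- `t^∞(K)` bounds the radii of the compact balls around `K`. -/
lemma isCompact_closedThickening_iff_lt_tInfty [T3Space S] [LocallyCompactSpace S]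
    (hK : IsCompact K) (hK0 : K ⊆ slice S 0) {t : ℝ} (ht : 0 ≤ t) :
    IsCompact (M.closedThickening (Prod.snd '' K) t) ↔ ENNReal.ofReal t < M.tInfty K := by
  let _ := M.toEMetricSpace
  have hset : {t : ℝ | 0 ≤ t ∧ IsCompact (M.Jplus K ∩ slice S t)} =
      {t : ℝ | 0 ≤ t ∧ IsCompact (M.closedThickening (Prod.snd '' K) t)} := by
    ext u
    refine and_congr_right fun hu => ?_
    rw [Jplus_inter_slice hK0 hu, isCompact_J_inter_slice_iff hK hK0, abs_of_nonneg hu]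
  rw [tInfty, hset]
  constructor
  -- The supremum is not attained: a compact ball of radius t comes with a larger one.
  · intro h
    obtain ⟨ε, hε, h'⟩ := exists_isCompact_cthickening_add (hasShortCurves (M := M)) ht h
    have hε0 : 0 < t + ε := add_pos_of_nonneg_of_pos ht hε
    calc ENNReal.ofReal t < ENNReal.ofReal (t + ε) :=
          (ENNReal.ofReal_lt_ofReal_iff (by linarith)).2 (by linarith)
      _ ≤ _ := le_sSup (mem_image_of_mem _ (show t + ε ∈ {t : ℝ | 0 ≤ t ∧
          IsCompact (M.closedThickening (Prod.snd '' K) t)} from ⟨hε0.le, h'⟩))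
  · intro h
    obtain ⟨_, ⟨u, hu, rfl⟩, htu⟩ := lt_sSup_iff.1 h
    exact isCompact_closedThickening_mono ((ENNReal.ofReal_lt_ofReal_iff'.1 htu).1.le) hu.2

lemma tInfty_pos [T3Space S] [LocallyCompactSpace S] (hK : IsCompact K) (hK0 : K ⊆ slice S 0) :
    0 < M.tInfty K := by
  let _ := M.toEMetricSpace
  rw [← ENNReal.ofReal_zero, ← isCompact_closedThickening_iff_lt_tInfty hK hK0 le_rfl,
    closedThickening_eq_cthickening, Metric.cthickening_zero,
    (hK.image continuous_snd).isClosed.closure_eq]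
  exact hK.image continuous_snd

lemma J_inter_slice_subset_D_iff_lt [T3Space S] [LocallyCompactSpace S]
    (hK : IsCompact K) (hK0 : K ⊆ slice S 0) {τ t : ℝ} (hτ : 0 ≤ τ) (hτt : τ ≤ t)
    (hτr : ENNReal.ofReal τ < M.tInfty K) :
    M.J K ∩ slice S t ⊆ M.D (slice S τ) ↔ ENNReal.ofReal (2 * t - τ) < M.tInfty K := by
  rw [J_inter_slice_subset_D_iff hK hK0 hτ hτt
    ((isCompact_closedThickening_iff_lt_tInfty hK hK0 hτ).2 hτr),
    isCompact_closedThickening_iff_lt_tInfty hK hK0 (by linarith)]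

lemma ofReal_one_sub_lt_one (n : ℕ) : ENNReal.ofReal (1 - 1 / 2 ^ n) < 1 := by
  rw [ENNReal.ofReal_lt_one]
  exact sub_lt_self _ (by positivity)

lemma one_sub_one_div_two_pow_nonneg (n : ℕ) : (0 : ℝ) ≤ 1 - 1 / 2 ^ n := by
  rw [sub_nonneg, div_le_one (by positivity)]
  exact one_le_pow₀ one_le_two

/-- The times `t_n(K)` halve the remaining time to `t^∞(K)`. -/
theorem tSeq_eq [T3Space S] [LocallyCompactSpace S] (hK : IsCompact K) (hK0 : K ⊆ slice S 0)
    (n : ℕ) : M.tSeq K n = ENNReal.ofReal (1 - 1 / 2 ^ n) * M.tInfty K := by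
  have hpos := tInfty_pos (M := M) hK hK0
  induction n with
  | zero => simp [tSeq]
  | succ n ih =>
    have hn1 : 0 < ENNReal.ofReal (1 - 1 / 2 ^ (n + 1)) := by
      rw [ENNReal.ofReal_pos, sub_pos, div_lt_one (by positivity)]
      exact one_lt_pow₀ one_lt_two (by simp)
    rw [tSeq]
    split_ifs with htop
    · have hr : M.tInfty K = ⊤ := by
        by_contra hr
        rw [ih] at htop
        exact ENNReal.mul_ne_top ENNReal.ofReal_ne_top hr htop
      rw [hr, ENNReal.mul_top hn1.ne']
    · set τ := (M.tSeq K n).toReal with hτdef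
      have hτ0 : 0 ≤ τ := ENNReal.toReal_nonneg
      have hτ : ENNReal.ofReal τ = M.tSeq K n := ENNReal.ofReal_toReal htop
      have hτr : ENNReal.ofReal τ < M.tInfty K := by
        rw [hτ]
        by_cases hr : M.tInfty K = ⊤
        · rw [hr]
          exact lt_top_iff_ne_top.2 htop
        · rw [ih]
          calc _ < 1 * M.tInfty K :=
                (ENNReal.mul_lt_mul_iff_left hpos.ne' hr).2 (ofReal_one_sub_lt_one n)
            _ = _ := one_mul _
      -- Solved for t, the condition is t < (τ + t^∞(K)) / 2, the midpoint. Times below τ are not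
      -- covered, but cannot raise the supremum.
      have hmem : ∀ t, τ ≤ t → (t ∈ {t : ℝ | 0 ≤ t ∧ M.Jplus K ∩ slice S t ⊆ M.D (slice S τ)} ↔
          ENNReal.ofReal (2 * t - τ) < M.tInfty K) := fun t ht => by
        rw [← J_inter_slice_subset_D_iff_lt hK hK0 hτ0 ht hτr, mem_ofPred_eq,
          Jplus_inter_slice hK0 (hτ0.trans ht)]
        exact and_iff_right (hτ0.trans ht)
      by_cases hr : M.tInfty K = ⊤
      · rw [hr, ENNReal.mul_top hn1.ne']
        refine ENNReal.eq_top_of_forall_nnreal_le fun x => ?_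
        have hx : max τ (x + 1) ∈ {t : ℝ | 0 ≤ t ∧ M.Jplus K ∩ slice S t ⊆ M.D (slice S τ)} :=
          (hmem _ (le_max_left _ _)).2 (by rw [hr]; exact ENNReal.ofReal_lt_top)
        refine le_trans (le_of_lt ?_) (le_sSup (mem_image_of_mem _ hx))
        rw [← ENNReal.ofReal_coe_nnreal, ENNReal.ofReal_lt_ofReal_iff (lt_max_of_lt_right (by positivity))]
        exact lt_max_of_lt_right (lt_add_one _)
      · obtain ⟨ρ, hρ0, hρ⟩ : ∃ ρ : ℝ, 0 ≤ ρ ∧ ENNReal.ofReal ρ = M.tInfty K :=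
          ⟨_, ENNReal.toReal_nonneg, ENNReal.ofReal_toReal hr⟩
        rw [← hρ] at hτr hmem ih ⊢
        have hρpos : 0 < ρ := by
          rw [← hρ] at hpos
          exact ENNReal.ofReal_pos.1 hpos
        have hτeq : τ = (1 - 1 / 2 ^ n) * ρ := by
          rw [← ENNReal.ofReal_mul (one_sub_one_div_two_pow_nonneg n)] at ih
          rw [hτdef, ih, ENNReal.toReal_ofReal (mul_nonneg (one_sub_one_div_two_pow_nonneg n) hρ0)]
        have hτρ : τ < ρ := (ENNReal.ofReal_lt_ofReal_iff hρpos).1 hτr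
        rw [← ENNReal.ofReal_mul (one_sub_one_div_two_pow_nonneg _),
          show (1 - 1 / 2 ^ (n + 1)) * ρ = (τ + ρ) / 2 by rw [hτeq, pow_succ]; field_simp; ring]
        refine le_antisymm (sSup_le ?_) (le_of_forall_lt fun c hc => ?_)
        · rintro _ ⟨t, ht, rfl⟩
          refine ENNReal.ofReal_le_ofReal ?_
          rcases lt_or_ge t τ with h | h
          · linarith
          · have := (ENNReal.ofReal_lt_ofReal_iff hρpos).1 ((hmem t h).1 ht)
            linarith
        · obtain ⟨x, hx0, hxc, hx⟩ := ENNReal.lt_iff_exists_real_btwn.1 hc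
          have hx' := (ENNReal.ofReal_lt_ofReal_iff'.1 hx).1
          refine hxc.trans_le ((ENNReal.ofReal_le_ofReal (le_max_right τ x)).trans
            (le_sSup (mem_image_of_mem _ ((hmem _ (le_max_left _ _)).2 ?_))))
          rw [ENNReal.ofReal_lt_ofReal_iff hρpos]
          rcases max_cases τ x with h | h <;> linarith [h.1]

theorem J_inter_slice_subset_D_tSeq_iff [T3Space S] [LocallyCompactSpace S] (hK : IsCompact K)
    (hK0 : K ⊆ slice S 0) (n : ℕ) {t : ℝ} (ht0 : 0 ≤ t) (ht : M.tSeq K n ≤ ENNReal.ofReal t) :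
    M.J K ∩ slice S t ⊆ M.D (slice S (M.tSeq K n).toReal) ↔
      ENNReal.ofReal t < ENNReal.ofReal (1 - 1 / 2 ^ (n + 1)) * M.tInfty K := by
  have hpos := tInfty_pos (M := M) hK hK0
  have htop : M.tSeq K n ≠ ⊤ := (ht.trans_lt ENNReal.ofReal_lt_top).ne
  have hn1 : 0 < ENNReal.ofReal (1 - 1 / 2 ^ (n + 1)) := by
    rw [ENNReal.ofReal_pos, sub_pos, div_lt_one (by positivity)]
    exact one_lt_pow₀ one_lt_two (by simp)
  have hτt : (M.tSeq K n).toReal ≤ t := ENNReal.toReal_le_of_le_ofReal ht0 ht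
  by_cases hr : M.tInfty K = ⊤
  · rw [J_inter_slice_subset_D_iff_lt hK hK0 ENNReal.toReal_nonneg hτt
      (by rw [hr]; exact ENNReal.ofReal_lt_top), hr, ENNReal.mul_top hn1.ne']
    exact iff_of_true ENNReal.ofReal_lt_top ENNReal.ofReal_lt_top
  · have hτr : ENNReal.ofReal (M.tSeq K n).toReal < M.tInfty K := by
      rw [ENNReal.ofReal_toReal htop, tSeq_eq hK hK0]
      calc _ < 1 * M.tInfty K :=
            (ENNReal.mul_lt_mul_iff_left hpos.ne' hr).2 (ofReal_one_sub_lt_one n)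
        _ = _ := one_mul _
    rw [J_inter_slice_subset_D_iff_lt hK hK0 ENNReal.toReal_nonneg hτt hτr, tSeq_eq hK hK0]
    obtain ⟨ρ, hρ0, hρ⟩ : ∃ ρ : ℝ, 0 ≤ ρ ∧ ENNReal.ofReal ρ = M.tInfty K :=
      ⟨_, ENNReal.toReal_nonneg, ENNReal.ofReal_toReal hr⟩
    rw [← hρ] at hpos ⊢
    have hρpos : 0 < ρ := ENNReal.ofReal_pos.1 hpos
    have hp := ENNReal.ofReal_pos.1 hn1
    rw [← ENNReal.ofReal_mul (one_sub_one_div_two_pow_nonneg _),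
      ← ENNReal.ofReal_mul (one_sub_one_div_two_pow_nonneg _),
      ENNReal.toReal_ofReal (mul_nonneg (one_sub_one_div_two_pow_nonneg n) hρ0),
      ENNReal.ofReal_lt_ofReal_iff hρpos, ENNReal.ofReal_lt_ofReal_iff (by positivity)]
    have h1 : (1 - 1 / 2 ^ (n + 1)) * ρ = ((1 - 1 / 2 ^ n) * ρ + ρ) / 2 := by
      rw [pow_succ]; field_simp; ring
    rw [h1]
    constructor <;> intro h <;> linarith

/-! ### Completeness -/

/-- Completeness follows from the compactness of neighbourhoods of a tail of each Cauchy
sequence. -/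
lemma isComplete_of_forall_exists_isCompact [T3Space S]
    (h : ∀ p : S, ∃ C, IsCompact C ∧ ∀ q, M.dist q p < 1 → q ∈ C) : M.IsComplete := by
  let _ := M.toEMetricSpace
  intro u hu
  have hc : CauchySeq u := EMetric.cauchySeq_iff.2 hu
  obtain ⟨N, hN⟩ := hu 1 one_pos
  obtain ⟨C, hC, hmem⟩ := h (u N)
  obtain ⟨p, -, hp⟩ := hC.isComplete (map u atTop) hc (le_principal_iff.2 (mem_map.2 (by
    filter_upwards [eventually_ge_atTop N] with n hn using hmem _ (hN n hn N le_rfl))))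
  exact ⟨p, tendsto_iff_edist_tendsto_0.1 hp⟩

lemma IsComplete.isCompact_closedThickening [T3Space S] [LocallyCompactSpace S]
    (h : M.IsComplete) {A : Set S} (hA : IsCompact A) (t : ℝ) :
    IsCompact (M.closedThickening A t) := by
  let _ := M.toEMetricSpace
  have : CompleteSpace S := EMetric.complete_of_cauchySeq_tendsto fun u hu => by
    obtain ⟨p, hp⟩ := h u (EMetric.cauchySeq_iff.1 hu)
    exact ⟨p, tendsto_iff_edist_tendsto_0.2 hp⟩
  exact isCompact_cthickening_of_completeSpace (hasShortCurves (M := M)) hA t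

lemma tInfty_eq_top_iff [T3Space S] [LocallyCompactSpace S]
    (hK : IsCompact K) (hK0 : K ⊆ slice S 0) :
    M.tInfty K = ⊤ ↔ ∀ t : ℝ, 0 ≤ t → IsCompact (M.closedThickening (Prod.snd '' K) t) := by
  constructor
  · intro h t ht
    rw [isCompact_closedThickening_iff_lt_tInfty hK hK0 ht, h]
    exact ENNReal.ofReal_lt_top
  · intro h
    refine ENNReal.eq_top_of_forall_nnreal_le fun x => le_of_lt ?_
    rw [← ENNReal.ofReal_coe_nnreal, ← isCompact_closedThickening_iff_lt_tInfty hK hK0 x.coe_nonneg]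
    exact h _ x.coe_nonneg

/-- The points at finite distance from `q` form a clopen set. -/
lemma dist_lt_top [T3Space S] [ConnectedSpace S] (p q : S) : M.dist p q < ⊤ := by
  let _ := M.toEMetricSpace
  have h1 : IsClopen (Metric.eball q ⊤) := ⟨Metric.isClosed_eball_top, Metric.isOpen_eball⟩
  have h2 : p ∈ Metric.eball q ⊤ := by
    rw [h1.eq_univ ⟨q, Metric.mem_eball_self ENNReal.zero_lt_top⟩]
    trivial
  exact h2

end
end StandardStaticSpacetime

theorem mainTheorem9
    {E : Type*} [NormedAddCommGroup E] [NormedSpace ℝ E] [FiniteDimensional ℝ E]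
    {S : Type*} [TopologicalSpace S] [T2Space S] [SecondCountableTopology S]
    [ChartedSpace E S] [IsManifold 𝓘(ℝ, E) ∞ S]
    (M : StandardStaticSpacetime E S) :
    -- the statements about a fixed compact subset `K` of `Σ_0`
    (∀ K : Set (ℝ × S), IsCompact K → K ⊆ StandardStaticSpacetime.slice S 0 →
      -- compactness of `J(K) ∩ Σ_t` passes to times of smaller absolute value
      (∀ t t' : ℝ, |t'| ≤ |t| → IsCompact (M.J K ∩ StandardStaticSpacetime.slice S t) →
        IsCompact (M.J K ∩ StandardStaticSpacetime.slice S t')) ∧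
      -- `t^∞(K) ∈ (0, ∞]`
      0 < M.tInfty K ∧
      -- `J(K) ∩ Σ_t` is compact exactly for `|t| < t^∞(K)`
      (∀ t : ℝ, IsCompact (M.J K ∩ StandardStaticSpacetime.slice S t) ↔
        ENNReal.ofReal |t| < M.tInfty K) ∧
      -- completeness implies that all `C(K, t)` are compact and that `t^∞(K) = ∞`
      (M.IsComplete →
        (∀ t : ℝ, 0 ≤ t → IsCompact (M.closedThickening (Prod.snd '' K) t)) ∧
        M.tInfty K = ⊤) ∧
      -- the converse, for one non-empty `K`, if `S` is connected
      (ConnectedSpace S → K.Nonempty → M.tInfty K = ⊤ → M.IsComplete) ∧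
      -- `J(K) ∩ Σ_t ⊆ D(Σ_0)` exactly for `t < t^∞(K) / 2`, and `t_1(K) = t^∞(K) / 2`
      (∀ t : ℝ, 0 ≤ t →
        (M.J K ∩ StandardStaticSpacetime.slice S t ⊆ M.D (StandardStaticSpacetime.slice S 0) ↔
          ENNReal.ofReal t < M.tInfty K / 2)) ∧
      M.tSeq K 1 = M.tInfty K / 2 ∧
      -- for `t ≥ t_n(K)`: `J(K) ∩ Σ_t ⊆ D(Σ_{t_n(K)})` exactly for `t < (1 - 2⁻⁽ⁿ⁺¹⁾) t^∞(K)`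
      (∀ (n : ℕ) (t : ℝ), 0 ≤ t → M.tSeq K n ≤ ENNReal.ofReal t →
        (M.J K ∩ StandardStaticSpacetime.slice S t ⊆
            M.D (StandardStaticSpacetime.slice S (M.tSeq K n).toReal) ↔
          ENNReal.ofReal t < ENNReal.ofReal (1 - 1 / 2 ^ (n + 1)) * M.tInfty K)) ∧
      -- `t_n(K) = (1 - 2⁻ⁿ) t^∞(K)`, which increases to `t^∞(K)`
      (∀ n : ℕ, M.tSeq K n = ENNReal.ofReal (1 - 1 / 2 ^ n) * M.tInfty K) ∧
      Monotone (M.tSeq K) ∧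
      (M.tInfty K ≠ ⊤ → StrictMono (M.tSeq K)) ∧
      Tendsto (M.tSeq K) atTop (𝓝 (M.tInfty K))) ∧
    -- the converse without connectedness, from all non-empty compact subsets of `Σ_0`
    ((∀ K : Set (ℝ × S), IsCompact K → K ⊆ StandardStaticSpacetime.slice S 0 → K.Nonempty →
      M.tInfty K = ⊤) → M.IsComplete) := by
  open StandardStaticSpacetime in
  have _ : LocallyCompactSpace S := Manifold.locallyCompact_of_finiteDimensional 𝓘(ℝ, E)
  have _ : T3Space S := inferInstance
  refine ⟨fun K hK hK0 => ?_, fun h => ?_⟩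
  · have hpos := tInfty_pos (M := M) hK hK0
    have hcpt : ∀ t : ℝ, IsCompact (M.J K ∩ slice S t) ↔ ENNReal.ofReal |t| < M.tInfty K :=
      fun t => by
        rw [isCompact_J_inter_slice_iff hK hK0,
          isCompact_closedThickening_iff_lt_tInfty hK hK0 (abs_nonneg t)]
    have hseq := tSeq_eq (M := M) hK hK0
    have hmono : Monotone fun n : ℕ => (1 - 1 / 2 ^ n : ℝ) := fun m n hmn =>
      sub_le_sub_left (one_div_le_one_div_of_le (by positivity)
        (pow_le_pow_right₀ one_le_two hmn)) _
    have hhalf : ENNReal.ofReal (1 - 1 / 2 ^ (0 + 1)) * M.tInfty K = M.tInfty K / 2 := by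
      rw [show (1 - 1 / 2 ^ (0 + 1) : ℝ) = 2⁻¹ by norm_num, ENNReal.ofReal_inv_of_pos two_pos,
        ENNReal.ofReal_ofNat, mul_comm, ENNReal.div_eq_inv_mul, mul_comm]
    refine ⟨fun t t' htt h => ?_, hpos, hcpt, fun h => ⟨fun t _ =>
      h.isCompact_closedThickening (hK.image continuous_snd) t, (tInfty_eq_top_iff hK hK0).2
        fun t _ => h.isCompact_closedThickening (hK.image continuous_snd) t⟩,
      fun hconn hne htop => ?_, fun t ht => ?_, ?_, fun n t ht0 ht =>
      J_inter_slice_subset_D_tSeq_iff hK hK0 n ht0 ht, hseq, ?_, ?_, ?_⟩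
    · rw [hcpt] at h ⊢
      exact (ENNReal.ofReal_le_ofReal htt).trans_lt h
    -- The ball about π(K) of radius d(p, k) + 1 contains the unit ball about p. Connectedness
    -- enters through the finiteness of d(p, k).
    · obtain ⟨k, hk⟩ := hne
      refine isComplete_of_forall_exists_isCompact fun p =>
        ⟨_, (tInfty_eq_top_iff hK hK0).1 htop ((M.dist p k.2).toReal + 1) (by positivity),
          fun q hq => mem_closedThickening_of_dist_le (mem_image_of_mem _ hk) ?_⟩
      let _ := M.toEMetricSpace
      rw [ENNReal.ofReal_add ENNReal.toReal_nonneg zero_le_one,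
        ENNReal.ofReal_toReal (dist_lt_top p k.2).ne, ENNReal.ofReal_one, add_comm]
      exact (edist_triangle q p k.2).trans (add_le_add hq.le le_rfl)
    · have h0 : M.tSeq K 0 = 0 := rfl
      have := J_inter_slice_subset_D_tSeq_iff hK hK0 0 ht (by rw [h0]; exact zero_le)
      rwa [h0, ENNReal.toReal_zero, hhalf] at this
    · rw [hseq, ← hhalf]
    · intro m n hmn
      rw [hseq, hseq]
      exact mul_le_mul_left (ENNReal.ofReal_le_ofReal (hmono hmn)) _
    · intro htop
      refine strictMono_nat_of_lt_succ fun n => ?_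
      rw [hseq, hseq]
      refine (ENNReal.mul_lt_mul_iff_left hpos.ne' htop).2 ?_
      have h1 : (1 / 2 ^ (n + 1) : ℝ) < 1 / 2 ^ n :=
        one_div_lt_one_div_of_lt (by positivity) (pow_lt_pow_right₀ one_lt_two (Nat.lt_succ_self n))
      rw [ENNReal.ofReal_lt_ofReal_iff (by linarith [one_sub_one_div_two_pow_nonneg n])]
      linarith
    · have h1 : Tendsto (fun n : ℕ => ENNReal.ofReal (1 - 1 / 2 ^ n)) atTop (𝓝 1) := by
        have h2 : Tendsto (fun n : ℕ => (1 - 1 / 2 ^ n : ℝ)) atTop (𝓝 (1 - 0)) := by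
          refine tendsto_const_nhds.sub ?_
          simpa using tendsto_pow_atTop_nhds_zero_of_lt_one (r := (2⁻¹ : ℝ)) (by norm_num)
            (by norm_num)
        simpa using ENNReal.tendsto_ofReal h2
      have h3 := ENNReal.Tendsto.mul_const (b := M.tInfty K) h1 (Or.inl one_ne_zero)
      rw [one_mul] at h3
      exact h3.congr fun n => (hseq n).symm
  -- Without connectedness each p is served by its own compact set {(0, p)}.
  · refine isComplete_of_forall_exists_isCompact fun p => ?_
    have hK : IsCompact {((0 : ℝ), p)} := isCompact_singleton
    have hK0 : {((0 : ℝ), p)} ⊆ slice S 0 := by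
      rintro _ rfl
      rfl
    refine ⟨_, (tInfty_eq_top_iff hK hK0).1 (h _ hK hK0 (singleton_nonempty _)) 1 zero_le_one,
      fun q hq => mem_closedThickening_of_dist_le (q := p) ⟨_, rfl, rfl⟩ ?_⟩
    rw [ENNReal.ofReal_one]
    exact hq.le
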